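/- **Theorem 2.2.** Let $n\ge 1$ and let $\sigma$ be a compactly supported (positive) Borel measure on $\mathbb{R}^n$ with Fourier transform $m(\xi)=\widehat{\sigma}(\xi)=\int e^{-2\pi i\, y\cdot\xi}\,d\sigma(y)$. Let $\alpha>1/2$ and $0\le\beta\le n$, and suppose that for some constant $C$: 1) $\sigma(B(x,R))\le C R^{\beta}$ for all $x\in\mathbb{R}^n$ and $0<R\le 1$, where $B(x,R)$ is the open ball (that is, $\sigma$ is locally uniformly $\beta$-dimensional); 2) $\left(\int_1^2|m(t\xi)|^2\,dt\right)^{1/2}\le C(1+|\xi|)^{-\alpha}$ for all $\xi\in\mathbb{R}^n$; 3) $\left(\int_1^2|\nabla m(t\xi)|^2\,dt\right)^{1/2}\le C(1+|\xi|)^{-\alpha}$ for all $\xi\in\mathbb{R}^n$. Let $p:\mathbb{R}^n\to(0,\infty)$ be globally log-Hölder continuous, that is, there are $c_1,c_2,p_\infty>0$ with $$|p(x)-p(y)|\le\frac{c_1}{\log(e+1/|x-y|)}\quad\text{whenever }0<|x-y|<\tfrac12,\qquad |p(x)-p_\infty|\le\frac{c_2}{\log(e+|x|)}\quad\text{for all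 }x.$$ Put $p_-=\operatorname{ess\,inf}p$ and $p_+=\operatorname{ess\,sup}p$, and assume $$\frac{2n+2\alpha-2\beta-1}{n+2\alpha-\beta-1}<p_-\le p_+<\frac{2n+2\alpha-2\beta-1}{n-\beta},$$ where the right-hand bound is read as $+\infty$ if $\beta=n$. Let $L^{p(\cdot)}(\mathbb{R}^n)$ be the space of measurable $f:\mathbb{R}^n\to\mathbb{C}$ with $\int(|f(x)|/\lambda)^{p(x)}dx<\infty$ for some $\lambda>0$, with norm $\|f\|_{p(\cdot)}=\inf\{\lambda>0:\int(|f(x)|/\lambda)^{p(x)}dx\le1\}$. For a Schwartz function $f$ let $\mathcal{M}_mf(x)=\sup_{t>0}|M_tf(x)|$, where $(M_tf)^\wedge(\xi)=\widehat f(\xi)\,m(t\xi)$. Then $\mathcal{M}_m$ is bounded on $L^{p(\cdot)}(\mathbb{R}^n)$. Precisely, there is a constant $C'$ such that: (i) for every Schwartz function $f$, $\mathcal{M}_mf(x)=\sup_{t>0}\left|\int f(x-ty)\,d\sigma(y)\right|$ for all $x$, and $\|\mathcal{M}_mf\|_{p(\cdot)}\le C'\|f\|_{p(\cdot)}$; (ii)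 for every $f\in L^{p(\cdot)}(\mathbb{R}^n)$, for almost every $x$ the integrals $\int f(x-ty)\,d\sigma(y)$ converge absolutely for all $t>0$, the function $\mathcal{M}_mf(x):=\sup_{t>0}\left|\int f(x-ty)\,d\sigma(y)\right|$ belongs to $L^{p(\cdot)}(\mathbb{R}^n)$, and $\|\mathcal{M}_mf\|_{p(\cdot)}\le C'\|f\|_{p(\cdot)}$. -/

import Mathlib

open MeasureTheory
open scoped ENNReal NNReal FourierTransform SchwartzMap

namespace MaximalMultiplier

/-- The modular `∫ (|f(x)| / lam) ^ p(x) dx` of a function on `ℝⁿ`. It is stated through `‖·‖ₑ`,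
so that it applies both to complex-valued functions and to `[0, ∞]`-valued ones (for which
`‖a‖ₑ = a`). -/
noncomputable def modular {n : ℕ} {ε : Type*} [ENorm ε] (p : EuclideanSpace ℝ (Fin n) → ℝ)
    (lam : ℝ≥0∞) (f : EuclideanSpace ℝ (Fin n) → ε) : ℝ≥0∞ :=
  ∫⁻ x, (‖f x‖ₑ / lam) ^ (p x)

/-- Membership in the variable exponent Lebesgue space `L^{p(·)}(ℝⁿ)`: `f` is (Lebesgue) measurable
and its modular is finite for some `0 < lam < ∞`. -/
def MemVarLp {n : ℕ} {ε : Type*} [TopologicalSpace ε] [ENorm ε]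
    (p : EuclideanSpace ℝ (Fin n) → ℝ) (f : EuclideanSpace ℝ (Fin n) → ε) : Prop :=
  AEStronglyMeasurable f volume ∧ ∃ lam : ℝ≥0∞, 0 < lam ∧ lam ≠ ∞ ∧ modular p lam f < ∞

/-- The Luxemburg norm of `L^{p(·)}(ℝⁿ)`, with value `∞` when there is no admissible `lam`. -/
noncomputable def varLpNorm {n : ℕ} {ε : Type*} [ENorm ε]
    (p : EuclideanSpace ℝ (Fin n) → ℝ) (f : EuclideanSpace ℝ (Fin n) → ε) : ℝ≥0∞ :=
  sInf {lam : ℝ≥0∞ | 0 < lam ∧ lam ≠ ∞ ∧ modular p lam f ≤ 1}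

/-- Globally log-Hölder continuous exponents `p : ℝⁿ → (0, ∞)`: the local log-Hölder condition
together with the log-Hölder decay condition at infinity. -/
structure GloballyLogHolder {n : ℕ} (p : EuclideanSpace ℝ (Fin n) → ℝ) : Prop where
  pos : ∀ x, 0 < p x
  loc : ∃ c₁ : ℝ, 0 < c₁ ∧ ∀ x y, ‖x - y‖ < 1 / 2 →
    |p x - p y| ≤ c₁ * (1 / Real.log (Real.exp 1 + 1 / ‖x - y‖))
  decay : ∃ pInf c₂ : ℝ, 0 < pInf ∧ 0 < c₂ ∧ ∀ x,
    |p x - pInf| ≤ c₂ * (1 / Real.log (Real.exp 1 + ‖x‖))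

/-- `σ` is carried by a compact set. -/
def CompactlySupported {n : ℕ} (σ : Measure (EuclideanSpace ℝ (Fin n))) : Prop :=
  ∃ K : Set (EuclideanSpace ℝ (Fin n)), IsCompact K ∧ σ Kᶜ = 0

/-- `σ` is locally uniformly `β`-dimensional: `σ(B(x, R)) ≤ C R ^ β` for all `x` and `0 < R ≤ 1`. -/
def LocallyUniformlyDimensional {n : ℕ} (σ : Measure (EuclideanSpace ℝ (Fin n))) (β : ℝ) : Prop :=
  ∃ C : ℝ, ∀ (x : EuclideanSpace ℝ (Fin n)) (R : ℝ), 0 < R → R ≤ 1 →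
    σ (Metric.ball x R) ≤ ENNReal.ofReal (C * R ^ β)

/-- The Fourier transform `ξ ↦ ∫ exp(-2πi ⟨y, ξ⟩) dσ(y)` of a measure, with the normalization that
`𝓕` has on functions. -/
noncomputable def measureFourier {n : ℕ} (σ : Measure (EuclideanSpace ℝ (Fin n)))
    (ξ : EuclideanSpace ℝ (Fin n)) : ℂ :=
  ∫ y, Complex.exp (-(2 * Real.pi * inner ℝ y ξ : ℝ) * Complex.I) ∂σ

/-- `|∇ m(ξ)|² = ∑ j, |∂ⱼ m(ξ)|²`. -/
noncomputable def gradNormSq {n : ℕ} (m : EuclideanSpace ℝ (Fin n) → ℂ)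
    (ξ : EuclideanSpace ℝ (Fin n)) : ℝ :=
  ∑ j : Fin n, ‖fderiv ℝ m ξ (EuclideanSpace.single j 1)‖ ^ 2

/-- The multiplier operator `M_t` on Schwartz functions: `(M_t f)^(ξ) = f^(ξ) m(tξ)`. -/
noncomputable def multiplierOp {n : ℕ} (m : EuclideanSpace ℝ (Fin n) → ℂ) (t : ℝ)
    (f : 𝓢(EuclideanSpace ℝ (Fin n), ℂ)) : EuclideanSpace ℝ (Fin n) → ℂ :=
  𝓕⁻ (fun ξ : EuclideanSpace ℝ (Fin n) =>
    𝓕 (fun x : EuclideanSpace ℝ (Fin n) => f x) ξ * m (t • ξ))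

/-- The maximal multiplier operator `sup_{t > 0} |M_t f(x)|` on Schwartz functions. -/
noncomputable def maximalMultiplier {n : ℕ} (m : EuclideanSpace ℝ (Fin n) → ℂ)
    (f : 𝓢(EuclideanSpace ℝ (Fin n), ℂ)) (x : EuclideanSpace ℝ (Fin n)) : ℝ≥0∞ :=
  ⨆ (t : ℝ) (_ : 0 < t), ‖multiplierOp m t f x‖ₑ

/-- The maximal operator `sup_{t > 0} |∫ f(x - ty) dσ(y)|`, which makes sense on general functions
and represents the maximal multiplier operator when the multiplier is the Fourier transform of
`σ`. -/
noncomputable def maximalAverage {n : ℕ} (σ : Measure (EuclideanSpace ℝ (Fin n)))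
    (f : EuclideanSpace ℝ (Fin n) → ℂ) (x : EuclideanSpace ℝ (Fin n)) : ℝ≥0∞ :=
  ⨆ (t : ℝ) (_ : 0 < t), ‖∫ y, f (x - t • y) ∂σ‖ₑ

end MaximalMultiplier

namespace MaximalMultiplier

open Metric Set Filter Topology

variable {n : ℕ}

local notation "𝔼" => EuclideanSpace ℝ (Fin n)

/-! The measure is cut dyadically in frequency: it is the sum of one low-frequency piece and of the
pieces `dyadicPiece` at scales `s = 2^(-j)`, whose Fourier transforms live on `|ξ| ~ 1/s`. Write `N
= n - β` and `γ = 2α - 1`. Each piece satisfies two estimates.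

In space, the ball condition bounds its kernel by a multiple of `s^(-N) (1 + |x|)^(-(n+1))`
(`exists_norm_smoothed_le`). Its maximal operator is therefore at most `C s^(-N)` times the
Hardy–Littlewood operator, which is bounded on `L^{q(·)}` for log-Hölder `q` bounded and bounded
away from one (`exists_modular_hlMax_le`).

In frequency, a Sobolev inequality in `t` on each dyadic interval, Plancherel, and the decay of `m`
and of its gradient give an `L²` bound with the gain `s^(γ/2)` (`lintegral_iSup_avgOp_schwartz_le`,
`exists_dyadicMult_bound`).

Interpolation along `1/p = (1-θ)/q + θ/2` is a three lines argument for the operators linearized by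
a measurable choice of time `x ↦ τ x` (`modular_interpolation`). It yields the norm `s^ε` with `ε =
-N(1-θ) + θγ/2`, which decays as soon as `θ > 2N/(2N+γ)`. For `q` to be finite and above one, `θ`
must also satisfy `θ p₊ < 2` and `p₋ (2-θ) > 2`. The assumed range of `p` leaves room for such a `θ`
(`exists_interpolation_weight`), and the pieces then sum as a geometric series.

This settles nonnegative continuous functions with compact support. Because `σ` is positive, the
operator `positiveMax` is monotone, so the bound passes to lower semicontinuous functions by
monotone convergence and to Borel functions by the Vitali–Carathéodory theorem. Almost everywhere
finiteness of `positiveMax` of `|f|` gives absolute convergence of the averages. Applied to `∞`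
times the indicator of a null set, it shows that the representative of `f` does not matter.
Measurability of the maximal function follows by approximating `f` in modular by continuous
functions. On Schwartz functions the two definitions of the maximal operator agree by Fourier
inversion and Fubini. -/

/-! ### The Hardy–Littlewood maximal function on constant exponent spaces. -/

/-- The centred Hardy–Littlewood maximal function of a `[0, ∞]`-valued function. -/
noncomputable def hlMax (f : 𝔼 → ℝ≥0∞) (x : 𝔼) : ℝ≥0∞ :=
  ⨆ (r : ℝ) (_ : 0 < r), (volume (ball x r))⁻¹ * ∫⁻ y in ball x r, f y

lemma volume_ball_eq (x : 𝔼) {r : ℝ} (hr : 0 < r) :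
    volume (ball x r) = ENNReal.ofReal (r ^ n) * volume (ball (0 : 𝔼) 1) := by
  have := Measure.addHaar_ball_of_pos (volume : Measure 𝔼) x hr
  simpa using this

lemma volume_ball_zero_pos : 0 < volume (ball (0 : 𝔼) 1) := measure_ball_pos _ _ one_pos

lemma volume_ball_zero_ne_top : volume (ball (0 : 𝔼) 1) ≠ ∞ := measure_ball_lt_top.ne

lemma le_hlMax (f : 𝔼 → ℝ≥0∞) (x : 𝔼) {r : ℝ} (hr : 0 < r) :
    ∫⁻ y in ball x r, f y ≤ volume (ball x r) * hlMax f x := by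
  have h : (volume (ball x r))⁻¹ * ∫⁻ y in ball x r, f y ≤ hlMax f x :=
    le_iSup₂ (f := fun (r : ℝ) (_ : 0 < r) => (volume (ball x r))⁻¹ * ∫⁻ y in ball x r, f y) r hr
  calc ∫⁻ y in ball x r, f y
      = volume (ball x r) * ((volume (ball x r))⁻¹ * ∫⁻ y in ball x r, f y) := by
        rw [← mul_assoc, ENNReal.mul_inv_cancel (measure_ball_pos _ _ hr).ne'
          measure_ball_lt_top.ne, one_mul]
    _ ≤ _ := by gcongr

lemma hlMax_mono {f g : 𝔼 → ℝ≥0∞} (h : ∀ x, f x ≤ g x) (x : 𝔼) : hlMax f x ≤ hlMax g x := by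
  unfold hlMax
  gcongr with r hr y
  exact h y

lemma hlMax_add_le {f g : 𝔼 → ℝ≥0∞} (hf : Measurable f) (x : 𝔼) :
    hlMax (fun y => f y + g y) x ≤ hlMax f x + hlMax g x := by
  refine iSup₂_le fun r hr => ?_
  rw [lintegral_add_left hf, mul_add]
  gcongr
  · exact le_iSup₂ (f := fun (r : ℝ) (_ : 0 < r) =>
      (volume (ball x r))⁻¹ * ∫⁻ y in ball x r, f y) r hr
  · exact le_iSup₂ (f := fun (r : ℝ) (_ : 0 < r) =>
      (volume (ball x r))⁻¹ * ∫⁻ y in ball x r, g y) r hr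

lemma hlMax_le_of_le {f : 𝔼 → ℝ≥0∞} {c : ℝ≥0∞} (h : ∀ x, f x ≤ c) (x : 𝔼) : hlMax f x ≤ c := by
  refine iSup₂_le fun r hr => ?_
  calc (volume (ball x r))⁻¹ * ∫⁻ y in ball x r, f y
      ≤ (volume (ball x r))⁻¹ * ∫⁻ _ in ball x r, c := by gcongr; exact h _
    _ = c := by
        rw [setLIntegral_const, mul_comm c, ← mul_assoc,
          ENNReal.inv_mul_cancel (measure_ball_pos _ _ hr).ne' measure_ball_lt_top.ne, one_mul]

/-- An open ball is the increasing union of slightly smaller concentric ones, and the smaller ball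
stays inside the ball of radius `r` when the centre moves a little. This makes `hlMax f` measurable
without any assumption on `f`. -/
lemma lowerSemicontinuous_setLIntegral_ball (f : 𝔼 → ℝ≥0∞) (r : ℝ) :
    LowerSemicontinuous fun x => ∫⁻ y in ball x r, f y := by
  intro x a ha
  have hU : ball x r = ⋃ k : ℕ, ball x (r - 1 / (k + 1)) := by
    ext y
    simp only [mem_ball, mem_iUnion]
    constructor
    · intro h
      obtain ⟨k, hk⟩ := exists_nat_one_div_lt (sub_pos.2 h)
      exact ⟨k, by linarith⟩
    · rintro ⟨k, hk⟩
      have : (0 : ℝ) < 1 / (k + 1) := by positivity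
      linarith
  have hmono : Monotone fun k : ℕ => ball x (r - 1 / ((k : ℝ) + 1)) := by
    intro i j hij
    refine ball_subset_ball ?_
    have : (1 : ℝ) / (j + 1) ≤ 1 / (i + 1) := by
      have : (i : ℝ) ≤ j := by exact_mod_cast hij
      apply one_div_le_one_div_of_le <;> [positivity; linarith]
    linarith
  have hlim : ∫⁻ y in ball x r, f y = ⨆ k : ℕ, ∫⁻ y in ball x (r - 1 / ((k : ℝ) + 1)), f y := by
    rw [hU]
    exact setLIntegral_iUnion_of_directed f hmono.directed_le
  replace ha : a < ∫⁻ y in ball x r, f y := ha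
  rw [hlim] at ha
  obtain ⟨k, hk⟩ := lt_iSup_iff.1 ha
  have hk0 : (0 : ℝ) < 1 / (k + 1) := by positivity
  filter_upwards [ball_mem_nhds x hk0] with z hz
  refine hk.trans_le (lintegral_mono_set (ball_subset_ball' ?_))
  rw [dist_comm]
  have := mem_ball.1 hz
  linarith

lemma volume_ball_congr (x y : 𝔼) (r : ℝ) : volume (ball x r) = volume (ball y r) := by
  rw [Measure.addHaar_ball_center, Measure.addHaar_ball_center _ y]

lemma lowerSemicontinuous_hlMax (f : 𝔼 → ℝ≥0∞) : LowerSemicontinuous (hlMax f) := by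
  unfold hlMax
  refine lowerSemicontinuous_iSup fun r => lowerSemicontinuous_iSup fun hr => ?_
  have h := lowerSemicontinuous_setLIntegral_ball f r
  have hc : Continuous fun a : ℝ≥0∞ => (volume (ball (0 : 𝔼) r))⁻¹ * a :=
    ENNReal.continuous_const_mul (ENNReal.inv_ne_top.2 (measure_ball_pos _ _ hr).ne')
  have := hc.comp_lowerSemicontinuous h (fun a b hab => by dsimp; gcongr)
  convert this using 2 with x
  simp only [Function.comp]
  rw [volume_ball_congr x 0]

lemma measurable_hlMax (f : 𝔼 → ℝ≥0∞) : Measurable (hlMax f) :=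
  (lowerSemicontinuous_hlMax f).measurable

/-- The weak type `(1, 1)` inequality for the Hardy–Littlewood maximal function. -/
lemma volume_lt_hlMax_le (f : 𝔼 → ℝ≥0∞) (a : ℝ≥0∞) :
    a * volume {x | a < hlMax f x} ≤ 5 ^ n * ∫⁻ y, f y := by
  -- The Vitali covering lemma needs bounded radii, hence the cap `R`; it is removed at the end by
  -- monotone union.
  set A : ℕ → Set 𝔼 := fun R =>
    {x | ∃ r : ℝ, 0 < r ∧ r ≤ R ∧ a * volume (ball x r) ≤ ∫⁻ y in ball x r, f y} with hA
  have hsub : {x | a < hlMax f x} ⊆ ⋃ R, A R := by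
    intro x hx
    obtain ⟨r, hr⟩ := lt_iSup_iff.1 (show a < hlMax f x from hx)
    obtain ⟨h0, hr⟩ := lt_iSup_iff.1 hr
    obtain ⟨R, hR⟩ := exists_nat_ge r
    refine mem_iUnion.2 ⟨R, r, h0, hR, ?_⟩
    have hv0 := (measure_ball_pos (volume : Measure 𝔼) x h0).ne'
    have hv1 : volume (ball x r) ≠ ∞ := measure_ball_lt_top.ne
    calc a * volume (ball x r)
        ≤ (volume (ball x r))⁻¹ * (∫⁻ y in ball x r, f y) * volume (ball x r) := by gcongr
      _ = _ := by
        rw [mul_comm, ← mul_assoc, ENNReal.mul_inv_cancel hv0 hv1, one_mul]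
  have hmono : Monotone A := by
    rintro i j hij x ⟨r, h0, h1, h2⟩
    exact ⟨r, h0, h1.trans (by exact_mod_cast hij), h2⟩
  have key : ∀ R, a * volume (A R) ≤ 5 ^ n * ∫⁻ y, f y := by
    intro R
    choose! r h0 h1 h2 using (fun x (hx : x ∈ A R) => hx)
    obtain ⟨u, hu, hdisj, hcov⟩ := Vitali.exists_disjoint_subfamily_covering_enlargement_closedBall
      (A R) (fun x => x) r R h1 5 (by norm_num)
    have hdisj' : u.PairwiseDisjoint fun x => ball x (r x) :=
      hdisj.mono fun x => ball_subset_closedBall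
    have hcount : u.Countable := hdisj'.countable_of_isOpen (fun _ _ => isOpen_ball)
      (fun x hx => nonempty_ball.2 (h0 x (hu hx)))
    have hvol : ∀ x ∈ u, volume (closedBall x (5 * r x)) = 5 ^ n * volume (ball x (r x)) := by
      intro x hx
      have hr := h0 x (hu hx)
      rw [Measure.addHaar_closedBall _ _ (by positivity), volume_ball_eq x hr, ← mul_assoc]
      congr 1
      simp only [finrank_euclideanSpace, Fintype.card_fin]
      rw [mul_pow, ENNReal.ofReal_mul (by positivity), ENNReal.ofReal_pow (by norm_num)]
      norm_num
    have hAsub : A R ⊆ ⋃ x ∈ u, closedBall x (5 * r x) := by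
      intro x hx
      obtain ⟨b, hb, hsub⟩ := hcov x hx
      exact mem_iUnion₂.2 ⟨b, hb, hsub (mem_closedBall_self (h0 x hx).le)⟩
    have : Countable u := hcount
    calc a * volume (A R) ≤ a * volume (⋃ x ∈ u, closedBall x (5 * r x)) := by gcongr
      _ ≤ a * ∑' x : u, volume (closedBall (x : 𝔼) (5 * r x)) := by
        gcongr
        exact measure_biUnion_le _ hcount _
      _ = ∑' x : u, 5 ^ n * (a * volume (ball (x : 𝔼) (r x))) := by
        rw [← ENNReal.tsum_mul_left]
        refine tsum_congr fun x => ?_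
        rw [hvol x x.2]; ring
      _ ≤ ∑' x : u, 5 ^ n * ∫⁻ y in ball (x : 𝔼) (r x), f y := by
        gcongr with x
        exact h2 x (hu x.2)
      _ = 5 ^ n * ∫⁻ y in ⋃ x ∈ u, ball (x : 𝔼) (r x), f y := by
        rw [ENNReal.tsum_mul_left, lintegral_biUnion hcount (fun _ _ => measurableSet_ball) hdisj']
      _ ≤ _ := by
        gcongr
        exact Measure.restrict_le_self
  calc a * volume {x | a < hlMax f x} ≤ a * volume (⋃ R, A R) := by gcongr
    _ = ⨆ R, a * volume (A R) := by
      rw [hmono.measure_iUnion, ENNReal.mul_iSup]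
    _ ≤ _ := iSup_le key

/-- The layer cake formula at a single value. The value `∞` is included because the maximal function
may be infinite. -/
lemma lintegral_Ioi_rpow_lt (a : ℝ≥0∞) {s : ℝ} (hs : 0 < s) :
    ∫⁻ t in Ioi (0 : ℝ), (if ENNReal.ofReal t < a then ENNReal.ofReal (t ^ (s - 1)) else 0)
      = a ^ s / ENNReal.ofReal s := by
  have key : ∀ b : ℝ, 0 ≤ b → ∫⁻ t in Ioo (0 : ℝ) b, ENNReal.ofReal (t ^ (s - 1))
      = ENNReal.ofReal b ^ s / ENNReal.ofReal s := by
    intro b hb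
    have hint : IntervalIntegrable (fun t : ℝ => t ^ (s - 1)) volume 0 b :=
      intervalIntegral.intervalIntegrable_rpow' (by linarith)
    rw [intervalIntegrable_iff_integrableOn_Ioo_of_le hb] at hint
    rw [← ofReal_integral_eq_lintegral_ofReal hint, ← integral_Ioc_eq_integral_Ioo,
      ← intervalIntegral.integral_of_le hb, integral_rpow (Or.inl (by linarith))]
    · rw [sub_add_cancel, Real.zero_rpow hs.ne', sub_zero, ENNReal.ofReal_div_of_pos hs,
        ENNReal.ofReal_rpow_of_nonneg hb hs.le]
    · exact (ae_restrict_iff' measurableSet_Ioo).2 (ae_of_all _ fun t ht =>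
        Real.rpow_nonneg ht.1.le _)
  rcases eq_or_ne a ∞ with rfl | ha
  · rw [ENNReal.top_rpow_of_pos hs, ENNReal.top_div_of_ne_top ENNReal.ofReal_ne_top]
    refine ENNReal.eq_top_of_forall_nnreal_le fun c => ?_
    set b : ℝ := (c * s) ^ (s⁻¹) with hbdef
    have hb : 0 ≤ b := by positivity
    calc (c : ℝ≥0∞) = ENNReal.ofReal b ^ s / ENNReal.ofReal s := by
          rw [ENNReal.ofReal_rpow_of_nonneg hb hs.le, hbdef, ← Real.rpow_mul (by positivity),
            inv_mul_cancel₀ hs.ne', Real.rpow_one, ← ENNReal.ofReal_div_of_pos hs,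
            mul_div_cancel_right₀ _ hs.ne', ENNReal.ofReal_coe_nnreal]
      _ = ∫⁻ t in Ioo (0 : ℝ) b, ENNReal.ofReal (t ^ (s - 1)) := (key b hb).symm
      _ ≤ ∫⁻ t in Ioi (0 : ℝ), ENNReal.ofReal (t ^ (s - 1)) :=
        lintegral_mono_set fun t ht => ht.1
      _ = _ := by simp
  · lift a to ℝ≥0 using ha
    rw [← ENNReal.ofReal_coe_nnreal, ← key a a.2, ← lintegral_indicator measurableSet_Ioi,
      ← lintegral_indicator measurableSet_Ioo]
    refine lintegral_congr fun t => ?_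
    by_cases h0 : 0 < t
    · simp only [indicator, mem_Ioi, h0, mem_Ioo, true_and]
      simp only [if_true]
      congr 1
      rw [ENNReal.ofReal_lt_ofReal_iff_of_nonneg h0.le]
    · simp [indicator, h0]

/-- The strong type `(r, r)` inequality for the Hardy–Littlewood maximal function. -/
lemma exists_lintegral_hlMax_rpow_le {r : ℝ} (hr : 1 < r) :
    ∃ C : ℝ≥0, ∀ f : 𝔼 → ℝ≥0∞, Measurable f →
      ∫⁻ x, hlMax f x ^ r ≤ C * ∫⁻ x, f x ^ r := by
  have hr0 : 0 < r := by linarith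
  have hr1 : 0 < r - 1 := by linarith
  set c : ℝ≥0∞ := ENNReal.ofReal r * (2 * 5 ^ n * (2 ^ (r - 1) / ENNReal.ofReal (r - 1))) with hc
  have hctop : c ≠ ∞ := by
    refine ENNReal.mul_ne_top ENNReal.ofReal_ne_top (ENNReal.mul_ne_top ?_ ?_)
    · exact ENNReal.mul_ne_top (by simp) (by simp)
    · refine ENNReal.div_ne_top (ENNReal.rpow_ne_top_of_nonneg hr1.le (by simp)) ?_
      simpa using hr
  refine ⟨c.toNNReal, fun f hf => ?_⟩
  rw [ENNReal.coe_toNNReal hctop]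
  have hM := measurable_hlMax f
  -- The part of `f` of height at most `t/2` contributes at most `t/2` to the maximal function, so
  -- the weak type inequality is charged only on `{2f > t}`.
  have hm : ∀ t : ℝ, 0 < t → volume {x | ENNReal.ofReal t < hlMax f x} ≤
      (ENNReal.ofReal t)⁻¹ * (2 * 5 ^ n * ∫⁻ y, if ENNReal.ofReal t < 2 * f y then f y else 0) := by
    intro t ht
    have hmeas : MeasurableSet {y | ENNReal.ofReal t < 2 * f y} :=
      measurableSet_lt measurable_const (hf.const_mul 2)
    set g : 𝔼 → ℝ≥0∞ := fun y => if ENNReal.ofReal t < 2 * f y then f y else 0 with hg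
    have hgm : Measurable g := Measurable.ite hmeas hf measurable_const
    have hle : ∀ x, hlMax f x ≤ hlMax g x + ENNReal.ofReal t / 2 := by
      intro x
      calc hlMax f x ≤ hlMax (fun y => g y + ENNReal.ofReal t / 2) x := by
            refine hlMax_mono (fun y => ?_) x
            simp only [hg]
            split_ifs with h
            · exact le_self_add
            · rw [zero_add, ENNReal.le_div_iff_mul_le (by simp) (by simp), mul_comm]
              exact not_lt.1 h
        _ ≤ hlMax g x + hlMax (fun _ => ENNReal.ofReal t / 2) x := hlMax_add_le hgm x
        _ ≤ _ := by
          gcongr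
          exact hlMax_le_of_le (fun _ => le_rfl) x
    have hsub : {x | ENNReal.ofReal t < hlMax f x} ⊆ {x | ENNReal.ofReal t / 2 < hlMax g x} := by
      intro x hx
      have h1 : ENNReal.ofReal t < hlMax g x + ENNReal.ofReal t / 2 := lt_of_lt_of_le hx (hle x)
      by_contra h2
      have h3 : hlMax g x ≤ ENNReal.ofReal t / 2 := not_lt.1 h2
      have : hlMax g x + ENNReal.ofReal t / 2 ≤ ENNReal.ofReal t := by
        calc _ ≤ ENNReal.ofReal t / 2 + ENNReal.ofReal t / 2 := by gcongr
          _ = _ := ENNReal.add_halves _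
      exact absurd h1 (not_lt.2 this)
    have hw := volume_lt_hlMax_le g (ENNReal.ofReal t / 2)
    have ht0 : ENNReal.ofReal t ≠ 0 := by simpa using ht
    calc volume {x | ENNReal.ofReal t < hlMax f x}
        ≤ volume {x | ENNReal.ofReal t / 2 < hlMax g x} := measure_mono hsub
      _ = (ENNReal.ofReal t)⁻¹ * (2 * (ENNReal.ofReal t / 2
            * volume {x | ENNReal.ofReal t / 2 < hlMax g x})) := by
        rw [← mul_assoc 2, ENNReal.mul_div_cancel (by simp) (by simp), ← mul_assoc,
          ENNReal.inv_mul_cancel ht0 ENNReal.ofReal_ne_top, one_mul]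
      _ ≤ _ := by
        rw [mul_assoc 2]
        gcongr
  have hlayer : ∀ x, hlMax f x ^ r = ENNReal.ofReal r * ∫⁻ t in Ioi (0 : ℝ),
      (if ENNReal.ofReal t < hlMax f x then ENNReal.ofReal (t ^ (r - 1)) else 0) := by
    intro x
    rw [lintegral_Ioi_rpow_lt _ hr0, ENNReal.mul_div_cancel (by simpa using hr0)
      ENNReal.ofReal_ne_top]
  have hms1 : Measurable (Function.uncurry fun (x : 𝔼) (t : ℝ) =>
      (if ENNReal.ofReal t < hlMax f x then ENNReal.ofReal (t ^ (r - 1)) else 0)) := by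
    refine Measurable.ite ?_ ?_ measurable_const
    · exact measurableSet_lt (ENNReal.measurable_ofReal.comp measurable_snd)
        (hM.comp measurable_fst)
    · exact ENNReal.measurable_ofReal.comp (measurable_snd.pow_const _)
  have hms2 : Measurable (Function.uncurry fun (t : ℝ) (y : 𝔼) =>
      (if ENNReal.ofReal t < 2 * f y then ENNReal.ofReal (t ^ (r - 1 - 1)) * f y else 0)) := by
    refine Measurable.ite ?_ ?_ measurable_const
    · exact measurableSet_lt (ENNReal.measurable_ofReal.comp measurable_fst)
        ((hf.comp measurable_snd).const_mul 2)
    · exact (ENNReal.measurable_ofReal.comp (measurable_fst.pow_const _)).mul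
        (hf.comp measurable_snd)
  calc ∫⁻ x, hlMax f x ^ r
      = ENNReal.ofReal r * ∫⁻ x, ∫⁻ t in Ioi (0 : ℝ),
          (if ENNReal.ofReal t < hlMax f x then ENNReal.ofReal (t ^ (r - 1)) else 0) := by
        simp_rw [hlayer]
        rw [lintegral_const_mul' _ _ ENNReal.ofReal_ne_top]
    _ = ENNReal.ofReal r * ∫⁻ t in Ioi (0 : ℝ), ∫⁻ x,
          (if ENNReal.ofReal t < hlMax f x then ENNReal.ofReal (t ^ (r - 1)) else 0) := by
        rw [lintegral_lintegral_swap hms1.aemeasurable]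
    _ = ENNReal.ofReal r * ∫⁻ t in Ioi (0 : ℝ), ENNReal.ofReal (t ^ (r - 1)) *
          volume {x | ENNReal.ofReal t < hlMax f x} := by
        congr 1
        refine lintegral_congr fun t => ?_
        rw [← setLIntegral_const, ← lintegral_indicator (measurableSet_lt measurable_const hM)]
        simp only [indicator, mem_ofPred_eq]
    _ ≤ ENNReal.ofReal r * ∫⁻ t in Ioi (0 : ℝ), 2 * 5 ^ n * ∫⁻ y,
          if ENNReal.ofReal t < 2 * f y then ENNReal.ofReal (t ^ (r - 1 - 1)) * f y else 0 := by
        gcongr 1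
        refine setLIntegral_mono' measurableSet_Ioi fun t ht => ?_
        have ht' : 0 < t := ht
        calc _ ≤ ENNReal.ofReal (t ^ (r - 1)) * ((ENNReal.ofReal t)⁻¹ * (2 * 5 ^ n *
                ∫⁻ y, if ENNReal.ofReal t < 2 * f y then f y else 0)) := by
              gcongr
              exact hm t ht'
          _ = 2 * 5 ^ n * (ENNReal.ofReal (t ^ (r - 1 - 1)) *
                ∫⁻ y, if ENNReal.ofReal t < 2 * f y then f y else 0) := by
              rw [Real.rpow_sub_one ht'.ne' (r - 1), ENNReal.ofReal_div_of_pos ht', div_eq_mul_inv]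
              ring
          _ ≤ _ := by
              rw [← lintegral_const_mul' _ _ ENNReal.ofReal_ne_top]
              gcongr with y
              split_ifs <;> simp
    _ = ENNReal.ofReal r * (2 * 5 ^ n * ∫⁻ y, ∫⁻ t in Ioi (0 : ℝ),
          if ENNReal.ofReal t < 2 * f y then ENNReal.ofReal (t ^ (r - 1 - 1)) * f y else 0) := by
        rw [lintegral_const_mul' _ _ (ENNReal.mul_ne_top (by simp) (by simp)),
          lintegral_lintegral_swap hms2.aemeasurable]
    _ ≤ ENNReal.ofReal r * (2 * 5 ^ n * ∫⁻ y,
          (2 ^ (r - 1) / ENNReal.ofReal (r - 1)) * f y ^ r) := by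
        gcongr with y
        calc _ = ∫⁻ t in Ioi (0 : ℝ), f y *
              (if ENNReal.ofReal t < 2 * f y then ENNReal.ofReal (t ^ (r - 1 - 1)) else 0) := by
              refine lintegral_congr fun t => ?_
              split_ifs <;> simp [mul_comm]
          _ = f y * ((2 * f y) ^ (r - 1) / ENNReal.ofReal (r - 1)) := by
              rw [lintegral_const_mul _ ?_, lintegral_Ioi_rpow_lt _ hr1]
              refine Measurable.ite (measurableSet_lt ENNReal.measurable_ofReal measurable_const)
                ?_ measurable_const
              exact ENNReal.measurable_ofReal.comp (measurable_id.pow_const _)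
          _ = (2 ^ (r - 1) / ENNReal.ofReal (r - 1)) * (f y ^ (1 : ℝ) * f y ^ (r - 1)) := by
              rw [ENNReal.mul_rpow_of_nonneg _ _ hr1.le, ENNReal.rpow_one]
              simp only [div_eq_mul_inv]; ring
          _ = _ := by
              rw [← ENNReal.rpow_add_of_nonneg _ _ zero_le_one hr1.le]
              congr 2; ring
          _ ≤ _ := le_rfl
    _ = _ := by
        rw [lintegral_const_mul _ (hf.pow_const _), hc]; ring

/-! ### Kernels with radial decay and the maximal function. -/

/-- One term suffices: for the least `k` with `a < 2^k`, minimality gives `2^k ≤ 2(1 + a)`. The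
lemma turns integration of a decaying kernel into a sum over dyadic balls, both for Lebesgue measure
and for `σ`. -/
lemma one_add_rpow_neg_le_tsum {a : ℝ} (ha : 0 ≤ a) :
    ENNReal.ofReal ((1 + a) ^ (-((n : ℝ) + 1))) ≤
      ∑' k : ℕ, if a < 2 ^ k then (2 : ℝ≥0∞) ^ (n + 1) * ((2 : ℝ≥0∞) ^ (n + 1))⁻¹ ^ k else 0 := by
  have hex : ∃ k : ℕ, a < 2 ^ k := pow_unbounded_of_one_lt a one_lt_two
  classical
  set k := Nat.find hex with hk
  have hak : a < 2 ^ k := Nat.find_spec hex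
  refine le_trans ?_ (ENNReal.le_tsum k)
  rw [if_pos hak]
  have h2 : (2 : ℝ) ^ k ≤ 2 * (1 + a) := by
    rcases Nat.eq_zero_or_pos k with h0 | h0
    · rw [h0]; linarith [pow_zero (2 : ℝ)]
    · have : ¬ a < 2 ^ (k - 1) := Nat.find_min hex (Nat.sub_one_lt h0.ne')
      have h3 : (2 : ℝ) ^ k = 2 * 2 ^ (k - 1) := by
        rw [← pow_succ']; congr 1; omega
      rw [h3]
      linarith [not_lt.1 this]
  have h3 : (1 + a) ^ (-((n : ℝ) + 1)) ≤ 2 ^ (n + 1) * (((2 : ℝ) ^ (n + 1))⁻¹) ^ k := by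
    have h4 : (1 + a) ^ (-((n : ℝ) + 1)) = ((1 + a) ^ (n + 1))⁻¹ := by
      rw [Real.rpow_neg (by positivity)]
      congr 1
      exact_mod_cast Real.rpow_natCast (1 + a) (n + 1)
    rw [h4, inv_pow, ← div_eq_mul_inv, ← pow_mul, mul_comm (n + 1), pow_mul, ← div_pow, ← inv_pow]
    gcongr
    rw [inv_le_comm₀ (by positivity) (by positivity), inv_div, div_le_iff₀ (by positivity)]
    linarith
  refine (ENNReal.ofReal_le_ofReal h3).trans (le_of_eq ?_)
  rw [ENNReal.ofReal_mul (by positivity),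
    ENNReal.ofReal_pow (p := ((2 : ℝ) ^ (n + 1))⁻¹) (by positivity),
    ENNReal.ofReal_inv_of_pos (by positivity), ENNReal.ofReal_pow (by norm_num)]
  norm_num

/-- Integration against the dilates of an integrable radially decreasing kernel is controlled by
the Hardy–Littlewood maximal function. -/
lemma lintegral_dilate_le_hlMax (f : 𝔼 → ℝ≥0∞) (hf : Measurable f) (x : 𝔼) {t : ℝ} (ht : 0 < t) :
    ∫⁻ y, ENNReal.ofReal ((t ^ n)⁻¹ * (1 + ‖t⁻¹ • (x - y)‖) ^ (-((n : ℝ) + 1))) * f y ≤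
      2 ^ (n + 2) * volume (ball (0 : 𝔼) 1) * hlMax f x := by
  set c : ℝ≥0∞ := 2 ^ (n + 1) with hc
  have hc0 : c ≠ 0 := by simp [hc]
  have hct : c ≠ ∞ := by simp [hc]
  have hmem : ∀ (k : ℕ) (y : 𝔼), ‖t⁻¹ • (x - y)‖ < 2 ^ k ↔ y ∈ ball x (t * 2 ^ k) := by
    intro k y
    rw [norm_smul, norm_inv, Real.norm_of_nonneg ht.le, inv_mul_lt_iff₀ ht, mem_ball, dist_comm,
      dist_eq_norm]
  calc ∫⁻ y, ENNReal.ofReal ((t ^ n)⁻¹ * (1 + ‖t⁻¹ • (x - y)‖) ^ (-((n : ℝ) + 1))) * f y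
      ≤ ∫⁻ y, ∑' k : ℕ, ENNReal.ofReal ((t ^ n)⁻¹) * (c * c⁻¹ ^ k) *
          (ball x (t * 2 ^ k)).indicator f y := by
        gcongr with y
        rw [ENNReal.ofReal_mul (by positivity)]
        calc _ ≤ ENNReal.ofReal ((t ^ n)⁻¹) * (∑' k : ℕ, if ‖t⁻¹ • (x - y)‖ < 2 ^ k then
                c * c⁻¹ ^ k else 0) * f y := by
              gcongr
              exact one_add_rpow_neg_le_tsum (norm_nonneg _)
          _ = _ := by
              rw [← ENNReal.tsum_mul_left, ← ENNReal.tsum_mul_right]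
              refine tsum_congr fun k => ?_
              by_cases h : y ∈ ball x (t * 2 ^ k)
              · rw [if_pos ((hmem k y).2 h), indicator_of_mem h]
              · rw [if_neg (mt (hmem k y).1 h), indicator_of_notMem h]
                simp
    _ = ∑' k : ℕ, ENNReal.ofReal ((t ^ n)⁻¹) * (c * c⁻¹ ^ k) *
          ∫⁻ y in ball x (t * 2 ^ k), f y := by
        rw [lintegral_tsum]
        · refine tsum_congr fun k => ?_
          rw [lintegral_const_mul _ (hf.indicator measurableSet_ball),
            lintegral_indicator measurableSet_ball]
        · intro k
          exact ((hf.indicator measurableSet_ball).const_mul _).aemeasurable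
    _ ≤ ∑' k : ℕ, ENNReal.ofReal ((t ^ n)⁻¹) * (c * c⁻¹ ^ k) *
          (volume (ball x (t * 2 ^ k)) * hlMax f x) := by
        gcongr with k
        exact le_hlMax f x (by positivity)
    _ = ∑' k : ℕ, (2 : ℝ≥0∞)⁻¹ ^ k * (c * volume (ball (0 : 𝔼) 1) * hlMax f x) := by
        refine tsum_congr fun k => ?_
        rw [volume_ball_eq x (by positivity)]
        have h1 : ENNReal.ofReal ((t ^ n)⁻¹) * ENNReal.ofReal ((t * 2 ^ k) ^ n) = (2 ^ k) ^ n := by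
          rw [← ENNReal.ofReal_mul (by positivity), mul_pow, inv_mul_cancel_left₀ (by positivity),
            ENNReal.ofReal_pow (by positivity), ENNReal.ofReal_pow (by positivity)]
          norm_num
        -- The weight `2^(-(n+1)k)` beats the volume growth `2^(nk)` and leaves a geometric series.
        have h2 : c⁻¹ ^ k * (2 ^ k) ^ n = (2 : ℝ≥0∞)⁻¹ ^ k := by
          rw [← pow_mul, mul_comm k n, pow_mul, ← mul_pow, hc, pow_succ, ENNReal.mul_inv (by simp)
            (by simp), mul_right_comm, ENNReal.inv_mul_cancel (by simp) (by simp), one_mul]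
        calc _ = (ENNReal.ofReal ((t ^ n)⁻¹) * ENNReal.ofReal ((t * 2 ^ k) ^ n)) * c⁻¹ ^ k *
              (c * volume (ball (0 : 𝔼) 1) * hlMax f x) := by ring
          _ = _ := by rw [h1, mul_comm ((2 ^ k) ^ n), h2]
    _ = _ := by
        rw [ENNReal.tsum_mul_right, ENNReal.tsum_geometric, ENNReal.one_sub_inv_two, inv_inv, hc]
        ring

/-! ### The Hardy–Littlewood maximal theorem with variable exponent. -/

/-- The average of a `[0, ∞]`-valued function over a ball. -/
noncomputable def ballAvg (f : 𝔼 → ℝ≥0∞) (x : 𝔼) (r : ℝ) : ℝ≥0∞ :=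
  (volume (ball x r))⁻¹ * ∫⁻ y in ball x r, f y

lemma ballAvg_le_hlMax (f : 𝔼 → ℝ≥0∞) (x : 𝔼) {r : ℝ} (hr : 0 < r) :
    ballAvg f x r ≤ hlMax f x :=
  le_iSup₂ (f := fun (r : ℝ) (_ : 0 < r) => (volume (ball x r))⁻¹ * ∫⁻ y in ball x r, f y) r hr

lemma hlMax_le {f : 𝔼 → ℝ≥0∞} {x : 𝔼} {c : ℝ≥0∞} (h : ∀ r, 0 < r → ballAvg f x r ≤ c) :
    hlMax f x ≤ c :=
  iSup₂_le h

lemma ballAvg_mono_on {f g : 𝔼 → ℝ≥0∞} {x : 𝔼} {r : ℝ} (h : ∀ y ∈ ball x r, f y ≤ g y) :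
    ballAvg f x r ≤ ballAvg g x r := by
  unfold ballAvg
  gcongr 1
  exact setLIntegral_mono' measurableSet_ball h

/-- Jensen's inequality, in the form of monotonicity of `L^s` norms for the normalized measure on
the ball. -/
lemma ballAvg_rpow_le {f : 𝔼 → ℝ≥0∞} (hf : Measurable f) (x : 𝔼) {r s : ℝ} (hr : 0 < r)
    (hs : 1 ≤ s) : ballAvg f x r ^ s ≤ ballAvg (fun y => f y ^ s) x r := by
  set μ : Measure 𝔼 := (volume (ball x r))⁻¹ • volume.restrict (ball x r) with hμ
  have : IsProbabilityMeasure μ := by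
    constructor
    rw [hμ, Measure.smul_apply, Measure.restrict_apply_univ, smul_eq_mul,
      ENNReal.inv_mul_cancel (measure_ball_pos _ _ hr).ne' measure_ball_lt_top.ne]
  have h := eLpNorm'_le_eLpNorm'_of_exponent_le (μ := μ) (f := f) one_pos hs
    hf.aestronglyMeasurable
  simp only [eLpNorm', enorm_eq_self, ENNReal.rpow_one, div_one] at h
  rw [one_div, ENNReal.le_rpow_inv_iff (by linarith)] at h
  simpa [ballAvg, hμ, lintegral_smul_measure] using h

lemma rpow_le_one_add_rpow {a : ℝ≥0∞} {c : ℝ} (hc : 1 ≤ c) (ha : a ≤ ENNReal.ofReal c) {d L : ℝ}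
    (hd : 0 ≤ d) (hdL : d ≤ L) : a ^ d ≤ ENNReal.ofReal (c ^ L) := by
  calc a ^ d ≤ ENNReal.ofReal c ^ d := by gcongr
    _ = ENNReal.ofReal (c ^ d) := ENNReal.ofReal_rpow_of_nonneg (by linarith) hd
    _ ≤ _ := ENNReal.ofReal_le_ofReal (Real.rpow_le_rpow_of_exponent_le hc hdL)

/-- The local estimate behind the maximal theorem: for a function which vanishes wherever it is
less than one, only the local log-Hölder condition is used. -/
lemma exists_hlMax_rpow_le_of_one_le {q s : 𝔼 → ℝ} {S c : ℝ} (hs1 : ∀ x, 1 ≤ s x)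
    (hsS : ∀ x, s x ≤ S) (hsq : ∀ x, s x ≤ q x) (hc : 0 < c)
    (hloc : ∀ x y, ‖x - y‖ < 1 / 2 → |s x - s y| ≤ c * (1 / Real.log (Real.exp 1 + 1 / ‖x - y‖))) :
    ∃ C : ℝ≥0, ∀ f : 𝔼 → ℝ≥0∞, Measurable f → (∀ x, f x = 0 ∨ 1 ≤ f x) →
      ∫⁻ x, f x ^ q x ≤ 1 → ∀ x, hlMax f x ^ s x ≤ C * hlMax (fun y => f y ^ s y) x := by
  obtain ⟨v, hv0, hv⟩ : ∃ v : ℝ, 0 < v ∧ volume (ball (0 : 𝔼) 1) = ENNReal.ofReal v := by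
    refine ⟨(volume (ball (0 : 𝔼) 1)).toReal, ?_, ?_⟩
    · exact ENNReal.toReal_pos volume_ball_zero_pos.ne' volume_ball_zero_ne_top
    · rw [ENNReal.ofReal_toReal volume_ball_zero_ne_top]
  set V : ℝ := max 1 v⁻¹ with hV
  have hV1 : 1 ≤ V := le_max_left _ _
  have hS : 1 ≤ S := (hs1 0).trans (hsS 0)
  set C : ℝ := V ^ c * Real.exp (n * c) + (2 ^ n * V) ^ S with hC
  refine ⟨C.toNNReal, fun f hf hf1 hmod x => ?_⟩
  have hsx : 0 < s x := by linarith [hs1 x]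
  rw [← ENNReal.le_rpow_inv_iff hsx]
  refine hlMax_le fun r hr => ?_
  rw [ENNReal.le_rpow_inv_iff hsx]
  have hpow : ∀ (y : 𝔼) {a b : ℝ}, 0 < a → a ≤ b → f y ^ a ≤ f y ^ b := by
    intro y a b ha hab
    rcases hf1 y with h | h
    · rw [h, ENNReal.zero_rpow_of_pos ha, ENNReal.zero_rpow_of_pos (by linarith)]
    · exact ENNReal.rpow_le_rpow_of_exponent_le h hab
  have hvol : (volume (ball x r))⁻¹ = ENNReal.ofReal (v⁻¹ * (r⁻¹) ^ n) := by
    rw [volume_ball_eq x hr, hv, ← ENNReal.ofReal_mul (by positivity),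
      ← ENNReal.ofReal_inv_of_pos (by positivity)]
    congr 1
    rw [mul_inv, inv_pow, mul_comm]
  -- Where `f` is zero or at least one, `f ≤ f^q`; the modular bound then controls the average by
  -- the inverse volume of the ball.
  have ha : ballAvg f x r ≤ ENNReal.ofReal (v⁻¹ * (r⁻¹) ^ n) := by
    rw [← hvol]
    calc ballAvg f x r ≤ (volume (ball x r))⁻¹ * ∫⁻ y, f y ^ q y := by
          unfold ballAvg
          gcongr (volume (ball x r))⁻¹ * ?_
          refine (lintegral_mono fun y => ?_).trans (setLIntegral_le_lintegral _ _)
          calc f y = f y ^ (1 : ℝ) := (ENNReal.rpow_one _).symm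
            _ ≤ _ := hpow y one_pos ((hs1 y).trans (hsq y))
      _ ≤ (volume (ball x r))⁻¹ * 1 := by gcongr
      _ = _ := mul_one _
  have hvV : v⁻¹ ≤ V := le_max_right _ _
  -- Jensen can only be used with a constant exponent: `s'` is a lower bound for `s` on the ball, so
  -- that `f^s' ≤ f^s` there, and the surplus power `s x - s'` of the average has to stay bounded.
  have main : ∃ s' : ℝ, 1 ≤ s' ∧ s' ≤ s x ∧ (∀ y ∈ ball x r, s' ≤ s y) ∧
      ballAvg f x r ^ (s x - s') ≤ ENNReal.ofReal C := by
    have hC1 : 0 ≤ V ^ c * Real.exp (n * c) := by positivity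
    have hC2 : 0 ≤ (2 ^ n * V) ^ S := by positivity
    rcases lt_or_ge r (1 / 2) with hr2 | hr2
    · set ℓ : ℝ := Real.log (Real.exp 1 + 1 / r) with hℓ
      have hℓ1 : 1 ≤ ℓ := by
        rw [hℓ, Real.le_log_iff_exp_le (by positivity)]
        have : 0 < 1 / r := by positivity
        linarith
      have hℓr : Real.log r⁻¹ ≤ ℓ := by
        apply Real.log_le_log (by positivity)
        rw [one_div]
        linarith [Real.exp_pos 1]
      have hs' : ∀ y ∈ ball x r, s x - c / ℓ ≤ s y := by
        intro y hy
        have hxy : ‖x - y‖ < r := by rwa [mem_ball, dist_comm, dist_eq_norm] at hy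
        rcases eq_or_ne x y with rfl | hne
        · have : 0 < c / ℓ := by positivity
          linarith
        have hpos : 0 < ‖x - y‖ := norm_pos_iff.2 (sub_ne_zero.2 hne)
        have h1 := (le_abs_self _).trans (hloc x y (hxy.trans hr2))
        have h2 : ℓ ≤ Real.log (Real.exp 1 + 1 / ‖x - y‖) := by
          apply Real.log_le_log (by positivity)
          gcongr
        have h3 : c * (1 / Real.log (Real.exp 1 + 1 / ‖x - y‖)) ≤ c / ℓ := by
          rw [mul_one_div]
          gcongr
        linarith
      -- On a small ball `s` drops below `s x` by at most `c/ℓ` with `ℓ ≥ log (1/r)`, so the surplus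
      -- power of `r^(-n)` is at most `exp (n c)`. The maximum with one keeps Jensen available.
      refine ⟨max 1 (s x - c / ℓ), le_max_left _ _, max_le (hs1 x) ?_, fun y hy =>
        max_le (hs1 y) (hs' y hy), ?_⟩
      · have : 0 < c / ℓ := by positivity
        linarith
      · have h1 : ballAvg f x r ≤ ENNReal.ofReal (V * (r⁻¹) ^ n) := by
          refine ha.trans (ENNReal.ofReal_le_ofReal ?_)
          gcongr
        have hr1 : 1 ≤ r⁻¹ := by
          rw [one_le_inv₀ hr]; linarith
        have hbase : 1 ≤ V * (r⁻¹) ^ n := by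
          have := one_le_pow₀ hr1 (n := n)
          nlinarith
        refine (rpow_le_one_add_rpow hbase h1 (L := c / ℓ) ?_ ?_).trans
          (ENNReal.ofReal_le_ofReal ?_)
        · have : max 1 (s x - c / ℓ) ≤ s x := max_le (hs1 x) (by
            have : 0 < c / ℓ := by positivity
            linarith)
          linarith
        · linarith [le_max_right 1 (s x - c / ℓ)]
        · have hcl : c / ℓ ≤ c := div_le_self hc.le hℓ1
          have e1 : V ^ (c / ℓ) ≤ V ^ c := Real.rpow_le_rpow_of_exponent_le hV1 hcl
          have e2 : (r⁻¹ ^ n) ^ (c / ℓ) ≤ Real.exp (n * c) := by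
            rw [Real.rpow_def_of_pos (by positivity), Real.log_pow]
            rw [mul_right_comm, mul_assoc]
            refine Real.exp_le_exp.2 (mul_le_mul_of_nonneg_left ?_ (Nat.cast_nonneg n))
            calc c / ℓ * Real.log r⁻¹ ≤ c / ℓ * ℓ := by gcongr
              _ = c := by field_simp
          rw [Real.mul_rpow (by positivity) (by positivity)]
          have := mul_le_mul e1 e2 (by positivity) (by positivity)
          linarith
    -- On large balls the average is at most `2^n V`, so no continuity of the exponent is needed.
    · refine ⟨1, le_rfl, hs1 x, fun y _ => hs1 y, ?_⟩
      have h1 : ballAvg f x r ≤ ENNReal.ofReal (2 ^ n * V) := by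
        refine ha.trans (ENNReal.ofReal_le_ofReal ?_)
        have : r⁻¹ ≤ 2 := by
          rw [inv_le_comm₀ hr (by norm_num)]; linarith
        rw [mul_comm]
        gcongr
      refine (rpow_le_one_add_rpow (by
        have := one_le_pow₀ (one_le_two (α := ℝ)) (n := n)
        nlinarith) h1 (L := S) ?_ ?_).trans (ENNReal.ofReal_le_ofReal ?_)
      · linarith [hs1 x]
      · linarith [hsS x]
      · linarith
  obtain ⟨s', h1, h2, h3, h4⟩ := main
  calc ballAvg f x r ^ s x = ballAvg f x r ^ (s x - s') * ballAvg f x r ^ s' := by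
        rw [← ENNReal.rpow_add_of_nonneg _ _ (by linarith) (by linarith)]
        congr 1; ring
    _ ≤ ENNReal.ofReal C * ballAvg (fun y => f y ^ s y) x r := by
        gcongr
        exact (ballAvg_rpow_le hf x hr h1).trans
          (ballAvg_mono_on fun y hy => hpow y (by linarith) (h3 y hy))
    _ ≤ _ := by
        gcongr
        · rfl
        · exact ballAvg_le_hlMax _ x hr

/-- Exchange of exponents below height one. If `a` is below the threshold `exp (-mℓ)`, then `a^u ≤
a` is absorbed in the error term. Above it, `a^(u-w) ≤ a^(-c/ℓ) ≤ exp (mc)`. -/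
lemma rpow_le_exp_mul_rpow_add {a : ℝ≥0∞} (ha : a ≤ 1) {u w c m ℓ : ℝ} (hℓ : 0 < ℓ)
    (hu : 1 ≤ u) (huw : |u - w| ≤ c * (1 / ℓ)) :
    a ^ u ≤ ENNReal.ofReal (Real.exp (m * c)) * a ^ w + ENNReal.ofReal (Real.exp (-(m * ℓ))) := by
  have hatop : a ≠ ∞ := (ha.trans_lt ENNReal.one_lt_top).ne
  have hc : 0 ≤ c := by
    have := (abs_nonneg _).trans huw
    by_contra h
    have : c * (1 / ℓ) < 0 := mul_neg_of_neg_of_pos (not_le.1 h) (by positivity)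
    linarith
  rcases le_or_gt a (ENNReal.ofReal (Real.exp (-(m * ℓ)))) with h | h
  · refine le_trans ?_ le_add_self
    calc a ^ u ≤ a ^ (1 : ℝ) := ENNReal.rpow_le_rpow_of_exponent_ge ha hu
      _ = a := ENNReal.rpow_one a
      _ ≤ _ := h
  · refine le_trans ?_ le_self_add
    have ha0 : a ≠ 0 := (pos_of_gt h).ne'
    have h1 : a ^ (u - w) ≤ ENNReal.ofReal (Real.exp (m * c)) := by
      calc a ^ (u - w) ≤ a ^ (-(c * (1 / ℓ))) :=
            ENNReal.rpow_le_rpow_of_exponent_ge ha (by linarith [neg_abs_le (u - w)])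
        _ ≤ ENNReal.ofReal (Real.exp (-(m * ℓ))) ^ (-(c * (1 / ℓ))) := by
            rw [ENNReal.rpow_neg, ENNReal.rpow_neg]
            gcongr
        _ = ENNReal.ofReal (Real.exp (m * c)) := by
            rw [ENNReal.ofReal_rpow_of_pos (Real.exp_pos _), ← Real.exp_mul]
            congr 2
            field_simp
    calc a ^ u = a ^ (u - w) * a ^ w := by
          rw [← ENNReal.rpow_add _ _ ha0 hatop]; congr 1; ring
      _ ≤ _ := by gcongr

/-- The function `(e + |x|) ^ (-(n + 1))`, which absorbs the errors at infinity. -/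
noncomputable def decayFun (x : 𝔼) : ℝ≥0∞ :=
  ENNReal.ofReal (Real.exp (-((n + 1 : ℝ) * Real.log (Real.exp 1 + ‖x‖))))

lemma measurable_decayFun : Measurable (decayFun (n := n)) := by
  unfold decayFun; fun_prop

lemma log_exp_one_add_pos (x : 𝔼) : 0 < Real.log (Real.exp 1 + ‖x‖) := by
  apply Real.log_pos
  have := Real.add_one_le_exp 1
  linarith [norm_nonneg x]

lemma decayFun_le_one (x : 𝔼) : decayFun x ≤ 1 := by
  unfold decayFun
  rw [← ENNReal.ofReal_one]
  refine ENNReal.ofReal_le_ofReal ?_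
  rw [Real.exp_le_one_iff]
  have := log_exp_one_add_pos x
  have : 0 ≤ (n + 1 : ℝ) * Real.log (Real.exp 1 + ‖x‖) := by positivity
  linarith

lemma lintegral_decayFun_lt_top : ∫⁻ x : 𝔼, decayFun x < ∞ := by
  have h := finite_integral_one_add_norm (E := 𝔼) (μ := volume) (r := n + 1) (by simp)
  refine lt_of_le_of_lt (lintegral_mono fun x => ?_) h
  unfold decayFun
  refine ENNReal.ofReal_le_ofReal ?_
  have h1 : 0 < 1 + ‖x‖ := by positivity
  rw [Real.rpow_def_of_pos h1]
  gcongr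
  have : Real.log (1 + ‖x‖) ≤ Real.log (Real.exp 1 + ‖x‖) := by
    gcongr
    linarith [Real.add_one_le_exp 1]
  nlinarith [(Nat.cast_nonneg n : (0 : ℝ) ≤ n)]

/-- The estimate at infinity behind the maximal theorem: for a function bounded by one, only the
log-Hölder decay condition is used. -/
lemma exists_hlMax_rpow_le_of_le_one {s : 𝔼 → ℝ} {sInf c : ℝ} (hs1 : ∀ x, 1 ≤ s x)
    (hsInf : 1 ≤ sInf) (hsm : Measurable s)
    (hdecay : ∀ x, |s x - sInf| ≤ c * (1 / Real.log (Real.exp 1 + ‖x‖))) :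
    ∃ C : ℝ≥0, ∀ f : 𝔼 → ℝ≥0∞, Measurable f → (∀ x, f x ≤ 1) →
      ∀ x, hlMax f x ^ s x ≤ C * (hlMax (fun y => f y ^ s y) x + hlMax decayFun x + decayFun x) := by
  set D : ℝ := Real.exp ((n + 1 : ℝ) * c) with hD
  have hc : 0 ≤ c := by
    have h0 := (abs_nonneg _).trans (hdecay 0)
    have := log_exp_one_add_pos (0 : 𝔼)
    by_contra h
    have : c * (1 / Real.log (Real.exp 1 + ‖(0 : 𝔼)‖)) < 0 :=
      mul_neg_of_neg_of_pos (not_le.1 h) (by positivity)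
    linarith
  have hD1 : 1 ≤ D := Real.one_le_exp (by positivity)
  refine ⟨(D * D).toNNReal, fun f hf hf1 x => ?_⟩
  have hsx : 0 < s x := by linarith [hs1 x]
  rw [← ENNReal.le_rpow_inv_iff hsx]
  refine hlMax_le fun r hr => ?_
  rw [ENNReal.le_rpow_inv_iff hsx]
  have hD1' : 1 ≤ ENNReal.ofReal D := by simpa using hD1
  have ha1 : ballAvg f x r ≤ 1 := (ballAvg_le_hlMax f x hr).trans (hlMax_le_of_le hf1 x)
  have hp1 : ∀ y, f y ^ sInf ≤ ENNReal.ofReal D * f y ^ s y + decayFun y := fun y =>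
    rpow_le_exp_mul_rpow_add (hf1 y) (log_exp_one_add_pos y) hsInf
      (by rw [abs_sub_comm]; exact hdecay y)
  -- The exponent `s x` is exchanged for the constant `sInf`, Jensen is applied with it, and `sInf`
  -- is exchanged for `s y` under the average. Each exchange costs a factor `D` and an error
  -- `decayFun`.
  calc ballAvg f x r ^ s x ≤ ENNReal.ofReal D * ballAvg f x r ^ sInf + decayFun x :=
        rpow_le_exp_mul_rpow_add ha1 (log_exp_one_add_pos x) (hs1 x) (hdecay x)
    _ ≤ ENNReal.ofReal D * hlMax (fun y => ENNReal.ofReal D * f y ^ s y + decayFun y) x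
          + decayFun x := by
        gcongr
        refine (ballAvg_rpow_le hf x hr hsInf).trans ?_
        exact (ballAvg_mono_on fun y _ => hp1 y).trans (ballAvg_le_hlMax _ x hr)
    _ ≤ ENNReal.ofReal D * (ENNReal.ofReal D * hlMax (fun y => f y ^ s y) x + hlMax decayFun x)
          + decayFun x := by
        gcongr
        refine (hlMax_add_le ((hf.pow hsm).const_mul _) x).trans ?_
        gcongr
        refine hlMax_le fun r' hr' => ?_
        unfold ballAvg
        rw [lintegral_const_mul' _ _ ENNReal.ofReal_ne_top, mul_left_comm]
        gcongr
        exact ballAvg_le_hlMax _ x hr'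
    _ ≤ _ := by
        have : ((D * D).toNNReal : ℝ≥0∞) = ENNReal.ofReal D * ENNReal.ofReal D := by
          rw [← ENNReal.ofReal_mul (by positivity)]; rfl
        rw [this, mul_add, mul_add, mul_add, ← mul_assoc]
        gcongr
        · exact le_mul_of_one_le_left' hD1'
        · exact le_mul_of_one_le_left' (one_le_mul hD1' hD1')

/-- The modulus `c / log (e + 1/r)` tends to zero with `r`. -/
lemma GloballyLogHolder.continuous {p : 𝔼 → ℝ} (hp : GloballyLogHolder p) : Continuous p := by
  obtain ⟨c, hc, h⟩ := hp.loc
  refine continuous_iff_continuousAt.2 fun x => ?_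
  rw [ContinuousAt, tendsto_iff_dist_tendsto_zero]
  have hlim : Tendsto (fun y : 𝔼 => c * (1 / Real.log (Real.exp 1 + 1 / ‖y - x‖))) (𝓝[≠] x)
      (𝓝 0) := by
    have h1 : Tendsto (fun y : 𝔼 => ‖y - x‖) (𝓝[≠] x) (𝓝[>] 0) :=
      tendsto_norm_sub_self_nhdsNE x
    have h2 := (tendsto_inv_nhdsGT_zero.comp h1)
    have h3 : Tendsto (fun y : 𝔼 => Real.exp 1 + 1 / ‖y - x‖) (𝓝[≠] x) atTop := by
      refine tendsto_atTop_add_const_left _ _ (h2.congr fun y => ?_)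
      simp [one_div]
    have h4 := (tendsto_inv_atTop_zero.comp (Real.tendsto_log_atTop.comp h3)).const_mul c
    simpa [one_div, Function.comp_def] using h4
  have hpun : Tendsto (fun y => dist (p y) (p x)) (𝓝[≠] x) (𝓝 0) := by
    refine squeeze_zero' (Eventually.of_forall fun _ => dist_nonneg) ?_ hlim
    filter_upwards [mem_nhdsWithin_of_mem_nhds (ball_mem_nhds x (show (0 : ℝ) < 1 / 2 by norm_num))]
      with y hy
    rw [Real.dist_eq]
    exact h y x (by rwa [mem_ball, dist_eq_norm] at hy)
  rw [← nhdsNE_sup_pure]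
  refine hpun.sup ?_
  rw [tendsto_pure_left]
  intro s hs
  simpa using mem_of_mem_nhds hs

/-- The Hardy–Littlewood maximal operator is bounded on `L^{q(·)}` for log-Hölder exponents which
are bounded and bounded away from one. -/
theorem exists_modular_hlMax_le {q : 𝔼 → ℝ} (hq : GloballyLogHolder q) {qm qM : ℝ} (hqm : 1 < qm)
    (hqm' : ∀ x, qm ≤ q x) (hqM : ∀ x, q x ≤ qM) (hqInf : ∃ qInf c₂ : ℝ, qm ≤ qInf ∧ 0 < c₂ ∧ ∀ x,
      |q x - qInf| ≤ c₂ * (1 / Real.log (Real.exp 1 + ‖x‖))) :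
    ∃ C : ℝ≥0, 1 ≤ C ∧ ∀ f : 𝔼 → ℝ≥0∞, Measurable f → ∫⁻ x, f x ^ q x ≤ 1 →
      ∫⁻ x, (hlMax f x / C) ^ q x ≤ 1 := by
  have hqm0 : 0 < qm := by linarith
  have hqmeas : Measurable q := hq.continuous.measurable
  -- Since `(Mf)^q = ((Mf)^s)^qm`, the pointwise estimates are applied with the exponent `s ≥ 1`,
  -- and the spare power `qm > 1` is left for the strong type inequality.
  set s : 𝔼 → ℝ := fun x => q x / qm with hs
  have hsm : Measurable s := hqmeas.div_const _
  have hs1 : ∀ x, 1 ≤ s x := fun x => (one_le_div hqm0).2 (hqm' x)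
  have hsS : ∀ x, s x ≤ qM / qm := fun x => by simp only [hs]; gcongr; exact hqM x
  have hsq : ∀ x, s x ≤ q x := fun x => div_le_self (hq.pos x).le hqm.le
  have hsqm : ∀ x, s x * qm = q x := fun x => div_mul_cancel₀ _ hqm0.ne'
  have habs : ∀ a b : ℝ, |a / qm - b / qm| ≤ |a - b| := by
    intro a b
    rw [← sub_div, abs_div, abs_of_pos hqm0]
    exact div_le_self (abs_nonneg _) hqm.le
  obtain ⟨c₁, hc₁, hloc⟩ := hq.loc
  obtain ⟨qInf, c₂, hqInf1, hc₂, hdecay⟩ := hqInf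
  obtain ⟨C₁, hC₁⟩ := exists_hlMax_rpow_le_of_one_le (q := q) hs1 hsS hsq hc₁
    (fun x y hxy => (habs _ _).trans (hloc x y hxy))
  obtain ⟨C₂, hC₂⟩ := exists_hlMax_rpow_le_of_le_one (sInf := qInf / qm) hs1
    ((one_le_div hqm0).2 hqInf1) hsm (fun x => (habs _ _).trans (hdecay x))
  obtain ⟨C₃, hC₃⟩ := exists_lintegral_hlMax_rpow_le (n := n) hqm
  set I : ℝ≥0∞ := ∫⁻ x : 𝔼, decayFun x with hI
  have hItop : I ≠ ∞ := lintegral_decayFun_lt_top.ne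
  have hIq : ∫⁻ x : 𝔼, decayFun x ^ qm ≤ I := by
    refine lintegral_mono fun x => ?_
    calc decayFun x ^ qm ≤ decayFun x ^ (1 : ℝ) :=
          ENNReal.rpow_le_rpow_of_exponent_ge (decayFun_le_one x) hqm.le
      _ = _ := ENNReal.rpow_one _
  set K : ℝ≥0∞ := 2 ^ qM * ((C₁ : ℝ≥0∞) ^ qm * C₃ +
    (C₂ : ℝ≥0∞) ^ qm * (2 ^ qm * (2 ^ qm * (C₃ + C₃ * I) + I))) with hK
  have hKtop : K ≠ ∞ := by
    have h2 : ∀ r : ℝ, 0 ≤ r → (2 : ℝ≥0∞) ^ r ≠ ∞ := fun r hr =>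
      ENNReal.rpow_ne_top_of_nonneg hr (by simp)
    have hCr : ∀ c : ℝ≥0, (c : ℝ≥0∞) ^ qm ≠ ∞ := fun c =>
      ENNReal.rpow_ne_top_of_nonneg hqm0.le (by simp)
    have hqM0 : 0 ≤ qM := (hq.pos 0).le.trans (hqM 0)
    finiteness [h2 qM hqM0, h2 qm hqm0.le, hCr C₁, hCr C₂]
  refine ⟨max 1 K.toNNReal, le_max_left _ _, fun f hf hmod => ?_⟩
  -- The large part is handled by the local log-Hölder condition, the small part by the decay
  -- condition.
  set f₁ : 𝔼 → ℝ≥0∞ := fun x => if 1 ≤ f x then f x else 0 with hf₁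
  set f₂ : 𝔼 → ℝ≥0∞ := fun x => if 1 ≤ f x then 0 else f x with hf₂
  have hset : MeasurableSet {x | 1 ≤ f x} := measurableSet_le measurable_const hf
  have hf₁m : Measurable f₁ := Measurable.ite hset hf measurable_const
  have hf₂m : Measurable f₂ := Measurable.ite hset measurable_const hf
  have hf₁le : ∀ x, f₁ x ≤ f x := fun x => by simp only [hf₁]; split_ifs <;> simp
  have hf₂le : ∀ x, f₂ x ≤ f x := fun x => by simp only [hf₂]; split_ifs <;> simp
  have hsum : ∀ x, f x = f₁ x + f₂ x := fun x => by simp only [hf₁, hf₂]; split_ifs <;> simp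
  have hmod₁ : ∫⁻ x, f₁ x ^ q x ≤ 1 := le_trans (lintegral_mono fun x =>
    ENNReal.rpow_le_rpow (hf₁le x) (hq.pos x).le) hmod
  have hmod₂ : ∫⁻ x, f₂ x ^ q x ≤ 1 := le_trans (lintegral_mono fun x =>
    ENNReal.rpow_le_rpow (hf₂le x) (hq.pos x).le) hmod
  have e₁ := hC₁ f₁ hf₁m (fun x => by
    simp only [hf₁]; split_ifs with h
    · exact Or.inr h
    · exact Or.inl rfl) hmod₁
  have e₂ := hC₂ f₂ hf₂m (fun x => by
    simp only [hf₂]; split_ifs with h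
    · exact zero_le_one
    · exact (not_le.1 h).le)
  have strong : ∀ g : 𝔼 → ℝ≥0∞, Measurable g → ∫⁻ x, g x ^ q x ≤ 1 →
      ∫⁻ x, hlMax (fun y => g y ^ s y) x ^ qm ≤ C₃ := by
    intro g hg hgm
    refine (hC₃ _ (hg.pow hsm)).trans ?_
    calc (C₃ : ℝ≥0∞) * ∫⁻ x, (g x ^ s x) ^ qm = C₃ * ∫⁻ x, g x ^ q x := by
          simp_rw [← ENNReal.rpow_mul, hsqm]
      _ ≤ C₃ * 1 := by gcongr
      _ = _ := mul_one _
  have hpt₁ : ∀ x, hlMax f₁ x ^ q x ≤ (C₁ : ℝ≥0∞) ^ qm * hlMax (fun y => f₁ y ^ s y) x ^ qm := by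
    intro x
    rw [← hsqm, ENNReal.rpow_mul, ← ENNReal.mul_rpow_of_nonneg _ _ hqm0.le]
    exact ENNReal.rpow_le_rpow (e₁ x) hqm0.le
  have two : ∀ a b : ℝ≥0∞, (a + b) ^ qm ≤ 2 ^ qm * (a ^ qm + b ^ qm) := by
    intro a b
    refine (ENNReal.rpow_add_le_mul_rpow_add_rpow a b hqm.le).trans ?_
    gcongr
    · norm_num
    · linarith
  have hpt₂ : ∀ x, hlMax f₂ x ^ q x ≤ (C₂ : ℝ≥0∞) ^ qm * (2 ^ qm * (2 ^ qm *
      (hlMax (fun y => f₂ y ^ s y) x ^ qm + hlMax decayFun x ^ qm) + decayFun x ^ qm)) := by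
    intro x
    rw [← hsqm, ENNReal.rpow_mul]
    refine (ENNReal.rpow_le_rpow (e₂ x) hqm0.le).trans ?_
    rw [ENNReal.mul_rpow_of_nonneg _ _ hqm0.le]
    gcongr
    refine (two _ _).trans ?_
    gcongr
    exact two _ _
  have hm1 := measurable_hlMax (fun y => f₁ y ^ s y)
  have hm2 := measurable_hlMax (fun y => f₂ y ^ s y)
  have hm3 := measurable_hlMax (decayFun (n := n))
  have hm4 := measurable_decayFun (n := n)
  have hbound : ∫⁻ x, hlMax f x ^ q x ≤ K := by
    calc ∫⁻ x, hlMax f x ^ q x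
        ≤ ∫⁻ x, 2 ^ qM * ((C₁ : ℝ≥0∞) ^ qm * hlMax (fun y => f₁ y ^ s y) x ^ qm +
            (C₂ : ℝ≥0∞) ^ qm * (2 ^ qm * (2 ^ qm *
      (hlMax (fun y => f₂ y ^ s y) x ^ qm + hlMax decayFun x ^ qm) + decayFun x ^ qm))) := by
          refine lintegral_mono fun x => ?_
          calc hlMax f x ^ q x ≤ (hlMax f₁ x + hlMax f₂ x) ^ q x := by
                refine ENNReal.rpow_le_rpow ?_ (hq.pos x).le
                have : f = fun y => f₁ y + f₂ y := funext hsum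
                conv_lhs => rw [this]
                exact hlMax_add_le hf₁m x
            _ ≤ 2 ^ (q x - 1) * (hlMax f₁ x ^ q x + hlMax f₂ x ^ q x) :=
                ENNReal.rpow_add_le_mul_rpow_add_rpow _ _ (hqm.le.trans (hqm' x))
            _ ≤ _ := by
                gcongr
                · norm_num
                · linarith [hqM x]
                · exact hpt₁ x
                · exact hpt₂ x
      _ = 2 ^ qM * ((C₁ : ℝ≥0∞) ^ qm * ∫⁻ x, hlMax (fun y => f₁ y ^ s y) x ^ qm) +
            2 ^ qM * ((C₂ : ℝ≥0∞) ^ qm * (2 ^ qm * (2 ^ qm *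
      ((∫⁻ x, hlMax (fun y => f₂ y ^ s y) x ^ qm) + ∫⁻ x : 𝔼, hlMax decayFun x ^ qm) +
        ∫⁻ x : 𝔼, decayFun x ^ qm))) := by
          rw [lintegral_const_mul _ (by fun_prop), lintegral_add_left (by fun_prop),
            lintegral_const_mul _ (by fun_prop), lintegral_const_mul _ (by fun_prop),
            lintegral_const_mul _ (by fun_prop), lintegral_add_left (by fun_prop),
            lintegral_const_mul _ (by fun_prop), lintegral_add_left (by fun_prop), mul_add]
      _ ≤ 2 ^ qM * ((C₁ : ℝ≥0∞) ^ qm * C₃) +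
            2 ^ qM * ((C₂ : ℝ≥0∞) ^ qm * (2 ^ qm * (2 ^ qm * (C₃ + C₃ * I) + I))) := by
          gcongr
          · exact strong f₁ hf₁m hmod₁
          · exact strong f₂ hf₂m hmod₂
          · refine (hC₃ _ hm4).trans ?_
            gcongr
      _ = K := by rw [hK]; ring
  set c : ℝ≥0∞ := ((max 1 K.toNNReal : ℝ≥0) : ℝ≥0∞) with hc
  have hc1 : 1 ≤ c := by
    rw [hc]; exact_mod_cast le_max_left _ _
  have hcK : K ≤ c := by
    rw [← ENNReal.coe_toNNReal hKtop, hc]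
    exact_mod_cast le_max_right _ _
  -- As `q ≥ 1` and `c ≥ 1`, dividing by `c` divides the modular by at least `c`.
  calc ∫⁻ x, (hlMax f x / c) ^ q x ≤ ∫⁻ x, c⁻¹ * hlMax f x ^ q x := by
        refine lintegral_mono fun x => ?_
        rw [ENNReal.div_rpow_of_nonneg _ _ (hq.pos x).le, div_eq_mul_inv, mul_comm]
        gcongr
        calc c = c ^ (1 : ℝ) := (ENNReal.rpow_one c).symm
          _ ≤ _ := ENNReal.rpow_le_rpow_of_exponent_le hc1 (hqm.le.trans (hqm' x))
    _ = c⁻¹ * ∫⁻ x, hlMax f x ^ q x := by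
        rw [lintegral_const_mul _ ((measurable_hlMax f).pow hqmeas)]
    _ ≤ c⁻¹ * c := by gcongr; exact hbound.trans hcK
    _ ≤ 1 := ENNReal.inv_mul_le_one c

/-! ### Interpolation of variable exponent spaces: duality and the three lines theorem. -/

/-- A nonnegative measurable function with support of finite measure, which is bounded, and bounded
away from zero on its support. -/
structure IsTame (f : 𝔼 → ℝ) : Prop where
  measurable : Measurable f
  bounds : ∃ a b : ℝ, 0 < a ∧ ∀ x, f x = 0 ∨ (a ≤ f x ∧ f x ≤ b)
  support : volume (Function.support f) < ∞

lemma IsTame.nonneg {f : 𝔼 → ℝ} (hf : IsTame f) (x : 𝔼) : 0 ≤ f x := by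
  obtain ⟨a, b, ha, h⟩ := hf.bounds
  rcases h x with h | h
  · exact h.ge
  · exact ha.le.trans h.1

/-- This supplies the entire function of the three lines argument. Bounded data on a finite measure
space give a constant dominating function on each unit disc. -/
lemma differentiable_integral_mul_cexp {X : Type*} [MeasurableSpace X] {μ : Measure X}
    [IsFiniteMeasure μ] {w : X → ℂ} {a b : X → ℝ} (hw : Measurable w) (ha : Measurable a)
    (hb : Measurable b) {W A B : ℝ} (hW : ∀ x, ‖w x‖ ≤ W) (hA : ∀ x, |a x| ≤ A)
    (hB : ∀ x, |b x| ≤ B) :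
    Differentiable ℂ fun z : ℂ => ∫ x, w x * Complex.exp (a x + z * b x) ∂μ := by
  intro z₀
  have hbound : ∀ (x : X) (z : ℂ), z ∈ ball z₀ 1 →
      ‖Complex.exp (a x + z * b x)‖ ≤ Real.exp (A + (‖z₀‖ + 1) * B) := by
    intro x z hz
    rw [Complex.norm_exp]
    gcongr
    simp only [Complex.add_re, Complex.ofReal_re, Complex.mul_re, Complex.ofReal_im, mul_zero,
      sub_zero]
    have h1 : |z.re| ≤ ‖z₀‖ + 1 := by
      refine (Complex.abs_re_le_norm z).trans ?_
      have : ‖z - z₀‖ < 1 := by rwa [mem_ball, dist_eq_norm] at hz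
      linarith [norm_le_norm_add_norm_sub' z z₀]
    have h2 : z.re * b x ≤ (‖z₀‖ + 1) * B := by
      refine (le_abs_self _).trans ?_
      rw [abs_mul]
      gcongr
      exact hB x
    linarith [le_abs_self (a x), hA x]
  rcases isEmpty_or_nonempty X with hX | ⟨⟨x₀⟩⟩
  · simp [Measure.eq_zero_of_isEmpty μ]
  have hW0 : 0 ≤ W := (norm_nonneg _).trans (hW x₀)
  have hB0 : 0 ≤ B := (abs_nonneg _).trans (hB x₀)
  have hmeas : ∀ z : ℂ, Measurable fun x => w x * Complex.exp (a x + z * b x) := by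
    intro z; fun_prop
  refine (hasDerivAt_integral_of_dominated_loc_of_deriv_le (μ := μ) (s := ball z₀ 1)
    (F' := fun z x => w x * (Complex.exp (a x + z * b x) * b x))
    (bound := fun _ => W * (Real.exp (A + (‖z₀‖ + 1) * B) * B))
    (ball_mem_nhds _ one_pos) (Eventually.of_forall fun z => (hmeas z).aestronglyMeasurable)
    ?_ ?_ ?_ (integrable_const _) ?_).2.differentiableAt
  · refine Integrable.of_bound (hmeas z₀).aestronglyMeasurable
      (W * Real.exp (A + (‖z₀‖ + 1) * B)) (ae_of_all _ fun x => ?_)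
    rw [norm_mul]
    gcongr
    · exact hW x
    · exact hbound x z₀ (mem_ball_self one_pos)
  · exact (Measurable.aestronglyMeasurable (by fun_prop))
  · refine ae_of_all _ fun x z hz => ?_
    rw [norm_mul, norm_mul, Complex.norm_real]
    gcongr
    · exact hW x
    · exact hbound x z hz
    · exact hB x
  · refine ae_of_all _ fun x z _ => ?_
    have h1 : HasDerivAt (fun z : ℂ => (a x : ℂ) + z * b x) (b x) z := by
      simpa using ((hasDerivAt_id z).mul_const (b x : ℂ)).const_add (a x : ℂ)
    exact (h1.cexp).const_mul (w x)

/-- Pointwise Young inequality with the conjugate exponents at `x`. Their coefficients are only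
bounded by one, which is the origin of the factor two. -/
lemma enorm_integral_mul_le_of_modular_le_one {r : 𝔼 → ℝ} (hr : Measurable r) (hr1 : ∀ x, 1 < r x)
    {g h : 𝔼 → ℂ} (hg : Measurable g) {A : ℝ≥0∞} (hA0 : A ≠ 0) (hA : A ≠ ∞)
    (hgm : ∫⁻ x, ‖g x‖ₑ ^ (r x / (r x - 1)) ≤ 1) (hhm : ∫⁻ x, (‖h x‖ₑ / A) ^ r x ≤ 1) :
    ‖∫ x, g x * h x‖ₑ ≤ 2 * A := by
  have young : ∀ x, ‖g x‖ₑ * (‖h x‖ₑ / A) ≤ ‖g x‖ₑ ^ (r x / (r x - 1)) + (‖h x‖ₑ / A) ^ r x := by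
    intro x
    have hc : (r x).HolderConjugate (r x / (r x - 1)) :=
      Real.HolderConjugate.conjExponent (hr1 x)
    refine (ENNReal.young_inequality _ _ hc.symm).trans ?_
    gcongr
    · exact ENNReal.div_le_of_le_mul (le_mul_of_one_le_right' (by simpa using hc.symm.lt.le))
    · exact ENNReal.div_le_of_le_mul (le_mul_of_one_le_right' (by simpa using hc.lt.le))
  calc ‖∫ x, g x * h x‖ₑ ≤ ∫⁻ x, ‖g x * h x‖ₑ := enorm_integral_le_lintegral_enorm _
    _ = ∫⁻ x, A * (‖g x‖ₑ * (‖h x‖ₑ / A)) := by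
      refine lintegral_congr fun x => ?_
      rw [enorm_mul, mul_left_comm, ENNReal.mul_div_cancel hA0 hA]
    _ ≤ ∫⁻ x, A * (‖g x‖ₑ ^ (r x / (r x - 1)) + (‖h x‖ₑ / A) ^ r x) := by
      gcongr with x; exact young x
    _ = A * ((∫⁻ x, ‖g x‖ₑ ^ (r x / (r x - 1))) + ∫⁻ x, (‖h x‖ₑ / A) ^ r x) := by
      rw [lintegral_const_mul' _ _ hA, lintegral_add_left]
      exact hg.enorm.pow (hr.div (hr.sub_const 1))
    _ ≤ A * (1 + 1) := by gcongr
    _ = 2 * A := by rw [one_add_one_eq_two, mul_comm]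

/-- The modular of a bounded function is at most one as soon as its pairings with tame functions
in the unit ball of the dual space are. -/
lemma modular_le_one_of_dual {p : 𝔼 → ℝ} (hp : Measurable p) {l u : ℝ} (hl : 1 < l)
    (hlp : ∀ x, l ≤ p x) (hpu : ∀ x, p x ≤ u) {v : 𝔼 → ℝ} (hv : Measurable v) (hv0 : ∀ x, 0 ≤ v x)
    {M : ℝ} (hM : ∀ x, v x ≤ M)
    (h : ∀ g : 𝔼 → ℝ, IsTame g → ∫⁻ x, ENNReal.ofReal (g x) ^ (p x / (p x - 1)) ≤ 1 →
      ∫⁻ x, ENNReal.ofReal (g x) * ENNReal.ofReal (v x) ≤ 1) :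
    ∫⁻ x, ENNReal.ofReal (v x) ^ p x ≤ 1 := by
  -- The set where `v` is positive is exhausted by sets of finite measure on which `v` is bounded
  -- below, so that the extremal function built on them is tame.
  set S : ℕ → Set 𝔼 := fun N => ball 0 N ∩ {x | 1 / ((N : ℝ) + 1) ≤ v x} with hS
  have hSm : ∀ N, MeasurableSet (S N) := fun N =>
    measurableSet_ball.inter (measurableSet_le measurable_const hv)
  have hp0 : ∀ x, 0 < p x := fun x => by linarith [hlp x]
  have hSmono : Monotone S := by
    intro i j hij x hx
    have : (i : ℝ) ≤ j := by exact_mod_cast hij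
    have h1 : 1 / ((j : ℝ) + 1) ≤ 1 / ((i : ℝ) + 1) :=
      one_div_le_one_div_of_le (by positivity) (by linarith)
    exact ⟨ball_subset_ball this hx.1, h1.trans (show 1 / ((i : ℝ) + 1) ≤ v x from hx.2)⟩
  have hmeas : Measurable fun x => ENNReal.ofReal (v x) ^ p x :=
    (ENNReal.measurable_ofReal.comp hv).pow hp
  have hlim : ∫⁻ x, ENNReal.ofReal (v x) ^ p x = ⨆ N, ∫⁻ x in S N, ENNReal.ofReal (v x) ^ p x := by
    rw [← setLIntegral_iUnion_of_directed _ hSmono.directed_le, ← lintegral_indicator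
      (MeasurableSet.iUnion hSm)]
    refine lintegral_congr fun x => ?_
    by_cases hx : x ∈ ⋃ N, S N
    · rw [indicator_of_mem hx]
    · rw [indicator_of_notMem hx]
      have : v x = 0 := by
        by_contra hne
        apply hx
        have hpos : 0 < v x := lt_of_le_of_ne (hv0 x) (Ne.symm hne)
        obtain ⟨k, hk⟩ := exists_nat_one_div_lt hpos
        obtain ⟨j, hj⟩ := exists_nat_gt ‖x‖
        refine mem_iUnion.2 ⟨max k j, ?_, ?_⟩
        · rw [mem_ball_zero_iff]
          exact hj.trans_le (by exact_mod_cast le_max_right k j)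
        · refine le_trans (one_div_le_one_div_of_le (by positivity) ?_) hk.le
          have : (k : ℝ) ≤ (max k j : ℕ) := by exact_mod_cast le_max_left k j
          linarith
      rw [this, ENNReal.ofReal_zero, ENNReal.zero_rpow_of_pos (hp0 x)]
  rw [hlim]
  refine iSup_le fun N => ?_
  by_contra hcon
  rw [not_le] at hcon
  have hu : 0 < u := (hp0 0).trans_le (hpu 0)
  set M' : ℝ := max 1 M with hM'
  have hM'1 : 1 ≤ M' := le_max_left _ _
  have hvM' : ∀ x, v x ≤ M' := fun x => (hM x).trans (le_max_right _ _)
  have hSfin : volume (S N) < ∞ := (measure_mono inter_subset_left).trans_lt measure_ball_lt_top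
  have hfin : ∫⁻ x in S N, ENNReal.ofReal (v x) ^ p x < ∞ := by
    refine lt_of_le_of_lt (lintegral_mono (g := fun _ => ENNReal.ofReal (M' ^ u)) fun x => ?_) ?_
    · exact rpow_le_one_add_rpow hM'1 (ENNReal.ofReal_le_ofReal (hvM' x)) (hp0 x).le (hpu x)
    · rw [setLIntegral_const]
      exact ENNReal.mul_lt_top ENNReal.ofReal_lt_top hSfin
  set I : ℝ := (∫⁻ x in S N, ENNReal.ofReal (v x) ^ p x).toReal with hI
  have hIeq : ENNReal.ofReal I = ∫⁻ x in S N, ENNReal.ofReal (v x) ^ p x :=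
    ENNReal.ofReal_toReal hfin.ne
  have hI1 : 1 < I := by
    rw [← hIeq] at hcon
    simpa using hcon
  have hI0 : 0 < I := by linarith
  -- The normalized extremal function for a modular `I > 1`: `g^(p/(p-1)) = v^p / I` has integral
  -- one, while `g v ≥ I^(1/u - 1) v^p` has integral at least `I^(1/u) > 1`.
  set g : 𝔼 → ℝ := (S N).indicator fun x => I ^ (1 / p x - 1) * v x ^ (p x - 1) with hg
  have hd : 0 < 1 / ((N : ℝ) + 1) := by positivity
  have htame : IsTame g := by
    refine ⟨?_, ⟨I⁻¹ * (1 / ((N : ℝ) + 1)) ^ u, 1 * M' ^ u, by positivity, fun x => ?_⟩, ?_⟩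
    · refine Measurable.indicator ?_ (hSm N)
      exact (measurable_const.pow ((hp.const_div 1).sub_const 1)).mul (hv.pow (hp.sub_const 1))
    · by_cases hx : x ∈ S N
      · right
        rw [hg, indicator_of_mem hx]
        have hvx : 0 < v x := hd.trans_le hx.2
        have hpx := hp0 x
        have hpx1 : 0 < p x - 1 := by linarith [hlp x]
        have h1p : 1 / p x ≤ 1 := by rw [div_le_one hpx]; linarith
        constructor
        · gcongr ?_ * ?_
          · rw [← Real.rpow_neg_one]
            apply Real.rpow_le_rpow_of_exponent_le hI1.le
            have : 0 < 1 / p x := by positivity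
            linarith
          · calc (1 / ((N : ℝ) + 1)) ^ u ≤ (1 / ((N : ℝ) + 1)) ^ (p x - 1) := by
                  apply Real.rpow_le_rpow_of_exponent_ge hd
                  · rw [div_le_one (by positivity)]
                    linarith [(Nat.cast_nonneg N : (0 : ℝ) ≤ N)]
                  · linarith [hpu x]
              _ ≤ _ := Real.rpow_le_rpow hd.le hx.2 hpx1.le
        · gcongr ?_ * ?_
          · exact Real.rpow_le_one_of_one_le_of_nonpos hI1.le (by linarith)
          · calc v x ^ (p x - 1) ≤ M' ^ (p x - 1) := Real.rpow_le_rpow hvx.le (hvM' x) hpx1.le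
              _ ≤ _ := Real.rpow_le_rpow_of_exponent_le hM'1 (by linarith [hpu x])
      · left
        rw [hg, indicator_of_notMem hx]
    · exact (measure_mono support_indicator_subset).trans_lt hSfin
  have hgmod : ∫⁻ x, ENNReal.ofReal (g x) ^ (p x / (p x - 1)) ≤ 1 := by
    calc ∫⁻ x, ENNReal.ofReal (g x) ^ (p x / (p x - 1))
        = ∫⁻ x in S N, ENNReal.ofReal I⁻¹ * ENNReal.ofReal (v x) ^ p x := by
          rw [← lintegral_indicator (hSm N)]
          refine lintegral_congr fun x => ?_
          have hpx := hp0 x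
          have hpx1 : 0 < p x - 1 := by linarith [hlp x]
          by_cases hx : x ∈ S N
          · have hvx : 0 < v x := hd.trans_le hx.2
            rw [hg, indicator_of_mem hx, indicator_of_mem hx,
              ENNReal.ofReal_rpow_of_pos (by positivity), ENNReal.ofReal_rpow_of_pos hvx,
              ← ENNReal.ofReal_mul (by positivity), Real.mul_rpow (by positivity) (by positivity),
              ← Real.rpow_mul hI0.le, ← Real.rpow_mul hvx.le, ← Real.rpow_neg_one]
            congr 3
            · field_simp
              ring
            · field_simp
          · rw [hg, indicator_of_notMem hx, indicator_of_notMem hx, ENNReal.ofReal_zero,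
              ENNReal.zero_rpow_of_pos (by positivity)]
      _ = 1 := by
          rw [lintegral_const_mul' _ _ ENNReal.ofReal_ne_top, ← hIeq,
            ← ENNReal.ofReal_mul (by positivity), inv_mul_cancel₀ hI0.ne', ENNReal.ofReal_one]
      _ ≤ 1 := le_rfl
  have hge : ENNReal.ofReal (I ^ (1 / u)) ≤ ∫⁻ x, ENNReal.ofReal (g x) * ENNReal.ofReal (v x) := by
    calc ENNReal.ofReal (I ^ (1 / u))
        = ENNReal.ofReal (I ^ (1 / u - 1)) * ENNReal.ofReal I := by
          rw [← ENNReal.ofReal_mul (by positivity), ← Real.rpow_add_one hI0.ne', sub_add_cancel]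
      _ = ∫⁻ x in S N, ENNReal.ofReal (I ^ (1 / u - 1)) * ENNReal.ofReal (v x) ^ p x := by
          rw [lintegral_const_mul' _ _ ENNReal.ofReal_ne_top, hIeq]
      _ ≤ ∫⁻ x, ENNReal.ofReal (g x) * ENNReal.ofReal (v x) := by
          rw [← lintegral_indicator (hSm N)]
          refine lintegral_mono fun x => ?_
          by_cases hx : x ∈ S N
          · have hvx : 0 < v x := hd.trans_le hx.2
            have hpx := hp0 x
            rw [hg, indicator_of_mem hx, indicator_of_mem hx, ENNReal.ofReal_rpow_of_pos hvx,
              ← ENNReal.ofReal_mul (by positivity), ← ENNReal.ofReal_mul (by positivity),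
              mul_assoc, ← Real.rpow_add_one hvx.ne', sub_add_cancel]
            refine ENNReal.ofReal_le_ofReal ?_
            have h1 : 1 / u ≤ 1 / p x := one_div_le_one_div_of_le hpx (hpu x)
            have h2 : I ^ (1 / u - 1) ≤ I ^ (1 / p x - 1) :=
              Real.rpow_le_rpow_of_exponent_le hI1.le (by linarith)
            gcongr
          · rw [indicator_of_notMem hx]
            exact zero_le
  have h3 : 1 < ENNReal.ofReal (I ^ (1 / u)) := by
    rw [ENNReal.one_lt_ofReal]
    exact Real.one_lt_rpow hI1 (by positivity)
  exact absurd (hge.trans (h g htame hgmod)) (not_le.2 h3)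

lemma abs_mul_le_mul {a b A B : ℝ} (ha : |a| ≤ A) (hb : |b| ≤ B) : |a * b| ≤ A * B := by
  rw [abs_mul]
  exact mul_le_mul ha hb (abs_nonneg _) ((abs_nonneg _).trans ha)

/-- The analytic family of powers through a tame function. -/
noncomputable def cpowFamily (f : 𝔼 → ℝ) (a₀ a₁ : 𝔼 → ℝ) (z : ℂ) : 𝔼 → ℂ :=
  (Function.support f).indicator fun x =>
    Complex.exp ((a₀ x * Real.log (f x) : ℝ) + z * ((a₁ x - a₀ x) * Real.log (f x) : ℝ))

lemma IsTame.abs_log_le {f : 𝔼 → ℝ} (hf : IsTame f) : ∃ L : ℝ, ∀ x, |Real.log (f x)| ≤ L := by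
  obtain ⟨a, b, ha, h⟩ := hf.bounds
  refine ⟨max |Real.log a| |Real.log b|, fun x => ?_⟩
  rcases h x with h | ⟨h1, h2⟩
  · simp [h]
  · have h3 := Real.log_le_log ha h1
    have h4 := Real.log_le_log (ha.trans_le h1) h2
    rw [abs_le]
    constructor
    · linarith [neg_abs_le (Real.log a), le_max_left |Real.log a| |Real.log b|]
    · linarith [le_abs_self (Real.log b), le_max_right |Real.log a| |Real.log b|]

lemma measurable_cpowFamily {f a₀ a₁ : 𝔼 → ℝ} (hf : Measurable f) (h₀ : Measurable a₀)
    (h₁ : Measurable a₁) (z : ℂ) : Measurable (cpowFamily f a₀ a₁ z) := by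
  refine Measurable.indicator ?_ (measurableSet_support hf)
  fun_prop

lemma norm_cpowFamily_of_mem {f a₀ a₁ : 𝔼 → ℝ} (hf : IsTame f) (z : ℂ) {x : 𝔼} (hx : f x ≠ 0) :
    ‖cpowFamily f a₀ a₁ z x‖ = f x ^ ((1 - z.re) * a₀ x + z.re * a₁ x) := by
  have hpos : 0 < f x := lt_of_le_of_ne (hf.nonneg x) (Ne.symm hx)
  rw [cpowFamily, indicator_of_mem (Function.mem_support.2 hx), Complex.norm_exp,
    Real.rpow_def_of_pos hpos]
  simp only [Complex.add_re, Complex.ofReal_re, Complex.mul_re, Complex.ofReal_im, mul_zero,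
    sub_zero]
  congr 1
  ring

lemma enorm_cpowFamily_rpow {f a₀ a₁ : 𝔼 → ℝ} (hf : IsTame f) (z : ℂ) (x : 𝔼) {r s : ℝ} (hr : 0 < r)
    (hs : 0 < s) (h : ((1 - z.re) * a₀ x + z.re * a₁ x) * r = s) :
    ‖cpowFamily f a₀ a₁ z x‖ₑ ^ r = ENNReal.ofReal (f x) ^ s := by
  by_cases hx : f x = 0
  · have : cpowFamily f a₀ a₁ z x = 0 :=
      indicator_of_notMem (fun h => Function.mem_support.1 h hx) _
    rw [this, hx, enorm_zero, ENNReal.ofReal_zero, ENNReal.zero_rpow_of_pos hr,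
      ENNReal.zero_rpow_of_pos hs]
  · have hpos : 0 < f x := lt_of_le_of_ne (hf.nonneg x) (Ne.symm hx)
    rw [← ofReal_norm, norm_cpowFamily_of_mem hf z hx, ENNReal.ofReal_rpow_of_pos (by positivity),
      ENNReal.ofReal_rpow_of_pos hpos, ← Real.rpow_mul hpos.le, h]

lemma cpowFamily_eq {f a₀ a₁ : 𝔼 → ℝ} (hf : IsTame f) (θ : ℝ) (x : 𝔼)
    (h : (1 - θ) * a₀ x + θ * a₁ x = 1) : cpowFamily f a₀ a₁ θ x = f x := by
  by_cases hx : f x = 0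
  · have : cpowFamily f a₀ a₁ θ x = 0 :=
      indicator_of_notMem (fun h => Function.mem_support.1 h hx) _
    rw [this, hx, Complex.ofReal_zero]
  · have hpos : 0 < f x := lt_of_le_of_ne (hf.nonneg x) (Ne.symm hx)
    rw [cpowFamily, indicator_of_mem (Function.mem_support.2 hx)]
    conv_rhs => rw [← Real.exp_log hpos]
    rw [← Complex.ofReal_mul, ← Complex.ofReal_add, ← Complex.ofReal_exp]
    congr 2
    linear_combination Real.log (f x) * h

lemma norm_cpowFamily_le {f a₀ a₁ : 𝔼 → ℝ} (hf : IsTame f) {B : ℝ} (h₀ : ∀ x, |a₀ x| ≤ B)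
    (h₁ : ∀ x, |a₁ x| ≤ B) (z : ℂ) : ∃ M : ℝ, ∀ x, ‖cpowFamily f a₀ a₁ z x‖ ≤ M := by
  obtain ⟨L, hL⟩ := hf.abs_log_le
  have hL0 : 0 ≤ L := (abs_nonneg _).trans (hL 0)
  have hB0 : 0 ≤ B := (abs_nonneg _).trans (h₀ 0)
  refine ⟨Real.exp ((|1 - z.re| * B + |z.re| * B) * L), fun x => ?_⟩
  by_cases hx : f x = 0
  · have : cpowFamily f a₀ a₁ z x = 0 :=
      indicator_of_notMem (fun h => Function.mem_support.1 h hx) _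
    rw [this, norm_zero]
    positivity
  · have hpos : 0 < f x := lt_of_le_of_ne (hf.nonneg x) (Ne.symm hx)
    rw [norm_cpowFamily_of_mem hf z hx, Real.rpow_def_of_pos hpos]
    refine Real.exp_le_exp.2 ((le_abs_self _).trans ?_)
    rw [mul_comm]
    refine abs_mul_le_mul ?_ (hL x)
    exact (abs_add_le _ _).trans (add_le_add (abs_mul_le_mul le_rfl (h₀ x))
      (abs_mul_le_mul le_rfl (h₁ x)))

lemma support_cpowFamily_subset (f a₀ a₁ : 𝔼 → ℝ) (z : ℂ) :
    Function.support (cpowFamily f a₀ a₁ z) ⊆ Function.support f :=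
  support_indicator_subset

/-- Hypothesis of the interpolation theorem: the integral operator with kernel `k` maps the unit
ball of `L^{r(·)}` into the ball of radius `A`, on bounded functions with support of finite
measure. -/
def KernelBound (k : 𝔼 → 𝔼 → ℂ) (r : 𝔼 → ℝ) (A : ℝ) : Prop :=
  ∀ f : 𝔼 → ℂ, Measurable f → (∃ M : ℝ, ∀ x, ‖f x‖ ≤ M) → volume (Function.support f) < ∞ →
    ∫⁻ x, ‖f x‖ₑ ^ r x ≤ 1 → ∫⁻ x, (‖∫ y, k x y * f y‖ₑ / ENNReal.ofReal A) ^ r x ≤ 1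

/-- The three lines argument: the pairing of the image of a tame function with a tame function. -/
lemma norm_integral_mul_integral_le {p p₀ p₁ : 𝔼 → ℝ} (hp : Measurable p) (hp₀ : Measurable p₀)
    (hp₁ : Measurable p₁) {l u : ℝ} (hl : 1 < l) (hlp : ∀ x, l ≤ p x) (hpu : ∀ x, p x ≤ u)
    (hlp₀ : ∀ x, l ≤ p₀ x) (hlp₁ : ∀ x, l ≤ p₁ x) {θ : ℝ} (hθ0 : 0 < θ) (hθ1 : θ < 1)
    (hpθ : ∀ x, 1 / p x = (1 - θ) / p₀ x + θ / p₁ x)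
    {A₀ A₁ : ℝ} (hA₀ : 0 < A₀) (hA₁ : 0 < A₁) {k : 𝔼 → 𝔼 → ℂ}
    (hk : Measurable (Function.uncurry k)) {K : ℝ} (hkK : ∀ x y, ‖k x y‖ ≤ K)
    (h₀ : KernelBound k p₀ A₀) (h₁ : KernelBound k p₁ A₁) {f g : 𝔼 → ℝ} (hf : IsTame f)
    (hg : IsTame g) (hfm : ∫⁻ x, ENNReal.ofReal (f x) ^ p x ≤ 1)
    (hgm : ∫⁻ x, ENNReal.ofReal (g x) ^ (p x / (p x - 1)) ≤ 1) {w : 𝔼 → ℂ} (hw : Measurable w)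
    (hw1 : ∀ x, ‖w x‖ ≤ 1) :
    ‖∫ x, (w x * g x) * ∫ y, k x y * f y‖ ≤ 2 * (A₀ ^ (1 - θ) * A₁ ^ θ) := by
  have hpp : ∀ x, 0 < p x := fun x => by linarith [hlp x]
  have hpp₀ : ∀ x, 0 < p₀ x := fun x => by linarith [hlp₀ x]
  have hpp₁ : ∀ x, 0 < p₁ x := fun x => by linarith [hlp₁ x]
  have hp1 : ∀ x, 0 < p x - 1 := fun x => by linarith [hlp x]
  have hp01 : ∀ x, 0 < p₀ x - 1 := fun x => by linarith [hlp₀ x]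
  have hp11 : ∀ x, 0 < p₁ x - 1 := fun x => by linarith [hlp₁ x]
  -- The exponents make `|f_z|^p₀ = f^p` on `Re z = 0` and `|f_z|^p₁ = f^p` on `Re z = 1`; `b₀` and
  -- `b₁` do the same for `g` with the conjugate exponents. By `hpθ` both families return `f` and
  -- `g` at `z = θ`.
  set a₀ : 𝔼 → ℝ := fun x => p x / p₀ x with ha₀
  set a₁ : 𝔼 → ℝ := fun x => p x / p₁ x with ha₁
  set b₀ : 𝔼 → ℝ := fun x => p x / (p x - 1) * ((p₀ x - 1) / p₀ x) with hb₀
  set b₁ : 𝔼 → ℝ := fun x => p x / (p x - 1) * ((p₁ x - 1) / p₁ x) with hb₁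
  have ha₀m : Measurable a₀ := hp.div hp₀
  have ha₁m : Measurable a₁ := hp.div hp₁
  have hb₀m : Measurable b₀ := (hp.div (hp.sub_const 1)).mul ((hp₀.sub_const 1).div hp₀)
  have hb₁m : Measurable b₁ := (hp.div (hp.sub_const 1)).mul ((hp₁.sub_const 1).div hp₁)
  have hl1 : 0 < l - 1 := by linarith
  have hu0 : 0 < u := (hpp 0).trans_le (hpu 0)
  obtain ⟨B, hBa₀, hBa₁, hBb₀, hBb₁⟩ : ∃ B : ℝ, (∀ x, |a₀ x| ≤ B) ∧ (∀ x, |a₁ x| ≤ B) ∧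
      (∀ x, |b₀ x| ≤ B) ∧ ∀ x, |b₁ x| ≤ B := by
    have hone : ∀ r : ℝ, 1 < r → 0 ≤ (r - 1) / r ∧ (r - 1) / r ≤ 1 := fun r hr =>
      ⟨div_nonneg (by linarith) (by linarith), (div_le_one (by linarith)).2 (by linarith)⟩
    have ha : ∀ (x : 𝔼) (r : ℝ), l ≤ r → |p x / r| ≤ u + u / (l - 1) := by
      intro x r hr
      have : 0 < p x := hpp x
      have : 0 < r := by linarith
      rw [abs_of_pos (by positivity)]
      have h1 : p x / r ≤ p x := div_le_self (by positivity) (by linarith)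
      have h2 : 0 < u / (l - 1) := by positivity
      linarith [hpu x]
    have hb : ∀ (x : 𝔼) (r : ℝ), l ≤ r → |p x / (p x - 1) * ((r - 1) / r)| ≤ u + u / (l - 1) := by
      intro x r hr
      obtain ⟨h1, h2⟩ := hone r (by linarith)
      have h3 : 0 ≤ p x / (p x - 1) := div_nonneg (hpp x).le (hp1 x).le
      rw [abs_of_nonneg (by positivity)]
      calc p x / (p x - 1) * ((r - 1) / r) ≤ p x / (p x - 1) * 1 := by gcongr
        _ ≤ u / (l - 1) * 1 := by
            gcongr
            · exact hpu x
            · exact hlp x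
        _ ≤ _ := by linarith
    exact ⟨u + u / (l - 1), fun x => ha x _ (hlp₀ x), fun x => ha x _ (hlp₁ x),
      fun x => hb x _ (hlp₀ x), fun x => hb x _ (hlp₁ x)⟩
  have hB0 : 0 ≤ B := (abs_nonneg _).trans (hBa₀ 0)
  obtain ⟨Lf, hLf⟩ := hf.abs_log_le
  obtain ⟨Lg, hLg⟩ := hg.abs_log_le
  have hLf0 : 0 ≤ Lf := (abs_nonneg _).trans (hLf 0)
  have hLg0 : 0 ≤ Lg := (abs_nonneg _).trans (hLg 0)
  set Sf := Function.support f with hSf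
  set Sg := Function.support g with hSg
  have hSfm : MeasurableSet Sf := measurableSet_support hf.measurable
  have hSgm : MeasurableSet Sg := measurableSet_support hg.measurable
  have : IsFiniteMeasure (volume.restrict Sf) := ⟨by
    rw [Measure.restrict_apply_univ]; exact hf.support⟩
  have : IsFiniteMeasure (volume.restrict Sg) := ⟨by
    rw [Measure.restrict_apply_univ]; exact hg.support⟩
  set fz := cpowFamily f a₀ a₁ with hfz
  set gz := cpowFamily g b₀ b₁ with hgz
  have hfzm : ∀ z, Measurable (fz z) := measurable_cpowFamily hf.measurable ha₀m ha₁m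
  have hgzm : ∀ z, Measurable (gz z) := measurable_cpowFamily hg.measurable hb₀m hb₁m
  -- On the product of the supports, `g_z(x) f_z(y) = exp (α + zβ)`, so the pairing is a single
  -- integral of exponentials in `z`.
  set α : 𝔼 × 𝔼 → ℝ := fun q => b₀ q.1 * Real.log (g q.1) + a₀ q.2 * Real.log (f q.2) with hα
  set β : 𝔼 × 𝔼 → ℝ := fun q => (b₁ q.1 - b₀ q.1) * Real.log (g q.1) +
    (a₁ q.2 - a₀ q.2) * Real.log (f q.2) with hβ
  set W : 𝔼 × 𝔼 → ℂ := fun q => w q.1 * k q.1 q.2 with hW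
  have hgm' := hg.measurable
  have hfm' := hf.measurable
  have hαm : Measurable α := by fun_prop
  have hβm : Measurable β := by fun_prop
  have hWm : Measurable W := (hw.comp measurable_fst).mul hk
  have hαB : ∀ q, |α q| ≤ B * Lg + B * Lf := fun q =>
    (abs_add_le _ _).trans (add_le_add (abs_mul_le_mul (hBb₀ _) (hLg _))
      (abs_mul_le_mul (hBa₀ _) (hLf _)))
  have hβB : ∀ q, |β q| ≤ (B + B) * Lg + (B + B) * Lf := fun q =>
    (abs_add_le _ _).trans (add_le_add
      (abs_mul_le_mul ((abs_sub _ _).trans (add_le_add (hBb₁ _) (hBb₀ _))) (hLg _))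
      (abs_mul_le_mul ((abs_sub _ _).trans (add_le_add (hBa₁ _) (hBa₀ _))) (hLf _)))
  have hK0 : 0 ≤ K := (norm_nonneg _).trans (hkK 0 0)
  have hWK : ∀ q, ‖W q‖ ≤ 1 * K := fun q => by
    rw [norm_mul]
    gcongr
    exacts [hw1 _, hkK _ _]
  set μ := (volume.restrict Sg).prod (volume.restrict Sf) with hμ
  set F : ℂ → ℂ := fun z => ∫ q, W q * Complex.exp (α q + z * β q) ∂μ with hF
  have hFdiff : Differentiable ℂ F := differentiable_integral_mul_cexp hWm hαm hβm hWK hαB hβB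
  have hFeq : ∀ z, F z = ∫ x, (w x * gz z x) * ∫ y, k x y * fz z y := by
    intro z
    have hint : Integrable (fun q => W q * Complex.exp (α q + z * β q)) μ := by
      refine Integrable.of_bound (by fun_prop : Measurable _).aestronglyMeasurable
        (1 * K * Real.exp ((B * Lg + B * Lf) + |z.re| * ((B + B) * Lg + (B + B) * Lf)))
        (ae_of_all _ fun q => ?_)
      rw [norm_mul, Complex.norm_exp]
      gcongr
      · exact hWK q
      · simp only [Complex.add_re, Complex.ofReal_re, Complex.mul_re, Complex.ofReal_im, mul_zero,
          sub_zero]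
        refine add_le_add ((le_abs_self _).trans (hαB q)) ((le_abs_self _).trans ?_)
        rw [abs_mul]
        gcongr
        exact hβB q
    rw [hF]
    simp only []
    rw [hμ, integral_prod _ hint, ← integral_indicator hSgm]
    refine integral_congr_ae (ae_of_all _ fun x => ?_)
    by_cases hx : x ∈ Sg
    · simp only [indicator_of_mem hx]
      rw [← integral_indicator hSfm, ← integral_const_mul]
      refine integral_congr_ae (ae_of_all _ fun y => ?_)
      by_cases hy : y ∈ Sf
      · simp only [indicator_of_mem hy, hgz, hfz, cpowFamily, ← hSg, ← hSf, indicator_of_mem hx]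
        have : ∀ a b c d : ℂ, a * Complex.exp c * (b * Complex.exp d) = a * b * Complex.exp (c + d)
          := fun a b c d => by rw [Complex.exp_add]; ring
        rw [this]
        simp only [hW, hα, hβ]
        congr 2
        push_cast
        ring
      · simp only [indicator_of_notMem hy, hfz, cpowFamily, ← hSf, mul_zero]
    · simp only [indicator_of_notMem hx, hgz, cpowFamily, ← hSg, mul_zero, zero_mul]
  have hTm : ∀ z, Measurable fun x => ∫ y, k x y * fz z y := fun z =>
    (StronglyMeasurable.integral_prod_right' (f := fun q : 𝔼 × 𝔼 => k q.1 q.2 * fz z q.2)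
      (hk.mul ((hfzm z).comp measurable_snd)).stronglyMeasurable).measurable
  -- Both edges of the strip at once: the moduli depend on `z` through its real part only, and `r`
  -- is the exponent belonging to that edge.
  have edge : ∀ (r : 𝔼 → ℝ) (A : ℝ) (z : ℂ), Measurable r → (∀ x, 1 < r x) → 0 < A →
      KernelBound k r A → (∀ x, (1 - z.re) * a₀ x + z.re * a₁ x = p x / r x) →
      (∀ x, (1 - z.re) * b₀ x + z.re * b₁ x = p x / (p x - 1) * ((r x - 1) / r x)) →
      ‖F z‖ ≤ 2 * A := by
    intro r A z hr hr1 hA hkA hza hzb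
    have hr0 : ∀ x, 0 < r x := fun x => by linarith [hr1 x]
    have hr1' : ∀ x, 0 < r x - 1 := fun x => by linarith [hr1 x]
    have e1 : ∫⁻ x, ‖fz z x‖ₑ ^ r x ≤ 1 := by
      refine le_trans (le_of_eq (lintegral_congr fun x => ?_)) hfm
      refine enorm_cpowFamily_rpow hf z x (hr0 x) (hpp x) ?_
      rw [hza, div_mul_cancel₀ _ (hr0 x).ne']
    have e2 : ∫⁻ x, ‖w x * gz z x‖ₑ ^ (r x / (r x - 1)) ≤ 1 := by
      refine le_trans (lintegral_mono fun x => ?_) hgm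
      have hpos : 0 < r x / (r x - 1) := div_pos (hr0 x) (hr1' x)
      rw [← enorm_cpowFamily_rpow hg z x hpos (div_pos (hpp x) (hp1 x)) (by
        rw [hzb]
        have := (hr0 x).ne'
        have := (hr1' x).ne'
        field_simp)]
      refine ENNReal.rpow_le_rpow ?_ hpos.le
      rw [enorm_mul]
      refine mul_le_of_le_one_left' ?_
      rw [← ofReal_norm]
      exact ENNReal.ofReal_le_one.2 (hw1 x)
    have e3 := hkA (fz z) (hfzm z) (norm_cpowFamily_le hf hBa₀ hBa₁ z)
      ((measure_mono (support_cpowFamily_subset _ _ _ _)).trans_lt hf.support) e1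
    have e4 := enorm_integral_mul_le_of_modular_le_one hr hr1 (hw.mul (hgzm z))
      (by simpa using hA) ENNReal.ofReal_ne_top e2 e3
    rw [hFeq]
    rw [← ofReal_norm] at e4
    have : (2 : ℝ≥0∞) * ENNReal.ofReal A = ENNReal.ofReal (2 * A) := by
      rw [ENNReal.ofReal_mul (by norm_num)]; norm_num
    rw [this] at e4
    exact (ENNReal.ofReal_le_ofReal_iff (by positivity)).1 e4
  have hF0 : ∀ z ∈ Complex.re ⁻¹' {0}, ‖F z‖ ≤ 2 * A₀ := by
    intro z hz
    have hz0 : z.re = 0 := hz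
    exact edge p₀ A₀ z hp₀ (fun x => hl.trans_le (hlp₀ x)) hA₀ h₀
      (fun x => by rw [hz0]; ring) (fun x => by rw [hz0]; ring)
  have hF1 : ∀ z ∈ Complex.re ⁻¹' {1}, ‖F z‖ ≤ 2 * A₁ := by
    intro z hz
    have hz0 : z.re = 1 := hz
    exact edge p₁ A₁ z hp₁ (fun x => hl.trans_le (hlp₁ x)) hA₁ h₁
      (fun x => by rw [hz0]; ring) (fun x => by rw [hz0]; ring)
  have hbdd : BddAbove ((norm ∘ F) '' Complex.HadamardThreeLines.verticalClosedStrip 0 1) := by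
    refine ⟨∫ _, 1 * K * Real.exp ((B * Lg + B * Lf) + 1 * ((B + B) * Lg + (B + B) * Lf)) ∂μ, ?_⟩
    rintro _ ⟨z, hz, rfl⟩
    refine norm_integral_le_of_norm_le (integrable_const _) (ae_of_all _ fun q => ?_)
    rw [norm_mul, Complex.norm_exp]
    gcongr
    · exact hWK q
    · simp only [Complex.add_re, Complex.ofReal_re, Complex.mul_re, Complex.ofReal_im, mul_zero,
        sub_zero]
      refine add_le_add ((le_abs_self _).trans (hαB q)) ((le_abs_self _).trans ?_)
      rw [abs_mul]
      gcongr
      · rw [abs_of_nonneg hz.1]; exact hz.2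
      · exact hβB q
  have hthree := Complex.HadamardThreeLines.norm_le_interp_of_mem_verticalClosedStrip₀₁' F
    (z := (θ : ℂ)) ⟨by simpa using hθ0.le, by simpa using hθ1.le⟩ hFdiff.diffContOnCl hbdd hF0 hF1
  have hFθ : F θ = ∫ x, (w x * g x) * ∫ y, k x y * f y := by
    have e1 : ∀ y, fz θ y = f y := fun y => cpowFamily_eq hf θ y (by
      have h1 := hpθ y
      have h2 := (hpp y).ne'
      calc (1 - θ) * a₀ y + θ * a₁ y = p y * ((1 - θ) / p₀ y + θ / p₁ y) := by
            simp only [ha₀, ha₁]; ring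
        _ = 1 := by rw [← h1]; field_simp)
    have e2 : ∀ x, gz θ x = g x := fun x => cpowFamily_eq hg θ x (by
      have h1 := hpθ x
      have h2 := (hpp x).ne'
      have h3 := (hp1 x).ne'
      have h4 := (hpp₀ x).ne'
      have h5 := (hpp₁ x).ne'
      calc (1 - θ) * b₀ x + θ * b₁ x
          = p x / (p x - 1) * (1 - ((1 - θ) / p₀ x + θ / p₁ x)) := by
            simp only [hb₀, hb₁, sub_div, div_self h4, div_self h5]; ring
        _ = 1 := by rw [← h1]; field_simp)
    rw [hFeq]
    simp only [e1, e2]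
  rw [hFθ, Complex.ofReal_re] at hthree
  refine hthree.trans (le_of_eq ?_)
  rw [Real.mul_rpow (by norm_num) hA₀.le, Real.mul_rpow (by norm_num) hA₁.le]
  have : (2 : ℝ) ^ (1 - θ) * 2 ^ θ = 2 := by
    rw [← Real.rpow_add (by norm_num)]; norm_num
  linear_combination (A₀ ^ (1 - θ) * A₁ ^ θ) * this

/-- Interpolation between variable exponent spaces for integral operators with bounded kernels. -/
theorem modular_interpolation {p p₀ p₁ : 𝔼 → ℝ} (hp : Measurable p) (hp₀ : Measurable p₀)
    (hp₁ : Measurable p₁) {l u : ℝ} (hl : 1 < l) (hlp : ∀ x, l ≤ p x) (hpu : ∀ x, p x ≤ u)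
    (hlp₀ : ∀ x, l ≤ p₀ x) (hlp₁ : ∀ x, l ≤ p₁ x) {θ : ℝ} (hθ0 : 0 < θ) (hθ1 : θ < 1)
    (hpθ : ∀ x, 1 / p x = (1 - θ) / p₀ x + θ / p₁ x)
    {A₀ A₁ : ℝ} (hA₀ : 0 < A₀) (hA₁ : 0 < A₁) {k : 𝔼 → 𝔼 → ℂ}
    (hk : Measurable (Function.uncurry k)) {K : ℝ} (hkK : ∀ x y, ‖k x y‖ ≤ K)
    (h₀ : KernelBound k p₀ A₀) (h₁ : KernelBound k p₁ A₁) {f : 𝔼 → ℝ} (hf : IsTame f)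
    (hfm : ∫⁻ x, ENNReal.ofReal (f x) ^ p x ≤ 1) :
    ∫⁻ x, (‖∫ y, k x y * f y‖ₑ / ENNReal.ofReal (2 * (A₀ ^ (1 - θ) * A₁ ^ θ))) ^ p x ≤ 1 := by
  set D : ℝ := 2 * (A₀ ^ (1 - θ) * A₁ ^ θ) with hD
  have hD0 : 0 < D := by positivity
  set h : 𝔼 → ℂ := fun x => ∫ y, k x y * f y with hh
  have hhm : Measurable h :=
    (StronglyMeasurable.integral_prod_right' (f := fun q : 𝔼 × 𝔼 => k q.1 q.2 * f q.2)
      (hk.mul ((Complex.measurable_ofReal.comp hf.measurable).comp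
        measurable_snd)).stronglyMeasurable).measurable
  obtain ⟨a, b, ha, hab⟩ := hf.bounds
  have hfb : ∀ y, |f y| ≤ |b| := fun y => by
    rcases hab y with h | ⟨h1, h2⟩
    · rw [h, abs_zero]; positivity
    · rw [abs_of_pos (ha.trans_le h1)]; exact h2.trans (le_abs_self b)
  have hK0 : 0 ≤ K := (norm_nonneg _).trans (hkK 0 0)
  have hSfm : MeasurableSet (Function.support f) := measurableSet_support hf.measurable
  have hhM : ∀ x, ‖h x‖ ≤ K * |b| * (volume (Function.support f)).toReal := by
    intro x
    have : h x = ∫ y in Function.support f, k x y * f y := by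
      rw [setIntegral_eq_integral_of_forall_compl_eq_zero]
      intro y hy
      rw [Function.notMem_support.1 hy, Complex.ofReal_zero, mul_zero]
    rw [this]
    refine norm_setIntegral_le_of_norm_le_const hf.support (fun y _ => ?_)
    rw [norm_mul, Complex.norm_real]
    gcongr
    exacts [hkK x y, hfb y]
  have hdual := modular_le_one_of_dual hp hl hlp hpu (v := fun x => ‖h x‖ / D)
    (hhm.norm.div_const D) (fun x => by positivity)
    (M := K * |b| * (volume (Function.support f)).toReal / D)
    (fun x => by gcongr; exact hhM x) ?_
  · refine le_trans (le_of_eq (lintegral_congr fun x => ?_)) hdual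
    rw [ENNReal.ofReal_div_of_pos hD0, ofReal_norm]
  · intro g hg hgm
    -- The phase of `h`, equal to zero where `h` vanishes, turns the pairing into the integral of `g
    -- |h|`.
    set w : 𝔼 → ℂ := fun x => (starRingEnd ℂ) (h x) / (‖h x‖ : ℂ) with hw
    have hwm : Measurable w :=
      (Complex.continuous_conj.measurable.comp hhm).div
        (Complex.measurable_ofReal.comp hhm.norm)
    have hw1 : ∀ x, ‖w x‖ ≤ 1 := fun x => by
      rw [hw]
      simp only [norm_div, RCLike.norm_conj, Complex.norm_real, norm_norm]
      exact div_self_le_one _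
    have key := norm_integral_mul_integral_le hp hp₀ hp₁ hl hlp hpu hlp₀ hlp₁ hθ0 hθ1 hpθ hA₀ hA₁
      hk hkK h₀ h₁ hf hg hfm hgm hwm hw1
    have hwh : ∀ x, (w x * g x) * h x = ((g x * ‖h x‖ : ℝ) : ℂ) := by
      intro x
      by_cases hx : h x = 0
      · simp [hx]
      · have hn : (‖h x‖ : ℂ) ≠ 0 := by simpa using hx
        rw [hw]
        simp only []
        have : (starRingEnd ℂ) (h x) * h x = (‖h x‖ : ℂ) ^ 2 := by
          rw [mul_comm, Complex.mul_conj']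
        push_cast
        field_simp
        linear_combination (g x : ℂ) * this
    have hint : ∫ x, (w x * g x) * ∫ y, k x y * f y = ((∫ x, g x * ‖h x‖ : ℝ) : ℂ) := by
      rw [← integral_complex_ofReal]
      exact integral_congr_ae (ae_of_all _ hwh)
    have hgh : Integrable fun x => g x * ‖h x‖ := by
      obtain ⟨a', b', ha', hab'⟩ := hg.bounds
      have hgb : ∀ y, |g y| ≤ |b'| := fun y => by
        rcases hab' y with h | ⟨h1, h2⟩
        · rw [h, abs_zero]; positivity
        · rw [abs_of_pos (ha'.trans_le h1)]; exact h2.trans (le_abs_self b')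
      have hon : IntegrableOn (fun x => g x * ‖h x‖) (Function.support g) := by
        refine Measure.integrableOn_of_bounded (M := |b'| *
          (K * |b| * (volume (Function.support f)).toReal)) hg.support.ne
          (hg.measurable.mul hhm.norm).aestronglyMeasurable (ae_of_all _ fun x => ?_)
        rw [norm_mul, norm_norm]
        gcongr
        exacts [hgb x, hhM x]
      exact (integrableOn_iff_integrable_of_support_subset (fun x hx => by
        rw [Function.mem_support] at hx ⊢
        exact left_ne_zero_of_mul hx)).1 hon
    rw [hint, Complex.norm_real, Real.norm_eq_abs] at key
    have hlin : ∫⁻ x, ENNReal.ofReal (g x) * ENNReal.ofReal (‖h x‖ / D)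
        = ENNReal.ofReal (D⁻¹ * ∫ x, g x * ‖h x‖) := by
      rw [← integral_const_mul, ofReal_integral_eq_lintegral_ofReal (hgh.const_mul _)]
      · refine lintegral_congr fun x => ?_
        rw [← ENNReal.ofReal_mul (hg.nonneg x)]
        congr 1
        ring
      · exact ae_of_all _ fun x => mul_nonneg (by positivity)
          (mul_nonneg (hg.nonneg x) (norm_nonneg _))
    rw [hlin, ENNReal.ofReal_le_one]
    rw [inv_mul_le_iff₀ hD0, mul_one]
    exact (le_abs_self _).trans key

/-! ### Averaging operators and their Fourier representation. -/

/-- The averaging operator `∫ K(y) f(x - ty) dy` with kernel `K`. -/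
noncomputable def avgOp (K : 𝔼 → ℂ) (t : ℝ) (f : 𝔼 → ℂ) (x : 𝔼) : ℂ :=
  ∫ y, K y * f (x - t • y)

lemma norm_cexp_ofReal_mul_I (a : ℝ) : ‖Complex.exp (a * Complex.I)‖ = 1 :=
  Complex.norm_exp_ofReal_mul_I a

/-- Fourier representation of the averages of a Schwartz function against a complex measure. -/
lemma integral_mul_comp_sub_eq (f : 𝓢(𝔼, ℂ)) {μ : Measure 𝔼} [SFinite μ] {k : 𝔼 → ℂ}
    (hk : Integrable k μ) (t : ℝ) (x : 𝔼) :
    ∫ y, k y * f (x - t • y) ∂μ = ∫ ξ, 𝓕 f ξ *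
      (∫ y, k y * Complex.exp (-(2 * Real.pi * inner ℝ y (t • ξ) : ℝ) * Complex.I) ∂μ) *
        Complex.exp ((2 * Real.pi * inner ℝ ξ x : ℝ) * Complex.I) := by
  have hinv : ∀ z, f z = ∫ ξ, Complex.exp ((2 * Real.pi * inner ℝ ξ z : ℝ) * Complex.I) * 𝓕 f ξ := by
    intro z
    have h1 : (𝓕⁻ (𝓕 f) : 𝓢(𝔼, ℂ)) z = f z := by rw [FourierTransform.fourierInv_fourier_eq]
    rw [← h1, SchwartzMap.fourierInv_coe, Real.fourierInv_eq']
    simp only [smul_eq_mul]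
  set G : 𝔼 → 𝔼 → ℂ := fun y ξ =>
    Complex.exp ((2 * Real.pi * inner ℝ ξ (x - t • y) : ℝ) * Complex.I) with hG
  have hint : Integrable (Function.uncurry fun y ξ => k y * (G y ξ * 𝓕 f ξ)) (μ.prod volume) := by
    have h1 : Integrable (fun q : 𝔼 × 𝔼 => k q.1 * 𝓕 f q.2) (μ.prod volume) :=
      hk.mul_prod (𝓕 f).integrable
    have h2 : Integrable (fun q : 𝔼 × 𝔼 => G q.1 q.2 * (k q.1 * 𝓕 f q.2)) (μ.prod volume) := by
      refine h1.bdd_mul (c := 1) ?_ (ae_of_all _ fun q => (norm_cexp_ofReal_mul_I _).le)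
      have : Continuous fun q : 𝔼 × 𝔼 => G q.1 q.2 := by simp only [hG]; fun_prop
      exact this.aestronglyMeasurable
    refine h2.congr (ae_of_all _ fun q => ?_)
    simp only [Function.uncurry]
    ring
  calc ∫ y, k y * f (x - t • y) ∂μ = ∫ y, (∫ ξ, k y * (G y ξ * 𝓕 f ξ)) ∂μ := by
        refine integral_congr_ae (ae_of_all _ fun y => ?_)
        simp only []
        rw [hinv, integral_const_mul]
    _ = ∫ ξ, ∫ y, k y * (G y ξ * 𝓕 f ξ) ∂μ := integral_integral_swap hint
    _ = _ := by
        refine integral_congr_ae (ae_of_all _ fun ξ => ?_)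
        simp only []
        rw [← integral_const_mul, ← integral_mul_const]
        refine integral_congr_ae (ae_of_all _ fun y => ?_)
        simp only [hG]
        have : Complex.exp ((2 * Real.pi * inner ℝ ξ (x - t • y) : ℝ) * Complex.I) =
            Complex.exp (-(2 * Real.pi * inner ℝ y (t • ξ) : ℝ) * Complex.I) *
            Complex.exp ((2 * Real.pi * inner ℝ ξ x : ℝ) * Complex.I) := by
          rw [← Complex.exp_add]
          congr 1
          rw [inner_sub_right, inner_smul_right, inner_smul_right, real_inner_comm y ξ]
          push_cast
          ring
        rw [this]
        ring

lemma avgOp_schwartz_eq (K : 𝔼 → ℂ) (hK : Integrable K) (f : 𝓢(𝔼, ℂ)) (t : ℝ) (x : 𝔼) :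
    avgOp K t f x = ∫ ξ, 𝓕 f ξ * 𝓕 K (t • ξ) *
      Complex.exp ((2 * Real.pi * inner ℝ ξ x : ℝ) * Complex.I) := by
  rw [avgOp, integral_mul_comp_sub_eq f hK]
  refine integral_congr_ae (ae_of_all _ fun ξ => ?_)
  simp only [Real.fourier_eq', smul_eq_mul]
  congr 2
  refine integral_congr_ae (ae_of_all _ fun y => ?_)
  simp only []
  rw [mul_comm]
  congr 3
  push_cast
  ring

lemma integral_comp_sub_eq_measureFourier {σ : Measure 𝔼} [IsFiniteMeasure σ] (f : 𝓢(𝔼, ℂ)) (t : ℝ)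
    (x : 𝔼) : ∫ y, f (x - t • y) ∂σ = ∫ ξ, 𝓕 f ξ * measureFourier σ (t • ξ) *
      Complex.exp ((2 * Real.pi * inner ℝ ξ x : ℝ) * Complex.I) := by
  have := integral_mul_comp_sub_eq f (μ := σ) (k := fun _ => 1) (integrable_const _) t x
  simp only [one_mul] at this
  exact this

lemma multiplierOp_measureFourier {σ : Measure 𝔼} [IsFiniteMeasure σ] (f : 𝓢(𝔼, ℂ)) (t : ℝ)
    (x : 𝔼) : multiplierOp (measureFourier σ) t f x = ∫ y, f (x - t • y) ∂σ := by
  rw [integral_comp_sub_eq_measureFourier, multiplierOp, Real.fourierInv_eq']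
  refine integral_congr_ae (ae_of_all _ fun ξ => ?_)
  simp only [smul_eq_mul]
  rw [mul_comm]
  rfl

lemma maximalMultiplier_measureFourier {σ : Measure 𝔼} [IsFiniteMeasure σ] (f : 𝓢(𝔼, ℂ)) :
    maximalMultiplier (measureFourier σ) f = maximalAverage σ (fun x => f x) := by
  ext x
  simp only [maximalMultiplier, maximalAverage, multiplierOp_measureFourier]

/-! ### The measure -/

/-- Finiteness is not assumed of `σ`: it follows by covering the compact carrier with finitely many
unit balls. -/
lemma LocallyUniformlyDimensional.isFiniteMeasure {σ : Measure 𝔼} {β : ℝ}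
    (hσ : CompactlySupported σ) (hdim : LocallyUniformlyDimensional σ β) : IsFiniteMeasure σ := by
  obtain ⟨K, hK, hKσ⟩ := hσ
  obtain ⟨C, hC⟩ := hdim
  have : σ K < ∞ := by
    refine hK.measure_lt_top_of_nhdsWithin fun x _ => ⟨ball x 1, ?_, ?_⟩
    · exact mem_nhdsWithin_of_mem_nhds (ball_mem_nhds x one_pos)
    · exact (hC x 1 one_pos le_rfl).trans_lt ENNReal.ofReal_lt_top
  constructor
  calc σ univ = σ (K ∪ Kᶜ) := by rw [union_compl_self]
    _ ≤ σ K + σ Kᶜ := measure_union_le _ _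
    _ < ∞ := by rw [hKσ, add_zero]; exact this

lemma CompactlySupported.exists_ae_norm_le {σ : Measure 𝔼} (hσ : CompactlySupported σ) :
    ∃ R : ℝ, 0 ≤ R ∧ ∀ᵐ y ∂σ, ‖y‖ ≤ R := by
  obtain ⟨K, hK, hKσ⟩ := hσ
  obtain ⟨R, hR⟩ := hK.isBounded.exists_norm_le
  refine ⟨max R 0, le_max_right _ _, ?_⟩
  rw [ae_iff]
  refine measure_mono_null (fun y hy => ?_) hKσ
  intro hyK
  exact hy ((hR y hyK).trans (le_max_left _ _))

/-- For a finite measure, the ball condition at small radii extends to all radii. -/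
lemma LocallyUniformlyDimensional.exists_measure_ball_le {σ : Measure 𝔼} [IsFiniteMeasure σ] {β : ℝ}
    (hβ : 0 ≤ β) (hdim : LocallyUniformlyDimensional σ β) :
    ∃ C : ℝ, 0 < C ∧ ∀ (x : 𝔼) (R : ℝ), 0 < R → σ (ball x R) ≤ ENNReal.ofReal (C * R ^ β) := by
  obtain ⟨C, hC⟩ := hdim
  refine ⟨max (max C 1) (σ univ).toReal, by positivity, fun x R hR => ?_⟩
  rcases le_or_gt R 1 with h | h
  · refine (hC x R hR h).trans (ENNReal.ofReal_le_ofReal ?_)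
    gcongr
    exact (le_max_left _ _).trans (le_max_left _ _)
  · calc σ (ball x R) ≤ σ univ := measure_mono (subset_univ _)
      _ = ENNReal.ofReal (σ univ).toReal := (ENNReal.ofReal_toReal (measure_ne_top _ _)).symm
      _ ≤ _ := by
        refine ENNReal.ofReal_le_ofReal ?_
        have h1 : 1 ≤ R ^ β := Real.one_le_rpow h.le hβ
        have h2 : (σ univ).toReal ≤ max (max C 1) (σ univ).toReal := le_max_right _ _
        have h3 : 0 ≤ (σ univ).toReal := ENNReal.toReal_nonneg
        nlinarith

/-- A finite measure with bounded support has moments of all orders, so its characteristic function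
is smooth, and `measureFourier` is that function evaluated at `-2πξ`. -/
lemma contDiff_measureFourier {σ : Measure 𝔼} [IsFiniteMeasure σ] (hσ : CompactlySupported σ) :
    ContDiff ℝ (⊤ : ℕ∞) (measureFourier σ) := by
  obtain ⟨R, hR0, hR⟩ := hσ.exists_ae_norm_le
  have hmom : ∀ k : ℕ, MemLp (id : 𝔼 → 𝔼) k σ := fun k =>
    MemLp.of_bound aestronglyMeasurable_id R hR
  have h : ContDiff ℝ (⊤ : ℕ∞) fun ξ : 𝔼 => charFun σ ((-(2 * Real.pi)) • ξ) :=
    (contDiff_charFun' hmom).comp (by fun_prop)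
  convert h using 2 with ξ
  rw [measureFourier, charFun_apply]
  refine integral_congr_ae (ae_of_all _ fun y => ?_)
  simp only [inner_smul_right]
  congr 1
  push_cast
  ring

/-! ### The Littlewood–Paley cutoff -/

/-- A smooth bump function equal to one on the unit ball and supported in the ball of radius
two. -/
noncomputable def freqBump : ContDiffBump (0 : 𝔼) := ⟨1, 2, one_pos, one_lt_two⟩

/-- The frequency cutoff at scale `s⁻¹`. -/
noncomputable def cutoff (s : ℝ) (ξ : 𝔼) : ℂ := ((freqBump (s • ξ) : ℝ) : ℂ)

lemma cutoff_eq_one {s : ℝ} {ξ : 𝔼} (h : ‖s • ξ‖ ≤ 1) : cutoff s ξ = 1 := by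
  rw [cutoff, freqBump.one_of_mem_closedBall, Complex.ofReal_one]
  rw [mem_closedBall, dist_zero_right]
  exact h

lemma cutoff_eq_zero {s : ℝ} {ξ : 𝔼} (h : 2 ≤ ‖s • ξ‖) : cutoff s ξ = 0 := by
  rw [cutoff, freqBump.zero_of_le_dist, Complex.ofReal_zero]
  rw [dist_zero_right]
  exact h

lemma contDiff_cutoff (s : ℝ) : ContDiff ℝ (⊤ : ℕ∞) (cutoff (n := n) s) := by
  unfold cutoff
  have h1 : ContDiff ℝ (⊤ : ℕ∞) fun ξ : 𝔼 => freqBump (s • ξ) :=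
    freqBump.contDiff.comp (by fun_prop : ContDiff ℝ (⊤ : ℕ∞) fun ξ : 𝔼 => s • ξ)
  exact Complex.ofRealCLM.contDiff.comp h1

lemma hasCompactSupport_cutoff {s : ℝ} (hs : 0 < s) : HasCompactSupport (cutoff (n := n) s) := by
  refine HasCompactSupport.intro (isCompact_closedBall (0 : 𝔼) (2 / s)) fun ξ hξ => ?_
  apply cutoff_eq_zero
  rw [mem_closedBall, dist_zero_right, not_le, div_lt_iff₀ hs] at hξ
  rw [norm_smul, Real.norm_of_nonneg hs.le]
  linarith

/-- The inverse Fourier transform of the frequency bump. -/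
noncomputable def bumpKernel : 𝓢(𝔼, ℂ) :=
  𝓕⁻ ((hasCompactSupport_cutoff one_pos).toSchwartzMap (contDiff_cutoff 1) : 𝓢(𝔼, ℂ))

/-- The `L¹`-normalized dilates of `bumpKernel`. -/
noncomputable def mollifier (s : ℝ) (z : 𝔼) : ℂ := ((s ^ n)⁻¹ : ℝ) * bumpKernel (s⁻¹ • z)

/-- The convolution of a measure with `mollifier s`. -/
noncomputable def smoothed (σ : Measure 𝔼) (s : ℝ) (x : 𝔼) : ℂ := ∫ y, mollifier s (x - y) ∂σ

lemma bumpKernel_apply (z : 𝔼) : bumpKernel z = 𝓕⁻ (cutoff (n := n) 1) z := by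
  rw [bumpKernel, SchwartzMap.fourierInv_coe]
  rfl

lemma mollifier_eq_fourierInv {s : ℝ} (hs : 0 < s) (z : 𝔼) :
    mollifier s z = 𝓕⁻ (cutoff (n := n) s) z := by
  rw [mollifier, bumpKernel_apply, Real.fourierInv_eq', Real.fourierInv_eq']
  have h := Measure.integral_comp_smul (volume : Measure 𝔼)
    (fun v : 𝔼 => Complex.exp (((2 * Real.pi * inner ℝ v (s⁻¹ • z) : ℝ) : ℂ) * Complex.I) •
      cutoff (n := n) 1 v) s
  simp only [finrank_euclideanSpace, Fintype.card_fin] at h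
  rw [abs_of_pos (by positivity)] at h
  rw [← Complex.real_smul, ← h]
  refine integral_congr_ae (ae_of_all _ fun v => ?_)
  simp only []
  have h1 : cutoff s v = cutoff 1 (s • v) := by simp [cutoff]
  have h2 : inner ℝ (s • v) (s⁻¹ • z) = inner ℝ v z := by
    rw [inner_smul_left, inner_smul_right, conj_trivial, mul_inv_cancel_left₀ hs.ne']
  rw [h1, h2]

lemma continuous_mollifier (s : ℝ) : Continuous (mollifier (n := n) s) := by
  unfold mollifier
  have := (bumpKernel (n := n)).continuous
  fun_prop

/-- The integral is the value of the Fourier transform at the origin, where the cutoff equals one.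
This normalization makes the smoothed averages converge to the averages over `σ`. -/
lemma integral_bumpKernel : ∫ z : 𝔼, bumpKernel z = 1 := by
  have h1 : 𝓕 (bumpKernel (n := n)) = (hasCompactSupport_cutoff one_pos).toSchwartzMap
      (contDiff_cutoff 1) := FourierTransform.fourier_fourierInv_eq _
  have h2 : 𝓕 (bumpKernel (n := n)) (0 : 𝔼) = 1 := by
    rw [h1]
    exact cutoff_eq_one (by simp)
  rw [← h2, SchwartzMap.fourier_coe, Real.fourier_eq']
  simp

lemma hasCompactSupport_measureFourier_mul_cutoff (σ : Measure 𝔼) {s : ℝ} (hs : 0 < s) :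
    HasCompactSupport fun ξ => measureFourier σ ξ * cutoff s ξ :=
  (hasCompactSupport_cutoff hs).mul_left

/-- The convolution of a compactly supported measure with `mollifier s` is a Schwartz function. -/
noncomputable def smoothedSchwartz {σ : Measure 𝔼} [IsFiniteMeasure σ] (hσ : CompactlySupported σ)
    {s : ℝ} (hs : 0 < s) : 𝓢(𝔼, ℂ) :=
  𝓕⁻ ((hasCompactSupport_measureFourier_mul_cutoff σ hs).toSchwartzMap
    ((contDiff_measureFourier hσ).mul (contDiff_cutoff s)) : 𝓢(𝔼, ℂ))

/-- The frequency description shows that the function is Schwartz and serves the `L²` estimate; the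
convolution description serves the pointwise estimate. -/
lemma smoothedSchwartz_apply {σ : Measure 𝔼} [IsFiniteMeasure σ] (hσ : CompactlySupported σ)
    {s : ℝ} (hs : 0 < s) (x : 𝔼) : smoothedSchwartz hσ hs x = smoothed σ s x := by
  set B : 𝓢(𝔼, ℂ) := (hasCompactSupport_cutoff hs).toSchwartzMap (contDiff_cutoff s) with hB
  have h1 : ∀ z, (𝓕⁻ B : 𝓢(𝔼, ℂ)) z = mollifier s z := by
    intro z
    rw [mollifier_eq_fourierInv hs, SchwartzMap.fourierInv_coe]
    rfl
  have h2 := integral_comp_sub_eq_measureFourier (σ := σ) (𝓕⁻ B : 𝓢(𝔼, ℂ)) 1 x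
  rw [FourierTransform.fourier_fourierInv_eq] at h2
  simp only [h1, one_smul] at h2
  rw [smoothed, h2, smoothedSchwartz, SchwartzMap.fourierInv_coe, Real.fourierInv_eq']
  refine integral_congr_ae (ae_of_all _ fun ξ => ?_)
  simp only [smul_eq_mul, HasCompactSupport.toSchwartzMap_toFun, hB]
  rw [mul_comm]
  congr 1
  exact mul_comm _ _

lemma fourier_smoothedSchwartz {σ : Measure 𝔼} [IsFiniteMeasure σ] (hσ : CompactlySupported σ)
    {s : ℝ} (hs : 0 < s) (ξ : 𝔼) :
    𝓕 (smoothedSchwartz hσ hs) ξ = measureFourier σ ξ * cutoff s ξ := by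
  rw [smoothedSchwartz, FourierTransform.fourier_fourierInv_eq]
  rfl

/-- The pointwise bound for the smoothed measure. -/
lemma exists_norm_smoothed_le {σ : Measure 𝔼} [IsFiniteMeasure σ] (hσ : CompactlySupported σ)
    {β : ℝ} (hβ0 : 0 ≤ β) (hβn : β ≤ n) (hdim : LocallyUniformlyDimensional σ β) :
    ∃ C : ℝ, 0 < C ∧ ∀ s : ℝ, 0 < s → s ≤ 1 → ∀ x : 𝔼,
      ‖smoothed σ s x‖ ≤ C * s ^ (β - n) * (1 + ‖x‖) ^ (-((n : ℝ) + 1)) := by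
  obtain ⟨R, hR0, hR⟩ := hσ.exists_ae_norm_le
  obtain ⟨C₀, hC₀, hball⟩ := hdim.exists_measure_ball_le hβ0
  -- Decay of order `2(n+1)` is written as two equal factors. One pays for the decay in `x`, using
  -- `|y| ≤ R` on the carrier of `σ` and `s ≤ 1`; the other is integrated against `σ`.
  obtain ⟨C₁, hC₁, hdecay⟩ : ∃ C : ℝ, 0 < C ∧ ∀ z : 𝔼, ‖bumpKernel z‖ ≤
      C * ((1 + ‖z‖) ^ (-((n : ℝ) + 1)) * (1 + ‖z‖) ^ (-((n : ℝ) + 1))) := by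
    have h := SchwartzMap.one_add_le_sup_seminorm_apply (𝕜 := ℂ) (m := (2 * (n + 1), 0))
      (k := 2 * (n + 1)) (n := 0) le_rfl le_rfl (bumpKernel (n := n))
    set D := 2 ^ (2 * (n + 1), 0).1 * (Finset.Iic (2 * (n + 1), 0)).sup
      (fun m => SchwartzMap.seminorm ℂ m.1 m.2) (bumpKernel (n := n)) with hD
    refine ⟨max D 1, by positivity, fun z => ?_⟩
    have hz : 0 < 1 + ‖z‖ := by positivity
    have h1 := (h z).trans (le_max_left D 1)
    rw [norm_iteratedFDeriv_zero] at h1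
    have h2 : (1 + ‖z‖) ^ (-((n : ℝ) + 1)) * (1 + ‖z‖) ^ (-((n : ℝ) + 1)) =
        ((1 + ‖z‖) ^ (2 * (n + 1)))⁻¹ := by
      rw [← Real.rpow_add hz, ← Real.rpow_natCast, ← Real.rpow_neg hz.le]
      congr 1
      push_cast
      ring
    rw [h2, ← div_eq_mul_inv, le_div_iff₀ (by positivity), mul_comm]
    exact h1
  refine ⟨C₁ * (1 + R) ^ (n + 1) * (C₀ * 2 ^ (n + 2)), by positivity, fun s hs hs1 x => ?_⟩
  have hx : 0 < 1 + ‖x‖ := by positivity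
  have hker : ∀ᵐ y ∂σ, ‖mollifier s (x - y)‖ₑ ≤
      ENNReal.ofReal ((s ^ n)⁻¹ * (C₁ * (1 + R) ^ (n + 1) * (1 + ‖x‖) ^ (-((n : ℝ) + 1)))) *
        ENNReal.ofReal ((1 + ‖s⁻¹ • (x - y)‖) ^ (-((n : ℝ) + 1))) := by
    filter_upwards [hR] with y hy
    rw [← ENNReal.ofReal_mul (by positivity), ← ofReal_norm]
    refine ENNReal.ofReal_le_ofReal ?_
    rw [mollifier, norm_mul, Complex.norm_real, Real.norm_of_nonneg (by positivity)]
    set w := 1 + ‖s⁻¹ • (x - y)‖ with hw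
    have hw0 : 0 < w := by positivity
    suffices hww : w ^ (-((n : ℝ) + 1)) ≤ (1 + R) ^ (n + 1) * (1 + ‖x‖) ^ (-((n : ℝ) + 1)) by
      calc (s ^ n)⁻¹ * ‖bumpKernel (s⁻¹ • (x - y))‖
          ≤ (s ^ n)⁻¹ * (C₁ * (w ^ (-((n : ℝ) + 1)) * w ^ (-((n : ℝ) + 1)))) := by
            gcongr
            exact hdecay _
        _ ≤ (s ^ n)⁻¹ * (C₁ * (((1 + R) ^ (n + 1) * (1 + ‖x‖) ^ (-((n : ℝ) + 1))) *
              w ^ (-((n : ℝ) + 1)))) := by gcongr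
        _ = _ := by ring
    have hxw : 1 + ‖x‖ ≤ (1 + R) * w := by
      have h1 : ‖x - y‖ ≤ ‖s⁻¹ • (x - y)‖ := by
        rw [norm_smul, norm_inv, Real.norm_of_nonneg hs.le]
        exact le_mul_of_one_le_left (norm_nonneg _) ((one_le_inv₀ hs).2 hs1)
      have h2 : ‖x‖ ≤ ‖x - y‖ + ‖y‖ := by simpa using norm_add_le (x - y) y
      have h3 : 0 ≤ R * ‖s⁻¹ • (x - y)‖ := by positivity
      rw [hw]
      nlinarith
    have e : ∀ a : ℝ, 0 < a → a ^ (-((n : ℝ) + 1)) = (a ^ (n + 1))⁻¹ := by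
      intro a ha
      rw [Real.rpow_neg ha.le, ← Real.rpow_natCast]
      push_cast
      rfl
    rw [e w hw0, e _ hx, ← div_eq_mul_inv, le_div_iff₀ (by positivity),
      inv_mul_le_iff₀ (by positivity), ← mul_pow, mul_comm w]
    gcongr
  have hsum : ∫⁻ y, ENNReal.ofReal ((1 + ‖s⁻¹ • (x - y)‖) ^ (-((n : ℝ) + 1))) ∂σ ≤
      ENNReal.ofReal (C₀ * 2 ^ (n + 2) * s ^ β) := by
    set c : ℝ≥0∞ := 2 ^ (n + 1) with hc
    have hmem : ∀ (k : ℕ) (y : 𝔼), ‖s⁻¹ • (x - y)‖ < 2 ^ k ↔ y ∈ ball x (s * 2 ^ k) := by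
      intro k y
      rw [norm_smul, norm_inv, Real.norm_of_nonneg hs.le, inv_mul_lt_iff₀ hs, mem_ball, dist_comm,
        dist_eq_norm]
    calc ∫⁻ y, ENNReal.ofReal ((1 + ‖s⁻¹ • (x - y)‖) ^ (-((n : ℝ) + 1))) ∂σ
        ≤ ∫⁻ y, ∑' k : ℕ, (ball x (s * 2 ^ k)).indicator (fun _ => c * c⁻¹ ^ k) y ∂σ := by
          refine lintegral_mono fun y => ?_
          refine (one_add_rpow_neg_le_tsum (norm_nonneg _)).trans (le_of_eq ?_)
          refine tsum_congr fun k => ?_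
          by_cases h : y ∈ ball x (s * 2 ^ k)
          · rw [if_pos ((hmem k y).2 h), indicator_of_mem h]
          · rw [if_neg (mt (hmem k y).1 h), indicator_of_notMem h]
      _ = ∑' k : ℕ, c * c⁻¹ ^ k * σ (ball x (s * 2 ^ k)) := by
          rw [lintegral_tsum fun k => (measurable_const.indicator measurableSet_ball).aemeasurable]
          refine tsum_congr fun k => ?_
          rw [lintegral_indicator measurableSet_ball, setLIntegral_const]
      _ ≤ ∑' k : ℕ, (2 : ℝ≥0∞)⁻¹ ^ k * (c * ENNReal.ofReal (C₀ * s ^ β)) := by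
          refine ENNReal.tsum_le_tsum fun k => ?_
          -- As `β ≤ n`, the growth `2^(kβ)` is at most `2^(kn)`, and the weight `2^(-(n+1)k)` still
          -- leaves a geometric series.
          have h1 : σ (ball x (s * 2 ^ k)) ≤ ENNReal.ofReal (C₀ * s ^ β) * (2 ^ n) ^ k := by
            refine (hball x _ (by positivity)).trans ?_
            have : (2 : ℝ≥0∞) ^ n = ENNReal.ofReal (2 ^ n) := by
              rw [ENNReal.ofReal_pow (by norm_num)]; norm_num
            rw [this, ← ENNReal.ofReal_pow (by positivity), ← ENNReal.ofReal_mul (by positivity)]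
            refine ENNReal.ofReal_le_ofReal ?_
            rw [Real.mul_rpow hs.le (by positivity), mul_assoc]
            gcongr
            rw [← pow_mul, mul_comm n k, pow_mul, ← Real.rpow_natCast ((2 : ℝ) ^ k) n]
            exact Real.rpow_le_rpow_of_exponent_le (one_le_pow₀ one_le_two) hβn
          have h2 : c⁻¹ ^ k * (2 ^ n) ^ k = (2 : ℝ≥0∞)⁻¹ ^ k := by
            rw [← mul_pow, hc, pow_succ, ENNReal.mul_inv (by simp) (by simp), mul_right_comm,
              ENNReal.inv_mul_cancel (by simp) (by simp), one_mul]
          calc c * c⁻¹ ^ k * σ (ball x (s * 2 ^ k))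
              ≤ c * c⁻¹ ^ k * (ENNReal.ofReal (C₀ * s ^ β) * (2 ^ n) ^ k) := by gcongr
            _ = (c⁻¹ ^ k * (2 ^ n) ^ k) * (c * ENNReal.ofReal (C₀ * s ^ β)) := by ring
            _ = _ := by rw [h2]
      _ = _ := by
          rw [ENNReal.tsum_mul_right, ENNReal.tsum_geometric, ENNReal.one_sub_inv_two, inv_inv, hc]
          have : (2 : ℝ≥0∞) = ENNReal.ofReal 2 := by norm_num
          rw [this, ← ENNReal.ofReal_pow (by norm_num), ← ENNReal.ofReal_mul (by positivity),
            ← ENNReal.ofReal_mul (by positivity)]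
          congr 1
          ring
  have hfinal : ‖smoothed σ s x‖ₑ ≤ ENNReal.ofReal (C₁ * (1 + R) ^ (n + 1) * (C₀ * 2 ^ (n + 2)) *
      s ^ (β - n) * (1 + ‖x‖) ^ (-((n : ℝ) + 1))) := by
    calc ‖smoothed σ s x‖ₑ ≤ ∫⁻ y, ‖mollifier s (x - y)‖ₑ ∂σ := enorm_integral_le_lintegral_enorm _
      _ ≤ _ := lintegral_mono_ae hker
      _ ≤ ENNReal.ofReal ((s ^ n)⁻¹ * (C₁ * (1 + R) ^ (n + 1) *
            (1 + ‖x‖) ^ (-((n : ℝ) + 1)))) * ENNReal.ofReal (C₀ * 2 ^ (n + 2) * s ^ β) := by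
        rw [lintegral_const_mul' _ _ ENNReal.ofReal_ne_top]
        gcongr
      _ = _ := by
        rw [← ENNReal.ofReal_mul (by positivity)]
        congr 1
        rw [Real.rpow_sub hs, Real.rpow_natCast]
        field_simp
  rw [← ofReal_norm] at hfinal
  exact (ENNReal.ofReal_le_ofReal_iff (by positivity)).1 hfinal

/-! ### The `L²` maximal estimate for a frequency-localized kernel. -/

/-- The oscillatory integral `∫ f^(ξ) N(tξ) exp(2πi ⟨ξ, x⟩) dξ`. -/
noncomputable def multInt (f : 𝓢(𝔼, ℂ)) (N : 𝔼 → ℂ) (t : ℝ) (x : 𝔼) : ℂ :=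
  ∫ ξ, 𝓕 f ξ * N (t • ξ) * Complex.exp ((2 * Real.pi * inner ℝ ξ x : ℝ) * Complex.I)

lemma continuous_multInt (f : 𝓢(𝔼, ℂ)) {N : 𝔼 → ℂ} (hN : Continuous N) {B : ℝ}
    (hB : ∀ ξ, ‖N ξ‖ ≤ B) : Continuous fun q : ℝ × 𝔼 => multInt f N q.1 q.2 := by
  unfold multInt
  have hf := (𝓕 f).continuous
  refine continuous_of_dominated (bound := fun ξ => ‖𝓕 f ξ‖ * B) (fun q => ?_) (fun q => ?_) ?_ ?_
  · exact (by fun_prop : Continuous fun ξ : 𝔼 => 𝓕 f ξ * N (q.1 • ξ) *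
      Complex.exp ((2 * Real.pi * inner ℝ ξ q.2 : ℝ) * Complex.I)).aestronglyMeasurable
  · refine ae_of_all _ fun ξ => ?_
    rw [norm_mul, norm_mul, norm_cexp_ofReal_mul_I, mul_one]
    gcongr
    exact hB _
  · exact (𝓕 f).integrable.norm.mul_const B
  · exact ae_of_all _ fun ξ => by fun_prop

/-- The derivative of `t ↦ M(tξ)` is `t⁻¹ N(tξ)` with `N(η) = DM(η)η`, so differentiating in `t`
gives an integral of the same type, to which Plancherel applies again. -/
lemma hasDerivAt_multInt (f : 𝓢(𝔼, ℂ)) {M : 𝔼 → ℂ} (hM : ContDiff ℝ (⊤ : ℕ∞) M)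
    (hMc : HasCompactSupport M) (x : 𝔼) {t : ℝ} (ht : t ≠ 0) :
    HasDerivAt (fun t => multInt f M t x) (t⁻¹ * multInt f (fun η => fderiv ℝ M η η) t x) t := by
  have hMcont := hM.continuous
  have hdM : Continuous (fderiv ℝ M) := hM.continuous_fderiv (by simp)
  obtain ⟨D, hD⟩ := hdM.bounded_above_of_compact_support (hMc.fderiv ℝ)
  obtain ⟨B, hB⟩ := hMcont.bounded_above_of_compact_support hMc
  have hf := (𝓕 f).continuous
  have key := hasDerivAt_integral_of_dominated_loc_of_deriv_le (μ := (volume : Measure 𝔼))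
    (F := fun t ξ => 𝓕 f ξ * M (t • ξ) *
      Complex.exp ((2 * Real.pi * inner ℝ ξ x : ℝ) * Complex.I))
    (F' := fun t ξ => 𝓕 f ξ * (fderiv ℝ M (t • ξ) ξ) *
      Complex.exp ((2 * Real.pi * inner ℝ ξ x : ℝ) * Complex.I))
    (x₀ := t) (s := univ) (bound := fun ξ => D * (‖ξ‖ ^ 1 * ‖𝓕 f ξ‖)) univ_mem ?_ ?_ ?_ ?_ ?_ ?_
  · refine key.2.congr_deriv ?_
    rw [multInt, ← integral_const_mul]
    refine integral_congr_ae (ae_of_all _ fun ξ => ?_)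
    simp only [map_smul, Complex.real_smul]
    have : (t : ℂ) ≠ 0 := by exact_mod_cast ht
    push_cast
    field_simp
  · exact Eventually.of_forall fun t =>
      (by fun_prop : Continuous fun ξ : 𝔼 => 𝓕 f ξ * M (t • ξ) *
        Complex.exp ((2 * Real.pi * inner ℝ ξ x : ℝ) * Complex.I)).aestronglyMeasurable
  · refine ((𝓕 f).integrable.norm.mul_const B).mono'
      (by fun_prop : Continuous fun ξ : 𝔼 => 𝓕 f ξ * M (t • ξ) *
        Complex.exp ((2 * Real.pi * inner ℝ ξ x : ℝ) * Complex.I)).aestronglyMeasurable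
      (ae_of_all _ fun ξ => ?_)
    rw [norm_mul, norm_mul, norm_cexp_ofReal_mul_I, mul_one]
    gcongr
    exact hB _
  · have h1 : Continuous fun ξ : 𝔼 => fderiv ℝ M (t • ξ) ξ :=
      (hdM.comp (by fun_prop : Continuous fun ξ : 𝔼 => t • ξ)).clm_apply continuous_id
    exact (by fun_prop : Continuous fun ξ : 𝔼 => 𝓕 f ξ * (fderiv ℝ M (t • ξ) ξ) *
        Complex.exp ((2 * Real.pi * inner ℝ ξ x : ℝ) * Complex.I)).aestronglyMeasurable
  · refine ae_of_all _ fun ξ s _ => ?_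
    rw [norm_mul, norm_mul, norm_cexp_ofReal_mul_I, mul_one, pow_one]
    calc ‖𝓕 f ξ‖ * ‖fderiv ℝ M (s • ξ) ξ‖ ≤ ‖𝓕 f ξ‖ * (D * ‖ξ‖) := by
          gcongr
          exact (fderiv ℝ M (s • ξ)).le_of_opNorm_le (hD _) ξ
      _ = _ := by ring
  · exact ((𝓕 f).integrable_pow_mul volume 1).const_mul D
  · refine ae_of_all _ fun ξ s _ => ?_
    have h1 : HasDerivAt (fun s : ℝ => s • ξ) ξ s := by
      simpa using (hasDerivAt_id s).smul_const ξ
    have h2 : HasDerivAt (fun s : ℝ => M (s • ξ)) (fderiv ℝ M (s • ξ) ξ) s :=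
      ((hM.differentiable (by simp)) (s • ξ)).hasFDerivAt.comp_hasDerivAt s h1
    exact (h2.const_mul (𝓕 f ξ)).mul_const _

lemma lintegral_enorm_sq_eq (g : 𝓢(𝔼, ℂ)) :
    ∫⁻ x, ‖g x‖ₑ ^ 2 = ENNReal.ofReal (∫ x, ‖g x‖ ^ 2) := by
  rw [ofReal_integral_eq_lintegral_ofReal]
  · refine lintegral_congr fun x => ?_
    rw [ENNReal.ofReal_pow (norm_nonneg _), ofReal_norm]
  · exact (memLp_two_iff_integrable_sq_norm g.continuous.aestronglyMeasurable).1 (g.memLp 2)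
  · exact ae_of_all _ fun x => by positivity

lemma lintegral_enorm_sq_fourier (g : 𝓢(𝔼, ℂ)) :
    ∫⁻ x, ‖𝓕 g x‖ₑ ^ 2 = ∫⁻ x, ‖g x‖ₑ ^ 2 := by
  rw [lintegral_enorm_sq_eq, lintegral_enorm_sq_eq, SchwartzMap.integral_norm_sq_fourier]

/-- Plancherel: the integral is the inverse Fourier transform of the Schwartz function `𝓕 f ·
N(t·)`. -/
lemma lintegral_enorm_sq_multInt (f : 𝓢(𝔼, ℂ)) {N : 𝔼 → ℂ} (hN : ContDiff ℝ (⊤ : ℕ∞) N)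
    (hNc : HasCompactSupport N) {t : ℝ} (ht : t ≠ 0) :
    ∫⁻ x, ‖multInt f N t x‖ₑ ^ 2 = ∫⁻ ξ, ‖𝓕 f ξ‖ₑ ^ 2 * ‖N (t • ξ)‖ₑ ^ 2 := by
  have hNt : ContDiff ℝ (⊤ : ℕ∞) fun ξ => 𝓕 f ξ * N (t • ξ) :=
    ((𝓕 f).smooth ⊤).mul (hN.comp (by fun_prop))
  have hNtc : HasCompactSupport fun ξ => 𝓕 f ξ * N (t • ξ) :=
    (hNc.comp_smul ht).mul_left
  set G : 𝓢(𝔼, ℂ) := hNtc.toSchwartzMap hNt with hG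
  have h1 : ∀ x, multInt f N t x = (𝓕⁻ G : 𝓢(𝔼, ℂ)) x := by
    intro x
    rw [SchwartzMap.fourierInv_coe, Real.fourierInv_eq', multInt]
    refine integral_congr_ae (ae_of_all _ fun ξ => ?_)
    simp only [smul_eq_mul, hG, HasCompactSupport.toSchwartzMap_toFun]
    rw [mul_comm]
  simp only [h1]
  rw [← lintegral_enorm_sq_fourier, FourierTransform.fourier_fourierInv_eq]
  refine lintegral_congr fun ξ => ?_
  rw [← mul_pow, ← enorm_mul]
  rfl

/-- The Sobolev inequality on `[1, 2]`, with a free parameter. -/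
lemma sq_norm_le_of_hasDerivAt {v v' : ℝ → ℂ} (hv : ∀ s ∈ Icc (1 : ℝ) 2, HasDerivAt v (v' s) s)
    (hv' : ContinuousOn v' (Icc 1 2)) {L : ℝ} (hL : 0 < L) {s : ℝ} (hs : s ∈ Icc (1 : ℝ) 2) :
    ‖v s‖ ^ 2 ≤ (1 + L) * (∫ r in (1 : ℝ)..2, ‖v r‖ ^ 2) + L⁻¹ * ∫ r in (1 : ℝ)..2, ‖v' r‖ ^ 2 := by
  have hvc : ContinuousOn v (Icc 1 2) := fun r hr => (hv r hr).continuousAt.continuousWithinAt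
  have hle : (1 : ℝ) ≤ 2 := one_le_two
  have i1 : IntervalIntegrable (fun r => ‖v r‖ ^ 2) volume 1 2 := by
    refine ContinuousOn.intervalIntegrable ?_
    rw [uIcc_of_le hle]
    exact hvc.norm.pow 2
  have i2 : IntervalIntegrable (fun r => ‖v' r‖ ^ 2) volume 1 2 := by
    refine ContinuousOn.intervalIntegrable ?_
    rw [uIcc_of_le hle]
    exact hv'.norm.pow 2
  set J : ℝ := ∫ r in (1 : ℝ)..2, (L * ‖v r‖ ^ 2 + L⁻¹ * ‖v' r‖ ^ 2) with hJ
  have hJ' : J = L * (∫ r in (1 : ℝ)..2, ‖v r‖ ^ 2) + L⁻¹ * ∫ r in (1 : ℝ)..2, ‖v' r‖ ^ 2 := by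
    rw [hJ, intervalIntegral.integral_add (i1.const_mul L) (i2.const_mul L⁻¹),
      intervalIntegral.integral_const_mul, intervalIntegral.integral_const_mul]
  have hdiff : ∀ r ∈ Icc (1 : ℝ) 2, ‖v s‖ ^ 2 ≤ ‖v r‖ ^ 2 + J := by
    intro r hr
    have hsub : uIcc r s ⊆ Icc 1 2 := by
      rw [← uIcc_of_le hle] at hr hs ⊢
      exact uIcc_subset_uIcc hr hs
    have hder : ∀ y ∈ uIcc r s, HasDerivAt (fun y => ‖v y‖ ^ 2) (2 * inner ℝ (v y) (v' y)) y :=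
      fun y hy => (hv y (hsub hy)).norm_sq
    have hcont : ContinuousOn (fun y => 2 * inner ℝ (v y) (v' y)) (uIcc r s) :=
      continuousOn_const.mul (ContinuousOn.inner (𝕜 := ℝ) (hvc.mono hsub) (hv'.mono hsub))
    have hFTC := intervalIntegral.integral_eq_sub_of_hasDerivAt hder hcont.intervalIntegrable
    have hbound : |∫ y in r..s, 2 * inner ℝ (v y) (v' y)| ≤ J := by
      rw [← Real.norm_eq_abs]
      have hsub' : uIoc r s ⊆ Ioc 1 2 :=
        Ioc_subset_Ioc (le_min hr.1 hs.1) (max_le hr.2 hs.2)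
      have hpt : ∀ y, ‖2 * inner ℝ (v y) (v' y)‖ ≤ L * ‖v y‖ ^ 2 + L⁻¹ * ‖v' y‖ ^ 2 := by
        intro y
        rw [norm_mul, Real.norm_eq_abs, Real.norm_eq_abs, abs_two]
        have h1 := abs_real_inner_le_norm (v y) (v' y)
        -- The arithmetic-geometric inequality with weight `L`; the choice of `L` later balances the
        -- function against its derivative.
        have h2 : 0 ≤ L⁻¹ * (L * ‖v y‖ - ‖v' y‖) ^ 2 := by positivity
        have h3 : L⁻¹ * (L * ‖v y‖ - ‖v' y‖) ^ 2 =
            L * ‖v y‖ ^ 2 + L⁻¹ * ‖v' y‖ ^ 2 - 2 * (‖v y‖ * ‖v' y‖) := by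
          field_simp
          ring
        linarith
      have hintJ : IntegrableOn (fun y => L * ‖v y‖ ^ 2 + L⁻¹ * ‖v' y‖ ^ 2) (Ioc 1 2) :=
        (intervalIntegrable_iff_integrableOn_Ioc_of_le hle).1
          ((i1.const_mul L).add (i2.const_mul L⁻¹))
      calc _ ≤ ∫ y in uIoc r s, ‖2 * inner ℝ (v y) (v' y)‖ :=
            intervalIntegral.norm_integral_le_integral_norm_uIoc
        _ ≤ ∫ y in uIoc r s, (L * ‖v y‖ ^ 2 + L⁻¹ * ‖v' y‖ ^ 2) := by
            refine integral_mono_of_nonneg (ae_of_all _ fun y => norm_nonneg _)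
              (hintJ.mono_set hsub') (ae_of_all _ hpt)
        _ ≤ ∫ y in Ioc (1 : ℝ) 2, (L * ‖v y‖ ^ 2 + L⁻¹ * ‖v' y‖ ^ 2) :=
            setIntegral_mono_set hintJ (ae_of_all _ fun y => by
              simp only [Pi.zero_apply]; positivity) hsub'.eventuallyLE
        _ = J := by rw [hJ, intervalIntegral.integral_of_le hle]
    have := le_abs_self (∫ y in r..s, 2 * inner ℝ (v y) (v' y))
    linarith
  -- Averaging over `r` in an interval of length one removes the base point.
  have hint : ∫ _ in (1 : ℝ)..2, ‖v s‖ ^ 2 ≤ ∫ r in (1 : ℝ)..2, (‖v r‖ ^ 2 + J) :=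
    intervalIntegral.integral_mono_on hle (by simp) (i1.add (by simp)) hdiff
  rw [intervalIntegral.integral_add i1 (by simp), intervalIntegral.integral_const,
    intervalIntegral.integral_const] at hint
  norm_num at hint
  linarith

lemma ofReal_intervalIntegral_sq {v : ℝ → ℂ} (hv : ContinuousOn v (Icc 1 2)) :
    ENNReal.ofReal (∫ r in (1 : ℝ)..2, ‖v r‖ ^ 2) = ∫⁻ r in Icc (1 : ℝ) 2, ‖v r‖ₑ ^ 2 := by
  rw [intervalIntegral.integral_of_le one_le_two, ← integral_Icc_eq_integral_Ioc,
    ofReal_integral_eq_lintegral_ofReal]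
  · refine lintegral_congr fun x => ?_
    rw [ENNReal.ofReal_pow (norm_nonneg _), ofReal_norm]
  · exact (hv.norm.pow 2).integrableOn_Icc
  · exact ae_of_all _ fun x => by positivity

lemma enorm_sq_le_of_hasDerivAt {v v' : ℝ → ℂ} (hv : ∀ s ∈ Icc (1 : ℝ) 2, HasDerivAt v (v' s) s)
    (hv' : ContinuousOn v' (Icc 1 2)) {L : ℝ} (hL : 0 < L) {s : ℝ} (hs : s ∈ Icc (1 : ℝ) 2) :
    ‖v s‖ₑ ^ 2 ≤ ENNReal.ofReal (1 + L) * (∫⁻ r in Icc (1 : ℝ) 2, ‖v r‖ₑ ^ 2) +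
      ENNReal.ofReal L⁻¹ * ∫⁻ r in Icc (1 : ℝ) 2, ‖v' r‖ₑ ^ 2 := by
  have hvc : ContinuousOn v (Icc 1 2) := fun r hr => (hv r hr).continuousAt.continuousWithinAt
  have hpos : ∀ w : ℝ → ℂ, 0 ≤ ∫ r in (1 : ℝ)..2, ‖w r‖ ^ 2 := fun w =>
    intervalIntegral.integral_nonneg one_le_two fun _ _ => by positivity
  rw [← ofReal_intervalIntegral_sq hvc, ← ofReal_intervalIntegral_sq hv',
    ← ENNReal.ofReal_mul (by positivity), ← ENNReal.ofReal_mul (by positivity),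
    ← ENNReal.ofReal_add (mul_nonneg (by positivity) (hpos _))
      (mul_nonneg (by positivity) (hpos _)), ← ofReal_norm, ← ENNReal.ofReal_pow (norm_nonneg _)]
  exact ENNReal.ofReal_le_ofReal (sq_norm_le_of_hasDerivAt hv hv' hL hs)

/-- The endpoints of the shell have ratio `8 = 2^3`, so any two admissible `k` differ by at most
three, and all of them lie in a window of seven integers. -/
lemma tsum_dyadic_shell_le {a L : ℝ} (hL : 0 < L) (E : ℝ≥0∞) :
    ∑' k : ℤ, (if (2 : ℝ) ^ k * a ∈ Icc (L / 2) (4 * L) then E else 0) ≤ 7 * E := by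
  by_cases hex : ∃ k : ℤ, (2 : ℝ) ^ k * a ∈ Icc (L / 2) (4 * L)
  · obtain ⟨k₀, h1, h2⟩ := hex
    have ha : 0 < a := by
      have : 0 < (2 : ℝ) ^ k₀ * a := by linarith
      exact (mul_pos_iff_of_pos_left (by positivity)).1 this
    have hupper : ∀ i j : ℤ, L / 2 ≤ (2 : ℝ) ^ i * a → (2 : ℝ) ^ j * a ≤ 4 * L → j ≤ i + 3 := by
      intro i j hi hj
      have h3 : (2 : ℝ) ^ j * a ≤ 2 ^ (i + 3) * a := by
        rw [zpow_add₀ (by norm_num)]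
        norm_num
        linarith
      have h4 : (2 : ℝ) ^ j ≤ 2 ^ (i + 3) := le_of_mul_le_mul_right h3 ha
      exact (zpow_le_zpow_iff_right₀ (by norm_num)).1 h4
    rw [tsum_eq_sum (s := Finset.Icc (k₀ - 3) (k₀ + 3))]
    · calc _ ≤ ∑ _k ∈ Finset.Icc (k₀ - 3) (k₀ + 3), E := by
            refine Finset.sum_le_sum fun k _ => ?_
            split_ifs <;> simp
        _ = 7 * E := by
            rw [Finset.sum_const, Int.card_Icc, nsmul_eq_mul]
            congr 1
            have : (k₀ + 3 + 1 - (k₀ - 3)).toNat = 7 := by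
              have : k₀ + 3 + 1 - (k₀ - 3) = 7 := by ring
              rw [this]; rfl
            rw [this]; norm_num
    · intro k hk
      rw [if_neg]
      rintro ⟨h3, h4⟩
      apply hk
      rw [Finset.mem_Icc]
      have := hupper k₀ k h1 h4
      have := hupper k k₀ h3 h2
      omega
  · rw [not_exists] at hex
    simp [hex]

/-- The `L²` bound for the maximal function of a kernel whose Fourier transform is supported in
a dyadic shell, on Schwartz functions. -/
lemma lintegral_iSup_avgOp_schwartz_le (K : 𝓢(𝔼, ℂ)) (hKc : HasCompactSupport (𝓕 K : 𝓢(𝔼, ℂ)))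
    {L : ℝ} (hL : 0 < L) {E : ℝ≥0∞}
    (hE : ∀ η : 𝔼, ENNReal.ofReal (1 + L) * (∫⁻ r in Icc (1 : ℝ) 2, ‖𝓕 K (r • η)‖ₑ ^ 2) +
      ENNReal.ofReal L⁻¹ * (∫⁻ r in Icc (1 : ℝ) 2,
        ‖fderiv ℝ (𝓕 K : 𝓢(𝔼, ℂ)) (r • η) (r • η)‖ₑ ^ 2) ≤
      if ‖η‖ ∈ Icc (L / 2) (4 * L) then E else 0) (f : 𝓢(𝔼, ℂ)) :
    ∫⁻ x, ⨆ (t : ℝ) (_ : 0 < t), ‖avgOp K t f x‖ₑ ^ 2 ≤ 7 * E * ∫⁻ x, ‖f x‖ₑ ^ 2 := by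
  set M : 𝔼 → ℂ := fun ξ => 𝓕 K ξ with hM
  have hMs : ContDiff ℝ (⊤ : ℕ∞) M := (𝓕 K).smooth ⊤
  have hMc : HasCompactSupport M := hKc
  set N : 𝔼 → ℂ := fun η => fderiv ℝ M η η with hN
  have hNs : ContDiff ℝ (⊤ : ℕ∞) N :=
    (hMs.fderiv_right (m := (⊤ : ℕ∞)) (by simp)).clm_apply contDiff_id
  have hNc : HasCompactSupport N := by
    refine (hMc.fderiv ℝ).mono fun η hη => ?_
    rw [Function.mem_support] at hη ⊢
    intro h0
    apply hη
    simp only [hN, h0, zero_apply]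
  obtain ⟨BM, hBM⟩ := hMs.continuous.bounded_above_of_compact_support hMc
  obtain ⟨BN, hBN⟩ := hNs.continuous.bounded_above_of_compact_support hNc
  have hcM := continuous_multInt f hMs.continuous hBM
  have hcN := continuous_multInt f hNs.continuous hBN
  have hrep : ∀ t x, avgOp K t f x = multInt f M t x := fun t x => by
    rw [avgOp_schwartz_eq K K.integrable]
    rfl
  -- Every `t` is `2^k s` with `s` in `[1, 2]`. Replacing the supremum over `k` by a sum is
  -- affordable because, after Plancherel, at most seven `k` contribute at each frequency.
  have hpt : ∀ x, (⨆ (t : ℝ) (_ : 0 < t), ‖avgOp K t f x‖ₑ ^ 2) ≤ ∑' k : ℤ,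
      (ENNReal.ofReal (1 + L) * (∫⁻ r in Icc (1 : ℝ) 2, ‖multInt f M (2 ^ k * r) x‖ₑ ^ 2) +
        ENNReal.ofReal L⁻¹ * ∫⁻ r in Icc (1 : ℝ) 2, ‖multInt f N (2 ^ k * r) x‖ₑ ^ 2) := by
    intro x
    refine iSup₂_le fun t ht => ?_
    obtain ⟨k, hk1, hk2⟩ := exists_mem_Ico_zpow ht one_lt_two
    refine le_trans ?_ (ENNReal.le_tsum k)
    have h2k : (0 : ℝ) < 2 ^ k := by positivity
    set s : ℝ := t / 2 ^ k with hs
    have hs1 : s ∈ Icc (1 : ℝ) 2 := by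
      constructor
      · rw [hs, le_div_iff₀ h2k, one_mul]; exact hk1
      · rw [hs, div_le_iff₀ h2k]
        rw [zpow_add_one₀ (by norm_num), mul_comm] at hk2
        exact hk2.le
    have hts : t = 2 ^ k * s := by rw [hs]; field_simp
    have hder : ∀ r ∈ Icc (1 : ℝ) 2, HasDerivAt (fun r => multInt f M (2 ^ k * r) x)
        ((r⁻¹ : ℝ) * multInt f N (2 ^ k * r) x) r := by
      intro r hr
      have hr0 : (2 : ℝ) ^ k * r ≠ 0 := by
        have : 0 < r := by linarith [hr.1]
        positivity
      have h1 := hasDerivAt_multInt f hMs hMc x hr0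
      have h2 : HasDerivAt (fun r : ℝ => (2 : ℝ) ^ k * r) (2 ^ k) r := by
        simpa using (hasDerivAt_id r).const_mul ((2 : ℝ) ^ k)
      refine (h1.scomp r h2).congr_deriv ?_
      rw [Complex.real_smul]
      have h3 : (r : ℂ) ≠ 0 := by
        have : r ≠ 0 := by rintro rfl; simp at hr0
        exact_mod_cast this
      have h4 : ((2 : ℝ) ^ k : ℝ) ≠ 0 := h2k.ne'
      have h5 : (((2 : ℝ) ^ k : ℝ) : ℂ) ≠ 0 := by exact_mod_cast h4
      simp only [hN]
      push_cast at h5 ⊢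
      field_simp
    have hcont : ContinuousOn (fun r : ℝ => ((r⁻¹ : ℝ) : ℂ) * multInt f N (2 ^ k * r) x)
        (Icc 1 2) := by
      refine ContinuousOn.mul ?_ ?_
      · refine Complex.continuous_ofReal.comp_continuousOn (continuousOn_inv₀.mono fun r hr => ?_)
        have : (0 : ℝ) < r := by linarith [hr.1]
        exact this.ne'
      · exact (hcN.comp (by fun_prop : Continuous fun r : ℝ => ((2 : ℝ) ^ k * r, x))).continuousOn
    have := enorm_sq_le_of_hasDerivAt hder hcont hL hs1
    rw [hrep, hts]
    refine this.trans ?_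
    gcongr _ + _ * ?_
    refine setLIntegral_mono' measurableSet_Icc fun r hr => ?_
    gcongr
    rw [enorm_mul]
    -- The derivative in `r` carries the factor `r⁻¹`, at most one on `[1, 2]`, whatever `k` is.
    refine mul_le_of_le_one_left' ?_
    rw [← ofReal_norm, Complex.norm_real, ENNReal.ofReal_le_one, norm_inv]
    apply inv_le_one_of_one_le₀
    rw [Real.norm_eq_abs]
    exact hr.1.trans (le_abs_self r)
  have hmeas : ∀ (P : 𝔼 → ℂ), (Continuous fun q : ℝ × 𝔼 => multInt f P q.1 q.2) → ∀ k : ℤ,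
      Measurable (Function.uncurry fun (x : 𝔼) (r : ℝ) => ‖multInt f P (2 ^ k * r) x‖ₑ ^ 2) := by
    intro P hP k
    have : Continuous fun q : 𝔼 × ℝ => multInt f P (2 ^ k * q.2) q.1 :=
      hP.comp (by fun_prop : Continuous fun q : 𝔼 × ℝ => ((2 : ℝ) ^ k * q.2, q.1))
    exact this.measurable.enorm.pow_const 2
  have hfm : Measurable fun ξ : 𝔼 => ‖𝓕 f ξ‖ₑ ^ 2 := (𝓕 f).continuous.measurable.enorm.pow_const 2
  have hplanch : ∀ (P : 𝔼 → ℂ), ContDiff ℝ (⊤ : ℕ∞) P → HasCompactSupport P →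
      (Continuous fun q : ℝ × 𝔼 => multInt f P q.1 q.2) → ∀ k : ℤ,
      ∫⁻ x, ∫⁻ r in Icc (1 : ℝ) 2, ‖multInt f P (2 ^ k * r) x‖ₑ ^ 2 =
        ∫⁻ ξ, ‖𝓕 f ξ‖ₑ ^ 2 * ∫⁻ r in Icc (1 : ℝ) 2, ‖P (r • ((2 : ℝ) ^ k • ξ))‖ₑ ^ 2 := by
    intro P hP hPc hPcont k
    have hPm : Continuous fun q : ℝ × 𝔼 => P (q.1 • ((2 : ℝ) ^ k • q.2)) :=
      hP.continuous.comp (by fun_prop)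
    rw [lintegral_lintegral_swap (hmeas P hPcont k).aemeasurable]
    calc _ = ∫⁻ r in Icc (1 : ℝ) 2, ∫⁻ ξ, ‖𝓕 f ξ‖ₑ ^ 2 * ‖P (r • ((2 : ℝ) ^ k • ξ))‖ₑ ^ 2 := by
          refine setLIntegral_congr_fun measurableSet_Icc fun r hr => ?_
          have hr0 : (2 : ℝ) ^ k * r ≠ 0 := by
            have : 0 < r := by linarith [hr.1]
            positivity
          rw [lintegral_enorm_sq_multInt f hP hPc hr0]
          refine lintegral_congr fun ξ => ?_
          rw [smul_smul, mul_comm r]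
      _ = _ := by
          rw [lintegral_lintegral_swap]
          · refine lintegral_congr fun ξ => ?_
            rw [lintegral_const_mul]
            exact (hPm.comp (by fun_prop : Continuous fun r : ℝ => (r, ξ))).measurable.enorm.pow_const 2
          · exact ((hfm.comp measurable_snd).mul (hPm.measurable.enorm.pow_const 2)).aemeasurable
  calc ∫⁻ x, ⨆ (t : ℝ) (_ : 0 < t), ‖avgOp K t f x‖ₑ ^ 2
      ≤ ∫⁻ x, ∑' k : ℤ,
      (ENNReal.ofReal (1 + L) * (∫⁻ r in Icc (1 : ℝ) 2, ‖multInt f M (2 ^ k * r) x‖ₑ ^ 2) +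
        ENNReal.ofReal L⁻¹ * ∫⁻ r in Icc (1 : ℝ) 2, ‖multInt f N (2 ^ k * r) x‖ₑ ^ 2) :=
        lintegral_mono hpt
    _ = ∑' k : ℤ, (ENNReal.ofReal (1 + L) * (∫⁻ ξ, ‖𝓕 f ξ‖ₑ ^ 2 *
          ∫⁻ r in Icc (1 : ℝ) 2, ‖M (r • ((2 : ℝ) ^ k • ξ))‖ₑ ^ 2) +
        ENNReal.ofReal L⁻¹ * ∫⁻ ξ, ‖𝓕 f ξ‖ₑ ^ 2 *
          ∫⁻ r in Icc (1 : ℝ) 2, ‖N (r • ((2 : ℝ) ^ k • ξ))‖ₑ ^ 2) := by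
        have hm1 : ∀ k : ℤ, Measurable fun x =>
            ∫⁻ r in Icc (1 : ℝ) 2, ‖multInt f M (2 ^ k * r) x‖ₑ ^ 2 := fun k =>
          (hmeas M hcM k).lintegral_prod_right
        have hm2 : ∀ k : ℤ, Measurable fun x =>
            ∫⁻ r in Icc (1 : ℝ) 2, ‖multInt f N (2 ^ k * r) x‖ₑ ^ 2 := fun k =>
          (hmeas N hcN k).lintegral_prod_right
        rw [lintegral_tsum]
        swap
        · intro k
          exact (((hm1 k).const_mul _).add ((hm2 k).const_mul _)).aemeasurable
        refine tsum_congr fun k => ?_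
        rw [lintegral_add_left ((hm1 k).const_mul _), lintegral_const_mul _ (hm1 k),
          lintegral_const_mul _ (hm2 k), hplanch M hMs hMc hcM, hplanch N hNs hNc hcN]
    _ = ∫⁻ ξ, ∑' k : ℤ, ‖𝓕 f ξ‖ₑ ^ 2 * (ENNReal.ofReal (1 + L) *
          (∫⁻ r in Icc (1 : ℝ) 2, ‖M (r • ((2 : ℝ) ^ k • ξ))‖ₑ ^ 2) +
        ENNReal.ofReal L⁻¹ * ∫⁻ r in Icc (1 : ℝ) 2, ‖N (r • ((2 : ℝ) ^ k • ξ))‖ₑ ^ 2) := by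
        have hm : ∀ P : 𝔼 → ℂ, Continuous P → ∀ k : ℤ, Measurable fun ξ : 𝔼 =>
            ∫⁻ r in Icc (1 : ℝ) 2, ‖P (r • ((2 : ℝ) ^ k • ξ))‖ₑ ^ 2 := by
          intro P hP k
          refine Measurable.lintegral_prod_right'
            (f := fun q : 𝔼 × ℝ => ‖P (q.2 • ((2 : ℝ) ^ k • q.1))‖ₑ ^ 2) ?_
          exact (hP.comp (by fun_prop)).measurable.enorm.pow_const 2
        have hm1 := hm M hMs.continuous
        have hm2 := hm N hNs.continuous
        rw [lintegral_tsum]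
        swap
        · intro k
          exact (hfm.mul (((hm1 k).const_mul _).add ((hm2 k).const_mul _))).aemeasurable
        refine tsum_congr fun k => ?_
        have hfm1 : Measurable fun ξ : 𝔼 => ‖𝓕 f ξ‖ₑ ^ 2 *
          ∫⁻ r in Icc (1 : ℝ) 2, ‖M (r • ((2 : ℝ) ^ k • ξ))‖ₑ ^ 2 := hfm.mul (hm1 k)
        have hfm2 : Measurable fun ξ : 𝔼 => ‖𝓕 f ξ‖ₑ ^ 2 *
          ∫⁻ r in Icc (1 : ℝ) 2, ‖N (r • ((2 : ℝ) ^ k • ξ))‖ₑ ^ 2 := hfm.mul (hm2 k)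
        rw [← lintegral_const_mul _ hfm1, ← lintegral_const_mul _ hfm2,
          ← lintegral_add_left (hfm1.const_mul _)]
        refine lintegral_congr fun ξ => ?_
        ring
    _ ≤ ∫⁻ ξ, ‖𝓕 f ξ‖ₑ ^ 2 * (7 * E) := by
        refine lintegral_mono fun ξ => ?_
        rw [ENNReal.tsum_mul_left]
        gcongr
        refine le_trans (ENNReal.tsum_le_tsum fun k => hE ((2 : ℝ) ^ k • ξ)) ?_
        have hnorm : ∀ k : ℤ, ‖(2 : ℝ) ^ k • ξ‖ = 2 ^ k * ‖ξ‖ := fun k => by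
          rw [norm_smul, Real.norm_of_nonneg (by positivity)]
        simp only [hnorm]
        exact tsum_dyadic_shell_le hL E
    _ = _ := by
        rw [lintegral_mul_const _ hfm, lintegral_enorm_sq_fourier, mul_comm]

/-! ### Pointwise domination, and extension of the maximal bound to `L²`. -/

lemma avgOp_eq_integral_dilate (K f : 𝔼 → ℂ) {t : ℝ} (ht : 0 < t) (x : 𝔼) :
    avgOp K t f x = ∫ y, (((t ^ n)⁻¹ : ℝ) : ℂ) * K (t⁻¹ • (x - y)) * f y := by
  have h1 : ∫ y, (((t ^ n)⁻¹ : ℝ) : ℂ) * K (t⁻¹ • (x - y)) * f y =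
      ∫ z, (((t ^ n)⁻¹ : ℝ) : ℂ) * K (t⁻¹ • z) * f (x - z) := by
    rw [← integral_sub_left_eq_self (fun z => (((t ^ n)⁻¹ : ℝ) : ℂ) * K (t⁻¹ • z) * f (x - z))
      volume x]
    simp only [sub_sub_cancel]
  have h2 := Measure.integral_comp_smul (volume : Measure 𝔼)
    (fun u : 𝔼 => K u * f (x - t • u)) t⁻¹
  simp only [finrank_euclideanSpace, Fintype.card_fin, smul_smul, mul_inv_cancel₀ ht.ne',
    one_smul] at h2
  rw [h1, avgOp]
  simp only [mul_assoc]
  rw [integral_const_mul, h2, inv_pow, inv_inv, abs_of_pos (by positivity), Complex.real_smul,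
    ← mul_assoc, ← Complex.ofReal_mul, inv_mul_cancel₀ (by positivity), Complex.ofReal_one, one_mul]

lemma enorm_avgOp_le_hlMax {K : 𝔼 → ℂ} {A : ℝ} (hA : 0 ≤ A)
    (hK : ∀ y, ‖K y‖ ≤ A * (1 + ‖y‖) ^ (-((n : ℝ) + 1))) {f : 𝔼 → ℂ} (hf : Measurable f)
    {t : ℝ} (ht : 0 < t) (x : 𝔼) :
    ‖avgOp K t f x‖ₑ ≤
      ENNReal.ofReal A * (2 ^ (n + 2) * volume (ball (0 : 𝔼) 1)) * hlMax (fun y => ‖f y‖ₑ) x := by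
  rw [avgOp_eq_integral_dilate K f ht]
  calc _ ≤ ∫⁻ y, ‖(((t ^ n)⁻¹ : ℝ) : ℂ) * K (t⁻¹ • (x - y)) * f y‖ₑ :=
        enorm_integral_le_lintegral_enorm _
    _ ≤ ∫⁻ y, ENNReal.ofReal A *
          (ENNReal.ofReal ((t ^ n)⁻¹ * (1 + ‖t⁻¹ • (x - y)‖) ^ (-((n : ℝ) + 1))) * ‖f y‖ₑ) := by
        refine lintegral_mono fun y => ?_
        rw [enorm_mul, ← mul_assoc, ← ENNReal.ofReal_mul hA]
        gcongr
        rw [← ofReal_norm, norm_mul, Complex.norm_real, Real.norm_of_nonneg (by positivity)]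
        refine ENNReal.ofReal_le_ofReal ?_
        rw [mul_left_comm]
        gcongr
        exact hK _
    _ ≤ _ := by
        rw [lintegral_const_mul' _ _ ENNReal.ofReal_ne_top, mul_assoc]
        gcongr
        exact lintegral_dilate_le_hlMax _ hf.enorm x ht

/-- Cauchy–Schwarz. The constant depends on `t` and `x`, which is harmless: only continuity in `L²`
of each single average is wanted. -/
lemma exists_lintegral_dilate_mul_le (K : 𝓢(𝔼, ℂ)) {t : ℝ} (ht : 0 < t) (x : 𝔼) :
    ∃ C : ℝ≥0∞, C ≠ ∞ ∧ ∀ h : 𝔼 → ℂ, AEStronglyMeasurable h volume →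
      ∫⁻ y, ‖(((t ^ n)⁻¹ : ℝ) : ℂ) * K (t⁻¹ • (x - y)) * h y‖ₑ ≤ C * eLpNorm h 2 := by
  have hKc := K.continuous
  have hi : Integrable fun y => ‖(((t ^ n)⁻¹ : ℝ) : ℂ) * K (t⁻¹ • (x - y))‖ ^ 2 := by
    have h1 : Integrable fun z => ‖K z‖ ^ 2 :=
      (memLp_two_iff_integrable_sq_norm hKc.aestronglyMeasurable).1 (K.memLp 2)
    have h2 := (h1.comp_smul (inv_ne_zero ht.ne')).comp_sub_left x
    refine (h2.const_mul (((t ^ n)⁻¹) ^ 2)).congr (ae_of_all _ fun y => ?_)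
    simp only []
    rw [norm_mul, Complex.norm_real, Real.norm_of_nonneg (by positivity), mul_pow]
  have hm : MemLp (fun y => (((t ^ n)⁻¹ : ℝ) : ℂ) * K (t⁻¹ • (x - y))) 2 volume := by
    rw [memLp_two_iff_integrable_sq_norm]
    · exact hi
    · exact (by fun_prop : Continuous fun y => (((t ^ n)⁻¹ : ℝ) : ℂ) *
        K (t⁻¹ • (x - y))).aestronglyMeasurable
  refine ⟨eLpNorm (fun y => (((t ^ n)⁻¹ : ℝ) : ℂ) * K (t⁻¹ • (x - y))) 2 volume,
    hm.eLpNorm_ne_top, fun h hh => ?_⟩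
  have := eLpNorm_smul_le_mul_eLpNorm (p := 2) (q := 2) (r := 1) hh hm.aestronglyMeasurable
  rw [eLpNorm_one_eq_lintegral_enorm] at this
  exact this

lemma tendsto_avgOp_of_tendsto_eLpNorm (K : 𝓢(𝔼, ℂ)) {t : ℝ} (ht : 0 < t) (x : 𝔼) {f : 𝔼 → ℂ}
    (hf : MemLp f 2) {g : ℕ → 𝔼 → ℂ} (hg : ∀ k, MemLp (g k) 2)
    (hlim : Tendsto (fun k => eLpNorm (g k - f) 2) atTop (𝓝 0)) :
    Tendsto (fun k => avgOp K t (g k) x) atTop (𝓝 (avgOp K t f x)) := by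
  obtain ⟨C, hC, hbound⟩ := exists_lintegral_dilate_mul_le K ht x
  have hKc : Continuous fun y => (((t ^ n)⁻¹ : ℝ) : ℂ) * K (t⁻¹ • (x - y)) := by
    have hKc := K.continuous
    fun_prop
  have hint : ∀ h : 𝔼 → ℂ, MemLp h 2 → Integrable fun y =>
      (((t ^ n)⁻¹ : ℝ) : ℂ) * K (t⁻¹ • (x - y)) * h y := fun h hh =>
    ⟨hKc.aestronglyMeasurable.mul hh.aestronglyMeasurable, (hbound h hh.aestronglyMeasurable).trans_lt
      (ENNReal.mul_lt_top hC.lt_top hh.eLpNorm_lt_top)⟩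
  rw [tendsto_iff_edist_tendsto_0]
  have h0 : Tendsto (fun k => C * eLpNorm (g k - f) 2) atTop (𝓝 0) := by
    have := ENNReal.Tendsto.const_mul hlim (Or.inr hC) (a := C)
    rwa [mul_zero] at this
  refine tendsto_of_tendsto_of_tendsto_of_le_of_le tendsto_const_nhds h0 (fun _ => zero_le)
    fun k => ?_
  rw [edist_eq_enorm_sub, avgOp_eq_integral_dilate _ _ ht, avgOp_eq_integral_dilate _ _ ht,
    ← integral_sub (hint _ (hg k)) (hint _ hf)]
  refine (enorm_integral_le_lintegral_enorm _).trans (le_trans (le_of_eq ?_)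
    (hbound _ ((hg k).sub hf).aestronglyMeasurable))
  refine lintegral_congr fun y => ?_
  rw [Pi.sub_apply, mul_sub]

lemma continuous_avgOp_schwartz (K f : 𝓢(𝔼, ℂ)) (t : ℝ) : Continuous (avgOp K t f) := by
  have hf := f.continuous
  have hK := K.continuous
  unfold avgOp
  refine continuous_of_dominated (bound := fun y => ‖K y‖ * SchwartzMap.seminorm ℝ 0 0 f)
    (fun x => (by fun_prop : Continuous fun y => K y * f (x - t • y)).aestronglyMeasurable)
    (fun x => ae_of_all _ fun y => ?_) (K.integrable.norm.mul_const _)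
    (ae_of_all _ fun y => by fun_prop)
  rw [norm_mul]
  gcongr
  exact SchwartzMap.norm_le_seminorm ℝ f _

lemma lintegral_enorm_sq_eq_eLpNorm (u : 𝔼 → ℂ) : ∫⁻ x, ‖u x‖ₑ ^ 2 = eLpNorm u 2 ^ 2 := by
  rw [eLpNorm_eq_lintegral_rpow_enorm_toReal (by norm_num) (by norm_num)]
  simp only [ENNReal.toReal_ofNat, ENNReal.rpow_ofNat]
  rw [← ENNReal.rpow_natCast, ← ENNReal.rpow_mul]
  norm_num

lemma tendsto_of_sub_le_of_le_add {a : ℝ≥0∞} (ha : a ≠ ∞) {b c : ℕ → ℝ≥0∞}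
    (hc : Tendsto c atTop (𝓝 0)) (hlow : ∀ k, a - c k ≤ b k) (hup : ∀ k, b k ≤ a + c k) :
    Tendsto b atTop (𝓝 a) := by
  refine tendsto_of_tendsto_of_tendsto_of_le_of_le ?_ ?_ hlow hup
  · have h := ENNReal.Tendsto.sub (tendsto_const_nhds (x := a)) hc (Or.inl ha)
    rwa [tsub_zero] at h
  · have h := (tendsto_const_nhds (x := a)).add hc
    rwa [add_zero] at h

lemma tendsto_eLpNorm_of_tendsto_eLpNorm_sub {f : 𝔼 → ℂ} (hf : MemLp f 2) {g : ℕ → 𝔼 → ℂ}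
    (hg : ∀ k, MemLp (g k) 2) (hlim : Tendsto (fun k => eLpNorm (g k - f) 2) atTop (𝓝 0)) :
    Tendsto (fun k => eLpNorm (g k) 2) atTop (𝓝 (eLpNorm f 2)) := by
  have hup : ∀ k, eLpNorm (g k) 2 ≤ eLpNorm f 2 + eLpNorm (g k - f) 2 := fun k => by
    have h := eLpNorm_add_le (μ := volume) (p := 2) hf.aestronglyMeasurable
      ((hg k).sub hf).aestronglyMeasurable (by norm_num)
    rwa [add_sub_cancel] at h
  have hlow : ∀ k, eLpNorm f 2 - eLpNorm (g k - f) 2 ≤ eLpNorm (g k) 2 := fun k => by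
    rw [tsub_le_iff_right]
    have h := eLpNorm_sub_le (μ := volume) (p := 2) (hg k).aestronglyMeasurable
      ((hg k).sub hf).aestronglyMeasurable (by norm_num)
    rwa [sub_sub_cancel] at h
  exact tendsto_of_sub_le_of_le_add hf.eLpNorm_ne_top hlim hlow hup

/-- The `L²` bound for the maximal function extends from Schwartz functions to `L²`. -/
lemma lintegral_iSup_avgOp_le_of_schwartz (K : 𝓢(𝔼, ℂ)) {D : ℝ≥0∞} (hD : D ≠ ∞)
    (h : ∀ f : 𝓢(𝔼, ℂ), ∫⁻ x, ⨆ (t : ℝ) (_ : 0 < t), ‖avgOp K t f x‖ₑ ^ 2 ≤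
      D * ∫⁻ x, ‖f x‖ₑ ^ 2) {f : 𝔼 → ℂ} (hf : MemLp f 2) :
    ∫⁻ x, ⨆ (t : ℝ) (_ : 0 < t), ‖avgOp K t f x‖ₑ ^ 2 ≤ D * ∫⁻ x, ‖f x‖ₑ ^ 2 := by
  have hex : ∀ k : ℕ, ∃ g : 𝓢(𝔼, ℂ), eLpNorm (⇑g - f) 2 ≤ ENNReal.ofReal (1 / ((k : ℝ) + 1)) := by
    intro k
    obtain ⟨g, hg₁, hg₂, hg₃⟩ := MemLp.exist_eLpNorm_sub_le ENNReal.ofNat_ne_top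
      (by norm_num : (1 : ℝ≥0∞) ≤ 2) hf (by positivity : (0 : ℝ) < 1 / ((k : ℝ) + 1))
    exact ⟨hg₁.toSchwartzMap hg₂, by rw [eLpNorm_sub_comm]; exact hg₃⟩
  choose g hg using hex
  have hlim : Tendsto (fun k => eLpNorm (⇑(g k) - f) 2) atTop (𝓝 0) := by
    refine tendsto_of_tendsto_of_tendsto_of_le_of_le tendsto_const_nhds ?_ (fun _ => zero_le) hg
    have := ENNReal.tendsto_ofReal (tendsto_one_div_add_atTop_nhds_zero_nat (𝕜 := ℝ))
    simpa using this
  -- For fixed `t` and `x` the averages converge, so the supremum is lower semicontinuous along the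
  -- approximation, and Fatou's lemma applies.
  have hptlim : ∀ x, (⨆ (t : ℝ) (_ : 0 < t), ‖avgOp K t f x‖ₑ ^ 2) ≤
      liminf (fun k => ⨆ (t : ℝ) (_ : 0 < t), ‖avgOp K t (g k) x‖ₑ ^ 2) atTop := by
    intro x
    refine iSup₂_le fun t ht => ?_
    have h1 := tendsto_avgOp_of_tendsto_eLpNorm K ht x hf (fun k => (g k).memLp 2) hlim
    have h2 : Tendsto (fun k => ‖avgOp K t (g k) x‖ₑ ^ 2) atTop (𝓝 (‖avgOp K t f x‖ₑ ^ 2)) :=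
      (ENNReal.continuous_pow 2).continuousAt.tendsto.comp h1.enorm
    rw [← h2.liminf_eq]
    refine liminf_le_liminf (Eventually.of_forall fun k => ?_)
    exact le_iSup₂ (f := fun (t : ℝ) (_ : 0 < t) => ‖avgOp K t (g k) x‖ₑ ^ 2) t ht
  have hmeas : ∀ k, Measurable fun x => ⨆ (t : ℝ) (_ : 0 < t), ‖avgOp K t (g k) x‖ₑ ^ 2 := by
    intro k
    refine (lowerSemicontinuous_iSup fun t => lowerSemicontinuous_iSup fun _ => ?_).measurable
    exact ((ENNReal.continuous_pow 2).comp
      (continuous_avgOp_schwartz K (g k) t).enorm).lowerSemicontinuous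
  have hnorm : Tendsto (fun k => D * ∫⁻ x, ‖g k x‖ₑ ^ 2) atTop (𝓝 (D * ∫⁻ x, ‖f x‖ₑ ^ 2)) := by
    refine ENNReal.Tendsto.const_mul ?_ (Or.inr hD)
    simp only [lintegral_enorm_sq_eq_eLpNorm]
    exact (ENNReal.continuous_pow 2).continuousAt.tendsto.comp
      (tendsto_eLpNorm_of_tendsto_eLpNorm_sub hf (fun k => (g k).memLp 2) hlim)
  calc ∫⁻ x, ⨆ (t : ℝ) (_ : 0 < t), ‖avgOp K t f x‖ₑ ^ 2
      ≤ ∫⁻ x, liminf (fun k => ⨆ (t : ℝ) (_ : 0 < t), ‖avgOp K t (g k) x‖ₑ ^ 2) atTop :=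
        lintegral_mono hptlim
    _ ≤ liminf (fun k => ∫⁻ x, ⨆ (t : ℝ) (_ : 0 < t), ‖avgOp K t (g k) x‖ₑ ^ 2) atTop :=
        lintegral_liminf_le hmeas
    _ ≤ liminf (fun k => D * ∫⁻ x, ‖g k x‖ₑ ^ 2) atTop :=
        liminf_le_liminf (Eventually.of_forall fun k => h (g k))
    _ = _ := hnorm.liminf_eq

/-! ### The dyadic pieces -/

/-- The dyadic piece of the measure at frequency `s⁻¹`. -/
noncomputable def dyadicPiece {σ : Measure 𝔼} [IsFiniteMeasure σ] (hσ : CompactlySupported σ)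
    {s : ℝ} (hs : 0 < s) : 𝓢(𝔼, ℂ) :=
  smoothedSchwartz hσ (half_pos hs) - smoothedSchwartz hσ hs

/-- The Fourier transform of `dyadicPiece`. -/
noncomputable def dyadicMult (σ : Measure 𝔼) (s : ℝ) (ξ : 𝔼) : ℂ :=
  measureFourier σ ξ * (cutoff (s / 2) ξ - cutoff s ξ)

lemma fourier_dyadicPiece {σ : Measure 𝔼} [IsFiniteMeasure σ] (hσ : CompactlySupported σ)
    {s : ℝ} (hs : 0 < s) : ⇑(𝓕 (dyadicPiece hσ hs) : 𝓢(𝔼, ℂ)) = dyadicMult σ s := by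
  ext ξ
  rw [dyadicPiece, ← FourierTransform.fourierCLM_apply (R := ℂ), map_sub,
    FourierTransform.fourierCLM_apply, FourierTransform.fourierCLM_apply, sub_apply, fourier_smoothedSchwartz,
    fourier_smoothedSchwartz, dyadicMult, mul_sub]

lemma norm_cutoff_sub_le_one (s s' : ℝ) (ξ : 𝔼) : ‖cutoff s ξ - cutoff s' ξ‖ ≤ 1 := by
  rw [cutoff, cutoff, ← Complex.ofReal_sub, Complex.norm_real, Real.norm_eq_abs, abs_le]
  have h1 := freqBump.nonneg (x := s • ξ)
  have h2 := freqBump.le_one (x := s • ξ)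
  have h3 := freqBump.nonneg (x := s' • ξ)
  have h4 := freqBump.le_one (x := s' • ξ)
  constructor <;> linarith

lemma dyadicMult_eq_zero (σ : Measure 𝔼) {s : ℝ} (hs : 0 < s) {ξ : 𝔼}
    (h : ‖ξ‖ ≤ s⁻¹ ∨ 4 * s⁻¹ ≤ ‖ξ‖) : dyadicMult σ s ξ = 0 := by
  rw [dyadicMult]
  rcases h with h | h
  · have h1 : s * ‖ξ‖ ≤ 1 := by
      calc s * ‖ξ‖ ≤ s * s⁻¹ := by gcongr
        _ = 1 := mul_inv_cancel₀ hs.ne'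
    rw [cutoff_eq_one, cutoff_eq_one, sub_self, mul_zero]
    · rw [norm_smul, Real.norm_of_nonneg hs.le]; exact h1
    · rw [norm_smul, Real.norm_of_nonneg (by positivity)]
      have := norm_nonneg ξ
      nlinarith
  · have h1 : 4 ≤ s * ‖ξ‖ := by
      calc (4 : ℝ) = s * (4 * s⁻¹) := by field_simp
        _ ≤ s * ‖ξ‖ := by gcongr
    rw [cutoff_eq_zero, cutoff_eq_zero, sub_self, mul_zero]
    · rw [norm_smul, Real.norm_of_nonneg hs.le]; linarith
    · rw [norm_smul, Real.norm_of_nonneg (by positivity)]; linarith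

lemma fderiv_dyadicMult_eq_zero (σ : Measure 𝔼) {s : ℝ} (hs : 0 < s) {ξ : 𝔼}
    (h : ‖ξ‖ < s⁻¹ ∨ 4 * s⁻¹ < ‖ξ‖) : fderiv ℝ (dyadicMult σ s) ξ = 0 := by
  have : dyadicMult σ s =ᶠ[𝓝 ξ] fun _ => 0 := by
    rcases h with h | h
    · filter_upwards [(continuous_norm.tendsto ξ).eventually (gt_mem_nhds h)] with η hη
      exact dyadicMult_eq_zero σ hs (Or.inl (le_of_lt hη))
    · filter_upwards [(continuous_norm.tendsto ξ).eventually (lt_mem_nhds h)] with η hη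
      exact dyadicMult_eq_zero σ hs (Or.inr (le_of_lt hη))
  rw [this.fderiv_eq, fderiv_fun_const, Pi.zero_apply]

/-- The radial derivative `ξ · ∇` commutes with dilations, so the bound at scale one holds at all
scales. -/
lemma exists_norm_fderiv_cutoff_le : ∃ C : ℝ, 0 ≤ C ∧ ∀ (s : ℝ) (ξ : 𝔼),
    ‖fderiv ℝ (cutoff s) ξ ξ‖ ≤ C := by
  have hc : Continuous fun ξ : 𝔼 => fderiv ℝ (cutoff 1) ξ ξ :=
    ((contDiff_cutoff 1).continuous_fderiv (by simp)).clm_apply continuous_id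
  have hs : HasCompactSupport fun ξ : 𝔼 => fderiv ℝ (cutoff 1) ξ ξ := by
    refine ((hasCompactSupport_cutoff (n := n) one_pos).fderiv ℝ).mono fun η hη => ?_
    rw [Function.mem_support] at hη ⊢
    intro h0
    apply hη
    simp only [h0, zero_apply]
  obtain ⟨C, hC⟩ := hc.bounded_above_of_compact_support hs
  refine ⟨C, (norm_nonneg _).trans (hC 0), fun s ξ => ?_⟩
  have h1 : cutoff (n := n) s = fun ξ => cutoff 1 (s • ξ) := by
    ext ξ; simp [cutoff]
  have h2 : fderiv ℝ (cutoff s) ξ ξ = fderiv ℝ (cutoff 1) (s • ξ) (s • ξ) := by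
    rw [h1, fderiv_comp_smul, smul_apply, map_smul]
  rw [h2]
  exact hC _

/-- Cauchy–Schwarz in coordinates. The Sobolev argument produces only the radial derivative, while
the hypothesis concerns the full gradient. -/
lemma norm_fderiv_apply_self_sq_le (m : 𝔼 → ℂ) (ξ : 𝔼) :
    ‖fderiv ℝ m ξ ξ‖ ^ 2 ≤ gradNormSq m ξ * ‖ξ‖ ^ 2 := by
  have h1 : fderiv ℝ m ξ ξ = ∑ j, (ξ j : ℝ) • fderiv ℝ m ξ (EuclideanSpace.single j 1) := by
    have : ξ = ∑ j, (ξ j) • (EuclideanSpace.single j (1 : ℝ) : 𝔼) := by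
      have := (EuclideanSpace.basisFun (Fin n) ℝ).sum_repr ξ
      simpa using this.symm
    conv_lhs => rw [this]
    rw [map_sum]
    simp only [map_smul]
    congr 1
    ext j
    congr 3
    exact this.symm
  have h2 : ‖fderiv ℝ m ξ ξ‖ ≤ ∑ j, ‖fderiv ℝ m ξ (EuclideanSpace.single j 1)‖ * ‖ξ j‖ := by
    rw [h1]
    refine (norm_sum_le _ _).trans (le_of_eq ?_)
    refine Finset.sum_congr rfl fun j _ => ?_
    rw [norm_smul, mul_comm]
  calc ‖fderiv ℝ m ξ ξ‖ ^ 2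
      ≤ (∑ j, ‖fderiv ℝ m ξ (EuclideanSpace.single j 1)‖ * ‖ξ j‖) ^ 2 := by gcongr
    _ ≤ (∑ j, ‖fderiv ℝ m ξ (EuclideanSpace.single j 1)‖ ^ 2) * ∑ j, ‖ξ j‖ ^ 2 :=
        Finset.sum_mul_sq_le_sq_mul_sq _ _ _
    _ = _ := by rw [gradNormSq, EuclideanSpace.norm_sq_eq]

lemma gradNormSq_nonneg (m : 𝔼 → ℂ) (ξ : 𝔼) : 0 ≤ gradNormSq m ξ :=
  Finset.sum_nonneg fun _ _ => by positivity

/-- Product rule and `(a + b)² ≤ 2a² + 2b²`. The two cutoffs contribute `2C` to the derivative,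
hence the coefficient `8C²`. -/
lemma norm_fderiv_dyadicMult_sq_le {σ : Measure 𝔼} [IsFiniteMeasure σ] (hσ : CompactlySupported σ)
    {C : ℝ} (hC : ∀ (s : ℝ) (ξ : 𝔼), ‖fderiv ℝ (cutoff s) ξ ξ‖ ≤ C) (s : ℝ) (ξ : 𝔼) :
    ‖fderiv ℝ (dyadicMult σ s) ξ ξ‖ ^ 2 ≤ 8 * C ^ 2 * ‖measureFourier σ ξ‖ ^ 2 +
      2 * (gradNormSq (measureFourier σ) ξ * ‖ξ‖ ^ 2) := by
  have hm : DifferentiableAt ℝ (measureFourier σ) ξ :=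
    ((contDiff_measureFourier hσ).differentiable (by simp)) ξ
  have hc : ∀ s : ℝ, DifferentiableAt ℝ (cutoff (n := n) s) ξ := fun s =>
    ((contDiff_cutoff s).differentiable (by simp)) ξ
  have h1 : fderiv ℝ (dyadicMult σ s) ξ ξ =
      measureFourier σ ξ * (fderiv ℝ (cutoff (s / 2)) ξ ξ - fderiv ℝ (cutoff s) ξ ξ) +
        (cutoff (s / 2) ξ - cutoff s ξ) * fderiv ℝ (measureFourier σ) ξ ξ := by
    have h := (hm.hasFDerivAt.mul ((hc (s / 2)).hasFDerivAt.sub (hc s).hasFDerivAt)).fderiv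
    have h' : fderiv ℝ (dyadicMult σ s) ξ = _ := h
    rw [h']
    simp
  have h2 : ‖fderiv ℝ (dyadicMult σ s) ξ ξ‖ ≤
      ‖measureFourier σ ξ‖ * (2 * C) + ‖fderiv ℝ (measureFourier σ) ξ ξ‖ := by
    rw [h1]
    refine (norm_add_le _ _).trans ?_
    rw [norm_mul, norm_mul]
    gcongr
    · refine (norm_sub_le _ _).trans ?_
      linarith [hC (s / 2) ξ, hC s ξ]
    · exact mul_le_of_le_one_left (norm_nonneg _) (norm_cutoff_sub_le_one _ _ _)
  have h3 := norm_fderiv_apply_self_sq_le (measureFourier σ) ξ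
  calc _ ≤ (‖measureFourier σ ξ‖ * (2 * C) + ‖fderiv ℝ (measureFourier σ) ξ ξ‖) ^ 2 := by gcongr
    _ ≤ 2 * (‖measureFourier σ ξ‖ * (2 * C)) ^ 2 + 2 * ‖fderiv ℝ (measureFourier σ) ξ ξ‖ ^ 2 := by
        nlinarith [sq_nonneg (‖measureFourier σ ξ‖ * (2 * C) - ‖fderiv ℝ (measureFourier σ) ξ ξ‖)]
    _ ≤ _ := by nlinarith

lemma integral_le_of_sqrt_le {a C b α : ℝ} (hb : 0 < b) (h : Real.sqrt a ≤ C * b ^ (-α)) :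
    a ≤ C ^ 2 * b ^ (-(2 * α)) := by
  have h1 := (Real.sqrt_le_iff.1 h).2
  refine h1.trans (le_of_eq ?_)
  rw [mul_pow, ← Real.rpow_natCast (b ^ (-α)) 2, ← Real.rpow_mul hb.le]
  congr 2
  push_cast
  ring

/-- The square function bounds for the dyadic pieces of the multiplier. -/
lemma exists_dyadicMult_bound {σ : Measure 𝔼} [IsFiniteMeasure σ] (hσ : CompactlySupported σ)
    {α : ℝ} (hα : 1 / 2 < α) (hdecay : ∃ C : ℝ, ∀ ξ : 𝔼,
      Real.sqrt (∫ t in (1 : ℝ)..2, ‖measureFourier σ (t • ξ)‖ ^ 2) ≤ C * (1 + ‖ξ‖) ^ (-α))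
    (hgrad : ∃ C : ℝ, ∀ ξ : 𝔼,
      Real.sqrt (∫ t in (1 : ℝ)..2, gradNormSq (measureFourier σ) (t • ξ)) ≤
        C * (1 + ‖ξ‖) ^ (-α)) :
    ∃ C : ℝ, 0 < C ∧ ∀ s : ℝ, 0 < s → s ≤ 1 → ∀ η : 𝔼,
      ENNReal.ofReal (1 + s⁻¹) * (∫⁻ r in Icc (1 : ℝ) 2, ‖dyadicMult σ s (r • η)‖ₑ ^ 2) +
      ENNReal.ofReal s⁻¹⁻¹ * (∫⁻ r in Icc (1 : ℝ) 2,
        ‖fderiv ℝ (dyadicMult σ s) (r • η) (r • η)‖ₑ ^ 2) ≤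
      if ‖η‖ ∈ Icc (s⁻¹ / 2) (4 * s⁻¹) then ENNReal.ofReal (C * s ^ (2 * α - 1)) else 0 := by
  obtain ⟨C₁, h₁⟩ := hdecay
  obtain ⟨C₂, h₂⟩ := hgrad
  obtain ⟨Cb, hCb0, hCb⟩ := exists_norm_fderiv_cutoff_le (n := n)
  set m := measureFourier σ with hm
  have hms := contDiff_measureFourier hσ
  have hmc : Continuous m := hms.continuous
  have hdm : Continuous (fderiv ℝ m) := hms.continuous_fderiv (by simp)
  have hgc : Continuous (gradNormSq m) := by
    unfold gradNormSq
    refine continuous_finsetSum _ fun j _ => ?_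
    exact ((hdm.clm_apply continuous_const).norm.pow 2)
  -- The Sobolev weight `L = 1/s` is the balanced choice: on the shell the multiplier has square
  -- mean of order `s^(2α)` and its radial derivative of order `s^(2α-2)`, so both terms become
  -- `s^(2α-1)`. The final `1` only makes the constant positive.
  refine ⟨(2 * C₁ ^ 2 + (8 * Cb ^ 2 * C₁ ^ 2 + 128 * C₂ ^ 2)) * 2 ^ (2 * α) + 1, by positivity,
    fun s hs hs1 η => ?_⟩
  have hsi : 0 < s⁻¹ := by positivity
  have hDs : ContDiff ℝ (⊤ : ℕ∞) (dyadicMult σ s) :=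
    hms.mul ((contDiff_cutoff _).sub (contDiff_cutoff _))
  have hD1 : Continuous fun r : ℝ => dyadicMult σ s (r • η) :=
    hDs.continuous.comp (by fun_prop)
  have hD2 : Continuous fun r : ℝ => fderiv ℝ (dyadicMult σ s) (r • η) (r • η) :=
    ((hDs.continuous_fderiv (by simp)).comp
      (by fun_prop : Continuous fun r : ℝ => r • η)).clm_apply (by fun_prop)
  have hnorm : ∀ r ∈ Icc (1 : ℝ) 2, ‖r • η‖ = r * ‖η‖ := fun r hr => by
    rw [norm_smul, Real.norm_of_nonneg (by linarith [hr.1])]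
  by_cases hη : ‖η‖ ∈ Icc (s⁻¹ / 2) (4 * s⁻¹)
  · rw [if_pos hη]
    have hmr : Continuous fun r : ℝ => ‖m (r • η)‖ ^ 2 :=
      ((hmc.comp (by fun_prop : Continuous fun r : ℝ => r • η)).norm.pow 2)
    have hgr : Continuous fun r : ℝ => gradNormSq m (r • η) :=
      hgc.comp (by fun_prop : Continuous fun r : ℝ => r • η)
    have hw : (1 + ‖η‖) ^ (-(2 * α)) ≤ 2 ^ (2 * α) * s ^ (2 * α) := by
      rw [← Real.mul_rpow zero_le_two hs.le]
      calc (1 + ‖η‖) ^ (-(2 * α)) ≤ (s⁻¹ / 2) ^ (-(2 * α)) :=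
            Real.rpow_le_rpow_of_nonpos (by positivity) (by linarith [hη.1]) (by linarith)
        _ = _ := by
            rw [Real.rpow_neg (by positivity), ← Real.inv_rpow (by positivity)]
            congr 1
            field_simp
    have hI1 : ∫ r in (1 : ℝ)..2, ‖m (r • η)‖ ^ 2 ≤ C₁ ^ 2 * (2 ^ (2 * α) * s ^ (2 * α)) :=
      (integral_le_of_sqrt_le (by positivity) (h₁ η)).trans (by gcongr)
    have hI2 : ∫ r in (1 : ℝ)..2, gradNormSq m (r • η) ≤
        C₂ ^ 2 * (2 ^ (2 * α) * s ^ (2 * α)) :=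
      (integral_le_of_sqrt_le (by positivity) (h₂ η)).trans (by gcongr)
    have e1 : ∫ r in (1 : ℝ)..2, ‖dyadicMult σ s (r • η)‖ ^ 2 ≤
        ∫ r in (1 : ℝ)..2, ‖m (r • η)‖ ^ 2 := by
      refine intervalIntegral.integral_mono_on one_le_two
        ((hD1.norm.pow 2).intervalIntegrable _ _) (hmr.intervalIntegrable _ _) fun r _ => ?_
      rw [dyadicMult, norm_mul]
      gcongr
      exact mul_le_of_le_one_right (norm_nonneg _) (norm_cutoff_sub_le_one _ _ _)
    have e2 : ∫ r in (1 : ℝ)..2, ‖fderiv ℝ (dyadicMult σ s) (r • η) (r • η)‖ ^ 2 ≤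
        8 * Cb ^ 2 * (∫ r in (1 : ℝ)..2, ‖m (r • η)‖ ^ 2) +
          128 * s⁻¹ ^ 2 * ∫ r in (1 : ℝ)..2, gradNormSq m (r • η) := by
      rw [← intervalIntegral.integral_const_mul, ← intervalIntegral.integral_const_mul,
        ← intervalIntegral.integral_add ((hmr.const_mul _).intervalIntegrable _ _)
          ((hgr.const_mul _).intervalIntegrable _ _)]
      refine intervalIntegral.integral_mono_on one_le_two
        ((hD2.norm.pow 2).intervalIntegrable _ _)
        (((hmr.const_mul _).add (hgr.const_mul _)).intervalIntegrable _ _) fun r hr => ?_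
      -- From `r ≤ 2` and `‖η‖ ≤ 4/s`; squared and doubled, this is the constant `128`.
      have h8 : ‖r • η‖ ≤ 8 * s⁻¹ := by
        rw [hnorm r hr]
        have := hη.2
        have := norm_nonneg η
        nlinarith [hr.2, hr.1]
      refine (norm_fderiv_dyadicMult_sq_le hσ hCb s (r • η)).trans ?_
      have := gradNormSq_nonneg m (r • η)
      have h64 : ‖r • η‖ ^ 2 ≤ (8 * s⁻¹) ^ 2 := by gcongr
      have := mul_le_mul_of_nonneg_left h64 this
      rw [← hm]
      nlinarith
    have hs2 : s ^ (2 * α - 1) = s⁻¹ * s ^ (2 * α) := by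
      rw [Real.rpow_sub hs, Real.rpow_one]; field_simp
    rw [← ofReal_intervalIntegral_sq hD1.continuousOn, ← ofReal_intervalIntegral_sq
      hD2.continuousOn, ← ENNReal.ofReal_mul (by positivity), ← ENNReal.ofReal_mul (by positivity),
      ← ENNReal.ofReal_add (mul_nonneg (by positivity) (intervalIntegral.integral_nonneg one_le_two
        fun r _ => by positivity)) (mul_nonneg (by positivity)
        (intervalIntegral.integral_nonneg one_le_two fun r _ => by positivity))]
    refine ENNReal.ofReal_le_ofReal ?_
    set T : ℝ := 2 ^ (2 * α) * s ^ (2 * α) with hT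
    have hT0 : 0 ≤ T := by positivity
    have hsle : 1 ≤ s⁻¹ := (one_le_inv₀ hs).2 hs1
    have k1 : (1 + s⁻¹) * (∫ r in (1 : ℝ)..2, ‖dyadicMult σ s (r • η)‖ ^ 2) ≤
        (2 * s⁻¹) * (C₁ ^ 2 * T) := by
      refine mul_le_mul (by linarith) (e1.trans hI1) (intervalIntegral.integral_nonneg one_le_two
        fun r _ => by positivity) (by positivity)
    have k2 : s⁻¹⁻¹ * (∫ r in (1 : ℝ)..2, ‖fderiv ℝ (dyadicMult σ s) (r • η) (r • η)‖ ^ 2) ≤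
        s * (8 * Cb ^ 2 * (C₁ ^ 2 * T) + 128 * s⁻¹ ^ 2 * (C₂ ^ 2 * T)) := by
      rw [inv_inv]
      refine mul_le_mul_of_nonneg_left (e2.trans ?_) hs.le
      gcongr
    have k3 : s * (8 * Cb ^ 2 * (C₁ ^ 2 * T) + 128 * s⁻¹ ^ 2 * (C₂ ^ 2 * T)) ≤
        s⁻¹ * ((8 * Cb ^ 2 * C₁ ^ 2 + 128 * C₂ ^ 2) * T) := by
      have : s * (128 * s⁻¹ ^ 2 * (C₂ ^ 2 * T)) = s⁻¹ * (128 * C₂ ^ 2 * T) := by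
        field_simp
      have h2 : s * (8 * Cb ^ 2 * (C₁ ^ 2 * T)) ≤ s⁻¹ * (8 * Cb ^ 2 * (C₁ ^ 2 * T)) := by
        gcongr
        linarith
      linarith
    have k4 : 0 ≤ s⁻¹ * s ^ (2 * α) := by positivity
    rw [hs2]
    calc _ ≤ (2 * s⁻¹) * (C₁ ^ 2 * T) + s⁻¹ * ((8 * Cb ^ 2 * C₁ ^ 2 + 128 * C₂ ^ 2) * T) :=
          add_le_add k1 (k2.trans k3)
      _ = ((2 * C₁ ^ 2 + (8 * Cb ^ 2 * C₁ ^ 2 + 128 * C₂ ^ 2)) * 2 ^ (2 * α)) *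
            (s⁻¹ * s ^ (2 * α)) := by rw [hT]; ring
      _ ≤ _ := by gcongr; linarith
  · rw [if_neg hη]
    -- The multiplier lives on `[s⁻¹, 4s⁻¹]` and `r` ranges over `[1, 2]`, so the shell for `‖η‖` is
    -- enlarged by a factor two at its lower end only.
    have hz : ∀ r ∈ Icc (1 : ℝ) 2, ‖r • η‖ < s⁻¹ ∨ 4 * s⁻¹ < ‖r • η‖ := by
      intro r hr
      rw [hnorm r hr]
      have hη0 := norm_nonneg η
      by_cases h : s⁻¹ / 2 ≤ ‖η‖
      · right
        have : 4 * s⁻¹ < ‖η‖ := by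
          by_contra hcon
          exact hη ⟨h, not_lt.1 hcon⟩
        nlinarith [hr.1]
      · left
        rw [not_le] at h
        nlinarith [hr.2]
    have z1 : ∫⁻ r in Icc (1 : ℝ) 2, ‖dyadicMult σ s (r • η)‖ₑ ^ 2 = 0 := by
      rw [setLIntegral_congr_fun measurableSet_Icc (g := fun _ => 0) fun r hr => ?_,
        lintegral_zero]
      simp only []
      rw [dyadicMult_eq_zero σ hs ((hz r hr).imp le_of_lt le_of_lt)]
      simp
    have z2 : ∫⁻ r in Icc (1 : ℝ) 2, ‖fderiv ℝ (dyadicMult σ s) (r • η) (r • η)‖ₑ ^ 2 = 0 := by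
      rw [setLIntegral_congr_fun measurableSet_Icc (g := fun _ => 0) fun r hr => ?_,
        lintegral_zero]
      simp only []
      rw [fderiv_dyadicMult_eq_zero σ hs (hz r hr)]
      simp
    rw [z1, z2, mul_zero, mul_zero, add_zero]

/-! ### Linearized maximal operators and their interpolation. -/

/-- The linearized maximal operators `f ↦ avgOp K (τ x) f x` map the unit ball of `L^{r(·)}` into
the ball of radius `A`, on bounded functions with support of finite measure. -/
def LinearizedBound (K : 𝔼 → ℂ) (r : 𝔼 → ℝ) (A : ℝ) : Prop :=
  ∀ f : 𝔼 → ℂ, Measurable f → (∃ M : ℝ, ∀ x, ‖f x‖ ≤ M) → volume (Function.support f) < ∞ →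
    ∫⁻ x, ‖f x‖ₑ ^ r x ≤ 1 → ∀ τ : 𝔼 → ℝ, Measurable τ → (∀ x, 0 < τ x) →
      ∫⁻ x, (‖avgOp K (τ x) f x‖ₑ / ENNReal.ofReal A) ^ r x ≤ 1

/-- The maximal operator with kernel `K` maps nonnegative functions in the unit ball of `L^{p(·)}`
into the ball of radius `A`, on continuous functions with compact support. -/
def MaximalBound (K : 𝔼 → ℂ) (p : 𝔼 → ℝ) (A : ℝ) : Prop :=
  ∀ f : 𝔼 → ℝ, Continuous f → HasCompactSupport f → (∀ x, 0 ≤ f x) →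
    ∫⁻ x, ENNReal.ofReal (f x) ^ p x ≤ 1 →
      ∫⁻ x, ((⨆ (t : ℝ) (_ : 0 < t), ‖avgOp K t (fun y => (f y : ℂ)) x‖ₑ) /
        ENNReal.ofReal A) ^ p x ≤ 1

/-- The Hardy–Littlewood function dominates the averages at all times simultaneously, hence for any
choice of time. -/
lemma linearizedBound_of_decay {K : 𝔼 → ℂ} {A : ℝ} (hA : 0 < A)
    (hK : ∀ y, ‖K y‖ ≤ A * (1 + ‖y‖) ^ (-((n : ℝ) + 1))) {q : 𝔼 → ℝ} (hq0 : ∀ x, 0 ≤ q x)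
    {C : ℝ≥0} (hC : ∀ f : 𝔼 → ℝ≥0∞, Measurable f → ∫⁻ x, f x ^ q x ≤ 1 →
      ∫⁻ x, (hlMax f x / C) ^ q x ≤ 1) :
    LinearizedBound K q (A * ((2 ^ (n + 2) * volume (ball (0 : 𝔼) 1)).toReal * C)) := by
  intro f hf _ _ hmod τ _ hτ
  refine le_trans (lintegral_mono fun x => ?_) (hC (fun y => ‖f y‖ₑ) hf.enorm hmod)
  refine ENNReal.rpow_le_rpow ?_ (hq0 x)
  have hV : (2 ^ (n + 2) * volume (ball (0 : 𝔼) 1)) ≠ ∞ :=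
    ENNReal.mul_ne_top (by simp) volume_ball_zero_ne_top
  have hV0 : (2 ^ (n + 2) * volume (ball (0 : 𝔼) 1)) ≠ 0 :=
    mul_ne_zero (by simp) volume_ball_zero_pos.ne'
  rw [ENNReal.ofReal_mul hA.le, ENNReal.ofReal_mul ENNReal.toReal_nonneg, ENNReal.ofReal_toReal hV,
    ENNReal.ofReal_coe_nnreal, ← mul_assoc]
  set W := ENNReal.ofReal A * (2 ^ (n + 2) * volume (ball (0 : 𝔼) 1)) with hW
  have hWt : W ≠ ∞ := ENNReal.mul_ne_top ENNReal.ofReal_ne_top hV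
  have hW0 : W ≠ 0 := mul_ne_zero (by simpa using hA) hV0
  calc _ ≤ (W * hlMax (fun y => ‖f y‖ₑ) x) / (W * C) :=
        ENNReal.div_le_div_right (enorm_avgOp_le_hlMax hA.le hK hf (hτ x) x) _
    _ = _ := ENNReal.mul_div_mul_left _ _ hW0 hWt

lemma memLp_two_of_bounded {f : 𝔼 → ℂ} (hf : Measurable f) (hb : ∃ M : ℝ, ∀ x, ‖f x‖ ≤ M)
    (hs : volume (Function.support f) < ∞) : MemLp f 2 := by
  obtain ⟨M, hM⟩ := hb
  have h1 : MemLp ((Function.support f).indicator fun _ => M) 2 volume :=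
    memLp_indicator_const 2 (measurableSet_support hf) M (Or.inr hs.ne)
  refine h1.mono hf.aestronglyMeasurable (ae_of_all _ fun x => ?_)
  by_cases hx : x ∈ Function.support f
  · rw [indicator_of_mem hx]
    exact (hM x).trans (Real.le_norm_self M)
  · rw [Function.notMem_support.1 hx, norm_zero]
    positivity

/-- The supremum over all times dominates any choice of time, and for the constant exponent two the
modular is the square of the `L²` norm. -/
lemma linearizedBound_two (K : 𝓢(𝔼, ℂ)) {A : ℝ} (hA : 0 < A)
    (h : ∀ f : 𝓢(𝔼, ℂ), ∫⁻ x, ⨆ (t : ℝ) (_ : 0 < t), ‖avgOp K t f x‖ₑ ^ 2 ≤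
      ENNReal.ofReal A ^ 2 * ∫⁻ x, ‖f x‖ₑ ^ 2) :
    LinearizedBound K (fun _ => 2) A := by
  intro f hf hb hs hmod τ _ hτ
  have hA0 : ENNReal.ofReal A ≠ 0 := by simpa using hA
  have hAt : ENNReal.ofReal A ^ 2 ≠ ∞ := ENNReal.pow_ne_top ENNReal.ofReal_ne_top
  simp only [ENNReal.rpow_ofNat] at hmod ⊢
  have h1 := lintegral_iSup_avgOp_le_of_schwartz K hAt h (memLp_two_of_bounded hf hb hs)
  calc ∫⁻ x, (‖avgOp K (τ x) f x‖ₑ / ENNReal.ofReal A) ^ 2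
      ≤ ∫⁻ x, (ENNReal.ofReal A ^ 2)⁻¹ * ⨆ (t : ℝ) (_ : 0 < t), ‖avgOp K t f x‖ₑ ^ 2 := by
        refine lintegral_mono fun x => ?_
        rw [div_eq_mul_inv, mul_pow, mul_comm, ENNReal.inv_pow]
        gcongr
        exact le_iSup₂ (f := fun (t : ℝ) (_ : 0 < t) => ‖avgOp K t f x‖ₑ ^ 2) (τ x) (hτ x)
    _ = (ENNReal.ofReal A ^ 2)⁻¹ * ∫⁻ x, ⨆ (t : ℝ) (_ : 0 < t), ‖avgOp K t f x‖ₑ ^ 2 :=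
        lintegral_const_mul' _ _ (ENNReal.inv_ne_top.2 (pow_ne_zero _ hA0))
    _ ≤ (ENNReal.ofReal A ^ 2)⁻¹ * (ENNReal.ofReal A ^ 2 * 1) := by
        gcongr
        exact h1.trans (by gcongr)
    _ = 1 := by rw [mul_one, ENNReal.inv_mul_cancel (pow_ne_zero _ hA0) hAt]

/-- The kernel of the linearized maximal operator. -/
noncomputable def linKernel (K : 𝔼 → ℂ) (τ : 𝔼 → ℝ) (x y : 𝔼) : ℂ :=
  (((τ x ^ n)⁻¹ : ℝ) : ℂ) * K ((τ x)⁻¹ • (x - y))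

lemma measurable_linKernel {K : 𝔼 → ℂ} (hK : Continuous K) {τ : 𝔼 → ℝ} (hτ : Measurable τ) :
    Measurable (Function.uncurry (linKernel K τ)) := by
  have h1 : Measurable fun q : 𝔼 × 𝔼 => (τ q.1)⁻¹ := (hτ.comp measurable_fst).inv
  have h2 : Measurable fun q : 𝔼 × 𝔼 => (τ q.1)⁻¹ • (q.1 - q.2) :=
    h1.smul (measurable_fst.sub measurable_snd)
  have h3 : Measurable fun q : 𝔼 × 𝔼 => (((τ q.1 ^ n)⁻¹ : ℝ) : ℂ) :=
    Complex.measurable_ofReal.comp ((hτ.comp measurable_fst).pow_const n).inv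
  exact h3.mul (hK.measurable.comp h2)

lemma measurable_avgOp_comp {K : 𝔼 → ℂ} (hK : Continuous K) {τ : 𝔼 → ℝ} (hτ : Measurable τ)
    (hτ0 : ∀ x, 0 < τ x) {f : 𝔼 → ℂ} (hf : Measurable f) :
    Measurable fun x => avgOp K (τ x) f x := by
  have : (fun x => avgOp K (τ x) f x) = fun x => ∫ y, linKernel K τ x y * f y :=
    funext fun x => avgOp_eq_integral_dilate K f (hτ0 x) x
  rw [this]
  exact (StronglyMeasurable.integral_prod_right'
    (f := fun q : 𝔼 × 𝔼 => linKernel K τ q.1 q.2 * f q.2)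
    ((measurable_linKernel hK hτ).mul (hf.comp measurable_snd)).stronglyMeasurable).measurable

lemma LinearizedBound.kernelBound {K : 𝔼 → ℂ} {r : 𝔼 → ℝ} {A : ℝ} (h : LinearizedBound K r A)
    {τ : 𝔼 → ℝ} (hτ : Measurable τ) (hτ0 : ∀ x, 0 < τ x) :
    KernelBound (linKernel K τ) r A := by
  intro f hf hb hs hmod
  refine (le_of_eq (lintegral_congr fun x => ?_)).trans (h f hf hb hs hmod τ hτ hτ0)
  rw [avgOp_eq_integral_dilate K f (hτ0 x) x]
  rfl

/-- Truncation to `{f ≥ 1 / (k + 1)}`. -/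
noncomputable def truncBelow (f : 𝔼 → ℝ) (k : ℕ) (x : 𝔼) : ℝ :=
  if 1 / ((k : ℝ) + 1) ≤ f x then f x else 0

lemma isTame_truncBelow {f : 𝔼 → ℝ} (hf : Continuous f) (hs : HasCompactSupport f) (k : ℕ) :
    IsTame (truncBelow f k) := by
  obtain ⟨b, hb⟩ := hf.bounded_above_of_compact_support hs
  refine ⟨?_, ⟨1 / ((k : ℝ) + 1), b, by positivity, fun x => ?_⟩, ?_⟩
  · exact Measurable.ite (measurableSet_le measurable_const hf.measurable) hf.measurable
      measurable_const
  · unfold truncBelow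
    split_ifs with h
    · exact Or.inr ⟨h, (Real.le_norm_self _).trans (hb x)⟩
    · exact Or.inl rfl
  · refine (measure_mono fun x hx => ?_).trans_lt hs.isCompact.measure_lt_top
    refine subset_tsupport f ?_
    rw [Function.mem_support] at hx ⊢
    contrapose! hx
    unfold truncBelow
    rw [hx, ite_self]

lemma truncBelow_le {f : 𝔼 → ℝ} (hf0 : ∀ x, 0 ≤ f x) (k : ℕ) (x : 𝔼) : truncBelow f k x ≤ f x := by
  unfold truncBelow
  split_ifs
  · exact le_rfl
  · exact hf0 x

lemma tendsto_truncBelow {f : 𝔼 → ℝ} (hf0 : ∀ x, 0 ≤ f x) (x : 𝔼) :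
    Tendsto (fun k => truncBelow f k x) atTop (𝓝 (f x)) := by
  rcases (hf0 x).eq_or_lt with h | h
  · refine tendsto_const_nhds.congr fun k => ?_
    unfold truncBelow
    rw [← h, ite_self]
  · refine tendsto_const_nhds.congr' ?_
    filter_upwards [(tendsto_one_div_add_atTop_nhds_zero_nat (𝕜 := ℝ)).eventually (gt_mem_nhds h)]
      with k hk
    rw [truncBelow, if_pos (le_of_lt hk)]

lemma tendsto_avgOp_truncBelow (K : 𝓢(𝔼, ℂ)) {f : 𝔼 → ℝ} (hf : Continuous f)
    (hs : HasCompactSupport f) (hf0 : ∀ x, 0 ≤ f x) (t : ℝ) (x : 𝔼) :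
    Tendsto (fun k => avgOp K t (fun y => (truncBelow f k y : ℂ)) x) atTop
      (𝓝 (avgOp K t (fun y => (f y : ℂ)) x)) := by
  obtain ⟨b, hb⟩ := hf.bounded_above_of_compact_support hs
  have hKc := K.continuous
  unfold avgOp
  refine tendsto_integral_of_dominated_convergence (fun y => ‖K y‖ * b) (fun k => ?_)
    (K.integrable.norm.mul_const _) (fun k => ae_of_all _ fun y => ?_)
    (ae_of_all _ fun y => ?_)
  · exact (hKc.measurable.mul (Complex.measurable_ofReal.comp
      ((isTame_truncBelow hf hs k).measurable.comp (by fun_prop)))).aestronglyMeasurable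
  · rw [norm_mul, Complex.norm_real, Real.norm_of_nonneg ((isTame_truncBelow hf hs k).nonneg _)]
    gcongr
    exact (truncBelow_le hf0 k _).trans ((Real.le_norm_self _).trans (hb _))
  · exact tendsto_const_nhds.mul
      ((Complex.continuous_ofReal.tendsto _).comp (tendsto_truncBelow hf0 _))

/-- The interpolation theorem needs a bounded logarithm and a bounded kernel. The first is obtained
by truncating `f` below `1/(k+1)` and letting `k → ∞` with Fatou's lemma, the second from the lower
bound on `τ`. -/
lemma lintegral_avgOp_comp_le_of_interpolation {p p₀ p₁ : 𝔼 → ℝ}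
    (hp : Measurable p) (hp₀ : Measurable p₀)
    (hp₁ : Measurable p₁) {l u : ℝ} (hl : 1 < l) (hlp : ∀ x, l ≤ p x) (hpu : ∀ x, p x ≤ u)
    (hlp₀ : ∀ x, l ≤ p₀ x) (hlp₁ : ∀ x, l ≤ p₁ x) {θ : ℝ} (hθ0 : 0 < θ) (hθ1 : θ < 1)
    (hpθ : ∀ x, 1 / p x = (1 - θ) / p₀ x + θ / p₁ x) {A₀ A₁ : ℝ} (hA₀ : 0 < A₀) (hA₁ : 0 < A₁)
    (K : 𝓢(𝔼, ℂ)) (h₀ : LinearizedBound K p₀ A₀) (h₁ : LinearizedBound K p₁ A₁)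
    {f : 𝔼 → ℝ} (hf : Continuous f) (hs : HasCompactSupport f) (hf0 : ∀ x, 0 ≤ f x)
    (hfm : ∫⁻ x, ENNReal.ofReal (f x) ^ p x ≤ 1) {τ : 𝔼 → ℝ} (hτ : Measurable τ) {ε : ℝ}
    (hε : 0 < ε) (hτε : ∀ x, ε ≤ τ x) :
    ∫⁻ x, (‖avgOp K (τ x) (fun y => (f y : ℂ)) x‖ₑ /
      ENNReal.ofReal (2 * (A₀ ^ (1 - θ) * A₁ ^ θ))) ^ p x ≤ 1 := by
  set D := 2 * (A₀ ^ (1 - θ) * A₁ ^ θ) with hD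
  have hD0 : 0 < D := by positivity
  have hp0 : ∀ x, 0 < p x := fun x => by linarith [hlp x]
  have hτ0 : ∀ x, 0 < τ x := fun x => hε.trans_le (hτε x)
  have hker : ∀ x y, ‖linKernel K τ x y‖ ≤ (ε ^ n)⁻¹ * SchwartzMap.seminorm ℝ 0 0 K := by
    intro x y
    rw [linKernel, norm_mul, Complex.norm_real, Real.norm_of_nonneg (by
      have := hτ0 x; positivity)]
    gcongr
    · exact hτε x
    · exact SchwartzMap.norm_le_seminorm ℝ K _
  have hfm' : ∀ k, ∫⁻ x, ENNReal.ofReal (truncBelow f k x) ^ p x ≤ 1 := fun k =>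
    le_trans (lintegral_mono fun x => ENNReal.rpow_le_rpow
      (ENNReal.ofReal_le_ofReal (truncBelow_le hf0 k x)) (hp0 x).le) hfm
  have hk : ∀ k, ∫⁻ x, (‖avgOp K (τ x) (fun y => (truncBelow f k y : ℂ)) x‖ₑ /
      ENNReal.ofReal D) ^ p x ≤ 1 := fun k => by
    have hkey := modular_interpolation hp hp₀ hp₁ hl hlp
      hpu hlp₀ hlp₁ hθ0 hθ1 hpθ hA₀ hA₁ (measurable_linKernel K.continuous hτ) hker
      (h₀.kernelBound hτ hτ0) (h₁.kernelBound hτ hτ0) (isTame_truncBelow hf hs k) (hfm' k)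
    refine (le_of_eq (lintegral_congr fun x => ?_)).trans hkey
    rw [avgOp_eq_integral_dilate K _ (hτ0 x) x]
    rfl
  calc ∫⁻ x, (‖avgOp K (τ x) (fun y => (f y : ℂ)) x‖ₑ / ENNReal.ofReal D) ^ p x
      = ∫⁻ x, liminf (fun k => (‖avgOp K (τ x) (fun y => (truncBelow f k y : ℂ)) x‖ₑ /
          ENNReal.ofReal D) ^ p x) atTop := by
        refine lintegral_congr fun x => ?_
        have h1 := (tendsto_avgOp_truncBelow K hf hs hf0 (τ x) x).enorm
        have h2 : ENNReal.ofReal D ≠ 0 := by simpa using hD0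
        exact ((ENNReal.continuous_rpow_const.tendsto _).comp
          (ENNReal.Tendsto.div_const h1 (Or.inr h2))).liminf_eq.symm
    _ ≤ liminf (fun k => ∫⁻ x, (‖avgOp K (τ x) (fun y => (truncBelow f k y : ℂ)) x‖ₑ /
          ENNReal.ofReal D) ^ p x) atTop := by
        refine lintegral_liminf_le fun k => ?_
        exact ((measurable_avgOp_comp K.continuous hτ hτ0 (Complex.measurable_ofReal.comp
          (isTame_truncBelow hf hs k).measurable)).enorm.div_const _).pow hp
    _ ≤ liminf (fun _ : ℕ => (1 : ℝ≥0∞)) atTop :=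
        liminf_le_liminf (Eventually.of_forall hk)
    _ = 1 := liminf_const _

/-- By induction the new competitor is compared with the current maximum. The selected index
provides the measurable choice of time. -/
lemma exists_measurable_argmax (G : ℕ → 𝔼 → ℝ≥0∞) (hG : ∀ k, Measurable (G k)) (N : ℕ) :
    ∃ i : 𝔼 → ℕ, Measurable i ∧ (∀ x, i x ≤ N) ∧ ∀ x, ∀ k ≤ N, G k x ≤ G (i x) x := by
  induction N with
  | zero => exact ⟨fun _ => 0, measurable_const, fun _ => le_rfl, fun x k hk => by
      rw [Nat.le_zero.1 hk]⟩
  | succ N ih =>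
    obtain ⟨i, hi, hiN, hmax⟩ := ih
    have hGi : Measurable fun x => G (i x) x :=
      (measurable_from_prod_countable_right hG : Measurable fun q : ℕ × 𝔼 => G q.1 q.2).comp
        (hi.prodMk measurable_id)
    classical
    refine ⟨fun x => if G (i x) x ≤ G (N + 1) x then N + 1 else i x,
      Measurable.ite (measurableSet_le hGi (hG _)) measurable_const hi, fun x => ?_,
      fun x k hk => ?_⟩
    · dsimp only
      split_ifs
      · exact le_rfl
      · exact (hiN x).trans (Nat.le_succ N)
    · dsimp only
      split_ifs with h
      · rcases Nat.le_succ_iff.1 hk with hk | rfl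
        · exact (hmax x k hk).trans h
        · exact le_rfl
      · rcases Nat.le_succ_iff.1 hk with hk | rfl
        · exact hmax x k hk
        · exact (not_le.1 h).le

/-- An enumeration of the positive rationals. Density is phrased through closed sets, to be applied
to `{t | ‖g t‖ ≤ c}` for continuous `g`. -/
lemma exists_seq_pos_dense : ∃ e : ℕ → ℝ, (∀ k, 0 < e k) ∧ ∀ F : Set ℝ, IsClosed F →
    (∀ k, e k ∈ F) → ∀ t, 0 < t → t ∈ F := by
  have hc : {r : ℝ | 0 < r ∧ ∃ q : ℚ, (q : ℝ) = r}.Countable :=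
    (countable_range (fun q : ℚ => (q : ℝ))).mono fun r hr => hr.2
  obtain ⟨e, he⟩ := hc.exists_eq_range ⟨1, one_pos, 1, Rat.cast_one⟩
  refine ⟨e, fun k => ?_, fun F hF hmem t ht => ?_⟩
  · have : e k ∈ range e := mem_range_self k
    rw [← he] at this
    exact this.1
  · by_contra hcon
    obtain ⟨q, hq⟩ := Rat.denseRange_cast.exists_mem_open (hF.isOpen_compl.inter isOpen_Ioi)
      (⟨t, hcon, ht⟩ : (Fᶜ ∩ Ioi (0 : ℝ)).Nonempty)
    have : (q : ℝ) ∈ range e := he ▸ ⟨hq.2, q, rfl⟩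
    obtain ⟨k, hk⟩ := this
    exact hq.1 (hk ▸ hmem k)

lemma continuous_avgOp (K : 𝓢(𝔼, ℂ)) {f : 𝔼 → ℂ} (hf : Continuous f) {b : ℝ}
    (hb : ∀ x, ‖f x‖ ≤ b) : Continuous fun q : ℝ × 𝔼 => avgOp K q.1 f q.2 := by
  have hK := K.continuous
  unfold avgOp
  refine continuous_of_dominated (bound := fun y => ‖K y‖ * b)
    (fun x => (by fun_prop : Continuous fun y => K y * f (x.2 - x.1 • y)).aestronglyMeasurable)
    (fun x => ae_of_all _ fun y => ?_) (K.integrable.norm.mul_const _)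
    (ae_of_all _ fun y => by fun_prop)
  rw [norm_mul]
  gcongr
  exact hb _

lemma iSup_enorm_eq_of_dense {e : ℕ → ℝ} (he0 : ∀ k, 0 < e k)
    (he : ∀ F : Set ℝ, IsClosed F → (∀ k, e k ∈ F) → ∀ t, 0 < t → t ∈ F) {g : ℝ → ℂ}
    (hg : Continuous g) : (⨆ (t : ℝ) (_ : 0 < t), ‖g t‖ₑ) = ⨆ k, ‖g (e k)‖ₑ := by
  refine le_antisymm (iSup₂_le fun t ht => ?_) (iSup_le fun k =>
    le_iSup₂ (f := fun (t : ℝ) (_ : 0 < t) => ‖g t‖ₑ) (e k) (he0 k))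
  exact he {t | ‖g t‖ₑ ≤ ⨆ k, ‖g (e k)‖ₑ} (isClosed_le hg.enorm continuous_const)
    (fun k => le_iSup (fun k => ‖g (e k)‖ₑ) k) t ht

/-- The supremum is the increasing limit of the maxima over the first indices, each of which is
realized by a measurable bounded index; monotone convergence concludes. -/
lemma lintegral_iSup_div_rpow_le {p : 𝔼 → ℝ} (hp : Measurable p) (hp0 : ∀ x, 0 < p x)
    {G : ℕ → 𝔼 → ℝ≥0∞} (hG : ∀ k, Measurable (G k)) (c : ℝ≥0∞)
    (h : ∀ i : 𝔼 → ℕ, Measurable i → (∃ N, ∀ x, i x ≤ N) → ∫⁻ x, (G (i x) x / c) ^ p x ≤ 1) :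
    ∫⁻ x, ((⨆ k, G k x) / c) ^ p x ≤ 1 := by
  choose i hi hiN hmax using exists_measurable_argmax G hG
  have hGi : ∀ N, Measurable fun x => G (i N x) x := fun N =>
    (measurable_from_prod_countable_right hG : Measurable fun q : ℕ × 𝔼 => G q.1 q.2).comp
      ((hi N).prodMk measurable_id)
  have hmono : Monotone fun N x => (G (i N x) x / c) ^ p x := by
    intro N M hNM x
    refine ENNReal.rpow_le_rpow (ENNReal.div_le_div_right ?_ _) (hp0 x).le
    exact hmax M x _ ((hiN N x).trans hNM)
  have heq : ∀ x, ((⨆ k, G k x) / c) ^ p x = ⨆ N, (G (i N x) x / c) ^ p x := by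
    intro x
    have h1 : (⨆ k, G k x) = ⨆ N, G (i N x) x :=
      le_antisymm (iSup_mono fun k => hmax k x k le_rfl)
        (iSup_le fun N => le_iSup (fun k => G k x) (i N x))
    rw [h1, ENNReal.iSup_div]
    exact (ENNReal.orderIsoRpow (p x) (hp0 x)).map_iSup _
  rw [lintegral_congr heq, lintegral_iSup (fun N => ((hGi N).div_const _).pow hp) hmono]
  exact iSup_le fun N => h (i N) (hi N) ⟨N, hiN N⟩

/-- A bound for all linearizations which are bounded below is a bound for the maximal operator. -/
lemma lintegral_iSup_avgOp_le {p : 𝔼 → ℝ} (hp : Measurable p) (hp0 : ∀ x, 0 < p x) {D : ℝ}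
    (K : 𝓢(𝔼, ℂ)) {f : 𝔼 → ℝ} (hf : Continuous f) (hs : HasCompactSupport f)
    (h : ∀ τ : 𝔼 → ℝ, Measurable τ → (∃ ε : ℝ, 0 < ε ∧ ∀ x, ε ≤ τ x) →
      ∫⁻ x, (‖avgOp K (τ x) (fun y => (f y : ℂ)) x‖ₑ / ENNReal.ofReal D) ^ p x ≤ 1) :
    ∫⁻ x, ((⨆ (t : ℝ) (_ : 0 < t), ‖avgOp K t (fun y => (f y : ℂ)) x‖ₑ) /
        ENNReal.ofReal D) ^ p x ≤ 1 := by
  obtain ⟨e, he0, he⟩ := exists_seq_pos_dense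
  obtain ⟨b, hb⟩ := hf.bounded_above_of_compact_support hs
  have hcont : Continuous fun q : ℝ × 𝔼 => avgOp K q.1 (fun y => (f y : ℂ)) q.2 :=
    continuous_avgOp K (Complex.continuous_ofReal.comp hf) (b := b)
      (fun x => by rw [Complex.norm_real]; exact hb x)
  have hsup : ∀ x, (⨆ (t : ℝ) (_ : 0 < t), ‖avgOp K t (fun y => (f y : ℂ)) x‖ₑ) =
      ⨆ k, ‖avgOp K (e k) (fun y => (f y : ℂ)) x‖ₑ := fun x =>
    iSup_enorm_eq_of_dense he0 he (hcont.comp (by fun_prop : Continuous fun t : ℝ => (t, x)))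
  simp only [hsup]
  refine lintegral_iSup_div_rpow_le hp hp0 (G := fun k x => ‖avgOp K (e k) (fun y => (f y : ℂ)) x‖ₑ)
    (fun k => (hcont.comp (by fun_prop : Continuous fun x : 𝔼 => (e k, x))).enorm.measurable) _
    fun i hi ⟨N, hN⟩ => ?_
  refine h (fun x => e (i x)) (measurable_from_nat.comp hi) ?_
  -- Only finitely many times occur, and the smallest of them is the positive lower bound.
  obtain ⟨j, -, hj⟩ := (Finset.range (N + 1)).exists_min_image e ⟨0, by simp⟩
  exact ⟨e j, he0 j, fun x => hj _ (Finset.mem_range.2 (Nat.lt_succ_of_le (hN x)))⟩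

lemma maximalBound_of_interpolation {p p₀ p₁ : 𝔼 → ℝ}
    (hp : Measurable p) (hp₀ : Measurable p₀)
    (hp₁ : Measurable p₁) {l u : ℝ} (hl : 1 < l) (hlp : ∀ x, l ≤ p x) (hpu : ∀ x, p x ≤ u)
    (hlp₀ : ∀ x, l ≤ p₀ x) (hlp₁ : ∀ x, l ≤ p₁ x) {θ : ℝ} (hθ0 : 0 < θ) (hθ1 : θ < 1)
    (hpθ : ∀ x, 1 / p x = (1 - θ) / p₀ x + θ / p₁ x) {A₀ A₁ : ℝ} (hA₀ : 0 < A₀) (hA₁ : 0 < A₁)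
    (K : 𝓢(𝔼, ℂ)) (h₀ : LinearizedBound K p₀ A₀) (h₁ : LinearizedBound K p₁ A₁) :
    MaximalBound K p (2 * (A₀ ^ (1 - θ) * A₁ ^ θ)) := by
  intro f hf hs hf0 hfm
  refine lintegral_iSup_avgOp_le hp (fun x => by linarith [hlp x]) K hf hs
    fun τ hτ ⟨ε, hε, hτε⟩ => ?_
  exact lintegral_avgOp_comp_le_of_interpolation hp hp₀ hp₁ hl hlp hpu hlp₀ hlp₁ hθ0 hθ1 hpθ hA₀
    hA₁ K h₀ h₁ hf hs hf0 hfm hτ hε hτε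

lemma LinearizedBound.maximalBound {p : 𝔼 → ℝ} (hp : Measurable p) (hp0 : ∀ x, 0 < p x) {A : ℝ}
    (K : 𝓢(𝔼, ℂ)) (h : LinearizedBound K p A) : MaximalBound K p A := by
  intro f hf hs hf0 hfm
  obtain ⟨b, hb⟩ := hf.bounded_above_of_compact_support hs
  refine lintegral_iSup_avgOp_le hp hp0 K hf hs fun τ hτ ⟨ε, hε, hτε⟩ => ?_
  refine h (fun y => (f y : ℂ)) (Complex.measurable_ofReal.comp hf.measurable)
    ⟨b, fun x => by rw [Complex.norm_real]; exact hb x⟩ ?_ ?_ τ hτ fun x => hε.trans_le (hτε x)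
  · refine (measure_mono fun x hx => ?_).trans_lt hs.isCompact.measure_lt_top
    refine subset_tsupport f ?_
    simpa using hx
  · refine (le_of_eq (lintegral_congr fun x => ?_)).trans hfm
    rw [← ofReal_norm, Complex.norm_real, Real.norm_of_nonneg (hf0 x)]

/-! ### Exponents -/

/-- The decay rate of the log-Hölder condition is arbitrarily small at suitable points. -/
lemma exists_norm_le_log (hn : 1 ≤ n) {c ε : ℝ} (hε : 0 < ε) :
    ∃ x : 𝔼, c * (1 / Real.log (Real.exp 1 + ‖x‖)) ≤ ε := by
  have h1 : Tendsto (fun r : ℝ => c * (1 / Real.log (Real.exp 1 + r))) atTop (𝓝 0) := by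
    have h2 : Tendsto (fun r : ℝ => Real.log (Real.exp 1 + r)) atTop atTop :=
      Real.tendsto_log_atTop.comp (tendsto_atTop_add_const_left _ _ tendsto_id)
    have h3 := (h2.inv_tendsto_atTop).const_mul c
    simpa using h3
  obtain ⟨r, hr, hr0⟩ := ((h1.eventually (gt_mem_nhds hε)).and (eventually_ge_atTop 0)).exists
  refine ⟨EuclideanSpace.single ⟨0, hn⟩ r, ?_⟩
  rw [PiLp.norm_single, Real.norm_of_nonneg hr0]
  exact hr.le

/-- Bounds on `p` pass to its limit along points going to infinity, which exist because `n ≥ 1`. -/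
lemma limit_exponent_mem_Icc (hn : 1 ≤ n) {p : 𝔼 → ℝ} {l u pInf c : ℝ} (hl : ∀ x, l ≤ p x)
    (hu : ∀ x, p x ≤ u)
    (h : ∀ x, |p x - pInf| ≤ c * (1 / Real.log (Real.exp 1 + ‖x‖))) : pInf ∈ Icc l u := by
  constructor
  · refine le_of_forall_pos_le_add fun ε hε => ?_
    obtain ⟨x, hx⟩ := exists_norm_le_log hn (c := c) hε
    linarith [(abs_le.1 ((h x).trans hx)).2, hl x]
  · refine le_of_forall_pos_le_add fun ε hε => ?_
    obtain ⟨x, hx⟩ := exists_norm_le_log hn (c := c) hε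
    linarith [(abs_le.1 ((h x).trans hx)).1, hu x]

/-- The solution of `1 / p = (1 - θ) / q + θ / 2`. -/
noncomputable def conjExponent (θ p : ℝ) : ℝ := 2 * (1 - θ) * p / (2 - θ * p)

lemma conjExponent_mono {θ y z : ℝ} (hθ0 : 0 < θ) (hθ1 : θ < 1) (hy : 0 < y) (hyz : y ≤ z)
    (hz : θ * z < 2) : conjExponent θ y ≤ conjExponent θ z := by
  unfold conjExponent
  have h1 : θ * y ≤ θ * z := by gcongr
  have h2 : 0 < 1 - θ := by linarith
  have h3 : 0 < z := hy.trans_le hyz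
  gcongr

/-- The map is Lipschitz on values at most `u`, as these stay away from the pole `2/θ`. This
transfers the log-Hölder conditions from `p` to `q`. -/
lemma abs_conjExponent_sub_le {θ u y z : ℝ} (hθ0 : 0 < θ) (hθ1 : θ < 1) (hu : θ * u < 2)
    (hy : y ≤ u) (hz : z ≤ u) :
    |conjExponent θ y - conjExponent θ z| ≤ 4 * (1 - θ) / (2 - θ * u) ^ 2 * |y - z| := by
  have h1 : θ * y ≤ θ * u := by gcongr
  have h2 : θ * z ≤ θ * u := by gcongr
  have h3 : 0 < 2 - θ * y := by linarith
  have h4 : 0 < 2 - θ * z := by linarith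
  have h5 : 0 < 2 - θ * u := by linarith
  have h6 : 0 < 1 - θ := by linarith
  have e : conjExponent θ y - conjExponent θ z =
      4 * (1 - θ) / ((2 - θ * y) * (2 - θ * z)) * (y - z) := by
    unfold conjExponent
    field_simp
    ring
  rw [e, abs_mul, abs_of_pos (by positivity), pow_two]
  gcongr

/-- Three requirements are compatible: `θ > 2N/(2N+γ)` for geometric decay of the pieces, `θ < 2/u`
for a finite exponent `q`, and `θ < 2 - 2/l` for `q` above one. The two hypotheses on `l` and `u`
say that the first bound lies below the other two. -/
lemma exists_interpolation_weight {l u N γ : ℝ} (hl : 0 < l) (hlu : l ≤ u) (hN : 0 ≤ N)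
    (hγ : 0 < γ) (h1 : 2 * N + γ < l * (N + γ)) (h2 : N * u < 2 * N + γ) :
    ∃ θ : ℝ, 0 < θ ∧ θ < 1 ∧ N < θ * (N + γ / 2) ∧ θ * u < 2 ∧ 2 < l * (2 - θ) := by
  have hu : 0 < u := hl.trans_le hlu
  have hd : 2 * N / (2 * N + γ) < min 1 (min (2 / u) (2 - 2 / l)) := by
    refine lt_min ?_ (lt_min ?_ ?_)
    · rw [div_lt_one (by positivity)]; linarith
    · rw [div_lt_div_iff₀ (by positivity) hu]; linarith
    · rw [div_lt_iff₀ (by positivity)]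
      have : (2 - 2 / l) * (2 * N + γ) = 2 * (2 * N + γ) - 2 * ((2 * N + γ) / l) := by
        field_simp
      rw [this]
      have : (2 * N + γ) / l < N + γ := by rw [div_lt_iff₀ hl]; linarith
      linarith
  obtain ⟨θ, hθ, hθ'⟩ := exists_between hd
  have hd0 : 0 ≤ 2 * N / (2 * N + γ) := by positivity
  rw [lt_min_iff, lt_min_iff] at hθ'
  obtain ⟨ha, hb, hc⟩ := hθ'
  refine ⟨θ, hd0.trans_lt hθ, ha, ?_, (lt_div_iff₀ hu).1 hb, ?_⟩
  · rw [div_lt_iff₀ (by positivity)] at hθ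
    linarith
  · have : 2 / l < 2 - θ := by linarith
    rw [div_lt_iff₀ hl] at this
    linarith

/-- The exponent `q` is `conjExponent θ` composed with `p`. Monotonicity puts its infimum at or
above `conjExponent θ l`, and this value exceeds one exactly when `l(2 - θ) > 2`. -/
lemma exists_interpolation_exponent (hn : 1 ≤ n) {p : 𝔼 → ℝ} (hp : GloballyLogHolder p) {l u : ℝ}
    (hl0 : 0 < l) (hl : ∀ x, l ≤ p x) (hu : ∀ x, p x ≤ u) {θ : ℝ} (hθ0 : 0 < θ) (hθ1 : θ < 1)
    (hθu : θ * u < 2) (hθl : 2 < l * (2 - θ)) :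
    ∃ q : 𝔼 → ℝ, GloballyLogHolder q ∧ (∀ x, 1 / p x = (1 - θ) / q x + θ / 2) ∧
      ∃ qm qM : ℝ, 1 < qm ∧ (∀ x, qm ≤ q x) ∧ (∀ x, q x ≤ qM) ∧ ∃ qInf c₂ : ℝ, qm ≤ qInf ∧ 0 < c₂ ∧
        ∀ x, |q x - qInf| ≤ c₂ * (1 / Real.log (Real.exp 1 + ‖x‖)) := by
  have hlu : l ≤ u := (hl 0).trans (hu 0)
  have hθx : ∀ y, y ≤ u → 0 < 2 - θ * y := fun y hy => by
    have : θ * y ≤ θ * u := by gcongr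
    linarith
  have h1θ : 0 < 1 - θ := by linarith
  set L : ℝ := 4 * (1 - θ) / (2 - θ * u) ^ 2 with hL
  have hL0 : 0 < L := by have := hθx u le_rfl; positivity
  have hqm : 1 < conjExponent θ l := by
    rw [conjExponent, one_lt_div (hθx l hlu)]
    nlinarith
  have hqm' : ∀ y, l ≤ y → y ≤ u → conjExponent θ l ≤ conjExponent θ y := fun y hy hyu =>
    conjExponent_mono hθ0 hθ1 hl0 hy (by linarith [hθx y hyu])
  obtain ⟨c₁, hc₁, hloc⟩ := hp.loc
  obtain ⟨pInf, c₂, -, hc₂, hdecay⟩ := hp.decay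
  have hmem := limit_exponent_mem_Icc hn hl hu hdecay
  have hlocq : ∀ x y, ‖x - y‖ < 1 / 2 → |conjExponent θ (p x) - conjExponent θ (p y)| ≤
      L * c₁ * (1 / Real.log (Real.exp 1 + 1 / ‖x - y‖)) := fun x y hxy => by
    refine (abs_conjExponent_sub_le hθ0 hθ1 hθu (hu x) (hu y)).trans ?_
    rw [mul_assoc]
    gcongr
    exact hloc x y hxy
  have hdecq : ∀ x, |conjExponent θ (p x) - conjExponent θ pInf| ≤
      L * c₂ * (1 / Real.log (Real.exp 1 + ‖x‖)) := fun x => by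
    refine (abs_conjExponent_sub_le hθ0 hθ1 hθu (hu x) hmem.2).trans ?_
    rw [mul_assoc]
    gcongr
    exact hdecay x
  refine ⟨fun x => conjExponent θ (p x), ⟨fun x => ?_, ⟨L * c₁, by positivity, hlocq⟩,
    ⟨conjExponent θ pInf, L * c₂, ?_, by positivity, hdecq⟩⟩, fun x => ?_, conjExponent θ l,
    conjExponent θ u, hqm, fun x => hqm' _ (hl x) (hu x), fun x => conjExponent_mono hθ0 hθ1
      (hl0.trans_le (hl x)) (hu x) hθu, conjExponent θ pInf, L * c₂, hqm' _ hmem.1 hmem.2,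
      by positivity, hdecq⟩
  · linarith [hqm' _ (hl x) (hu x)]
  · linarith [hqm' _ hmem.1 hmem.2]
  · have h1 := hθx _ (hu x)
    have h2 := hp.pos x
    simp only [conjExponent]
    field_simp
    ring

/-! ### Bounds for the pieces -/

lemma hasCompactSupport_dyadicMult (σ : Measure 𝔼) {s : ℝ} (hs : 0 < s) :
    HasCompactSupport (dyadicMult σ s) := by
  refine HasCompactSupport.intro (isCompact_closedBall (0 : 𝔼) (4 * s⁻¹)) fun ξ hξ => ?_
  rw [mem_closedBall, dist_zero_right, not_le] at hξ
  exact dyadicMult_eq_zero σ hs (Or.inr hξ.le)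

lemma norm_dyadicPiece_le {σ : Measure 𝔼} [IsFiniteMeasure σ] (hσ : CompactlySupported σ)
    {C β : ℝ} (hC : ∀ s : ℝ, 0 < s → s ≤ 1 → ∀ x : 𝔼,
      ‖smoothed σ s x‖ ≤ C * s ^ (β - n) * (1 + ‖x‖) ^ (-((n : ℝ) + 1)))
    {s : ℝ} (hs : 0 < s) (hs1 : s ≤ 1) (y : 𝔼) :
    ‖dyadicPiece hσ hs y‖ ≤
      (C * (2 ^ (n - β) + 1) * s ^ (β - n)) * (1 + ‖y‖) ^ (-((n : ℝ) + 1)) := by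
  have e : dyadicPiece hσ hs y = smoothed σ (s / 2) y - smoothed σ s y := by
    rw [dyadicPiece, sub_apply, smoothedSchwartz_apply, smoothedSchwartz_apply]
  have h2 : (s / 2) ^ (β - n) = 2 ^ (n - β) * s ^ (β - n) := by
    rw [Real.div_rpow hs.le zero_le_two, div_eq_mul_inv, ← Real.rpow_neg zero_le_two, neg_sub,
      mul_comm]
  rw [e]
  refine (norm_sub_le _ _).trans ((add_le_add (hC _ (half_pos hs) (by linarith) y)
    (hC s hs hs1 y)).trans (le_of_eq ?_))
  rw [h2]
  ring

lemma linearizedBound_two_dyadicPiece {σ : Measure 𝔼} [IsFiniteMeasure σ]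
    (hσ : CompactlySupported σ) {C γ : ℝ} (hC0 : 0 < C) {s : ℝ} (hs : 0 < s)
    (hC : ∀ η : 𝔼,
      ENNReal.ofReal (1 + s⁻¹) * (∫⁻ r in Icc (1 : ℝ) 2, ‖dyadicMult σ s (r • η)‖ₑ ^ 2) +
      ENNReal.ofReal s⁻¹⁻¹ * (∫⁻ r in Icc (1 : ℝ) 2,
        ‖fderiv ℝ (dyadicMult σ s) (r • η) (r • η)‖ₑ ^ 2) ≤
      if ‖η‖ ∈ Icc (s⁻¹ / 2) (4 * s⁻¹) then ENNReal.ofReal (C * s ^ γ) else 0) :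
    LinearizedBound (dyadicPiece hσ hs) (fun _ => 2) (Real.sqrt (7 * C) * s ^ (γ / 2)) := by
  have hA : 0 < Real.sqrt (7 * C) * s ^ (γ / 2) := by positivity
  refine linearizedBound_two _ hA fun f => ?_
  have h := lintegral_iSup_avgOp_schwartz_le (dyadicPiece hσ hs)
    (by rw [fourier_dyadicPiece]; exact hasCompactSupport_dyadicMult σ hs) (inv_pos.2 hs)
    (E := ENNReal.ofReal (C * s ^ γ)) (by rw [fourier_dyadicPiece]; exact hC) f
  refine h.trans (le_of_eq ?_)
  congr 1
  rw [← ENNReal.ofReal_pow hA.le, mul_pow, Real.sq_sqrt (by positivity), ← Real.rpow_natCast,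
    ← Real.rpow_mul hs.le, mul_assoc, ENNReal.ofReal_mul (by norm_num : (0 : ℝ) ≤ 7)]
  norm_num

lemma MaximalBound.mono {K : 𝔼 → ℂ} {p : 𝔼 → ℝ} (hp : ∀ x, 0 < p x) {A B : ℝ}
    (h : MaximalBound K p A) (hAB : A ≤ B) : MaximalBound K p B := by
  intro f hf hs hf0 hfm
  refine le_trans (lintegral_mono fun x => ENNReal.rpow_le_rpow ?_ (hp x).le) (h f hf hs hf0 hfm)
  exact ENNReal.div_le_div_left (ENNReal.ofReal_le_ofReal hAB) _

/-- The frequency-localized pieces of the maximal operator are bounded, with geometric decay. -/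
theorem exists_maximalBound_dyadicPiece (hn : 1 ≤ n) {σ : Measure 𝔼} [IsFiniteMeasure σ]
    (hσ : CompactlySupported σ) {α β : ℝ} (hα : 1 / 2 < α) (hβ0 : 0 ≤ β) (hβn : β ≤ n)
    (hdim : LocallyUniformlyDimensional σ β)
    (hdecay : ∃ C : ℝ, ∀ ξ : 𝔼,
      Real.sqrt (∫ t in (1 : ℝ)..2, ‖measureFourier σ (t • ξ)‖ ^ 2) ≤ C * (1 + ‖ξ‖) ^ (-α))
    (hgrad : ∃ C : ℝ, ∀ ξ : 𝔼,
      Real.sqrt (∫ t in (1 : ℝ)..2, gradNormSq (measureFourier σ) (t • ξ)) ≤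
        C * (1 + ‖ξ‖) ^ (-α))
    {p : 𝔼 → ℝ} (hp : GloballyLogHolder p) {l u : ℝ} (hl0 : 0 < l) (hl : ∀ x, l ≤ p x)
    (hu : ∀ x, p x ≤ u) (h1 : 2 * (n - β) + (2 * α - 1) < l * ((n - β) + (2 * α - 1)))
    (h2 : (n - β) * u < 2 * (n - β) + (2 * α - 1)) :
    ∃ A ε : ℝ, 0 < A ∧ 0 < ε ∧ MaximalBound (smoothedSchwartz hσ one_pos) p A ∧
      ∀ s (hs : 0 < s), s ≤ 1 → MaximalBound (dyadicPiece hσ hs) p (A * s ^ ε) := by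
  have hN : (0 : ℝ) ≤ n - β := by linarith
  have hγ : 0 < 2 * α - 1 := by linarith
  have hl1 : 1 < l := by nlinarith
  have hlu : l ≤ u := (hl 0).trans (hu 0)
  have hpm : Measurable p := hp.continuous.measurable
  obtain ⟨θ, hθ0, hθ1, hθN, hθu, hθl⟩ := exists_interpolation_weight hl0 hlu hN hγ h1 h2
  obtain ⟨q, hq, hpq, qm, qM, hqm1, hqm, hqM, hqInf⟩ :=
    exists_interpolation_exponent hn hp hl0 hl hu hθ0 hθ1 hθu hθl
  obtain ⟨Cq, hCq1, hCq⟩ := exists_modular_hlMax_le hq hqm1 hqm hqM hqInf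
  obtain ⟨pInf, c₂, -, hc₂, hdec⟩ := hp.decay
  obtain ⟨Cp, hCp1, hCp⟩ := exists_modular_hlMax_le hp hl1 hl hu
    ⟨pInf, c₂, (limit_exponent_mem_Icc hn hl hu hdec).1, hc₂, hdec⟩
  obtain ⟨C₀, hC₀, hsm⟩ := exists_norm_smoothed_le hσ hβ0 hβn hdim
  obtain ⟨C₁, hC₁, hmult⟩ := exists_dyadicMult_bound hσ hα hdecay hgrad
  set V : ℝ := (2 ^ (n + 2) * volume (ball (0 : 𝔼) 1)).toReal with hV
  have hV0 : 0 < V := ENNReal.toReal_pos (mul_ne_zero (by simp) volume_ball_zero_pos.ne')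
    (ENNReal.mul_ne_top (by simp) volume_ball_zero_ne_top)
  have hCq0 : (0 : ℝ) < Cq := by
    have : (1 : ℝ) ≤ Cq := by exact_mod_cast hCq1
    linarith
  have hCp0 : (0 : ℝ) < Cp := by
    have : (1 : ℝ) ≤ Cp := by exact_mod_cast hCp1
    linarith
  -- The low-frequency piece occurs once and needs no decay, so the maximal theorem is used directly
  -- at the exponent `p`.
  have hlow : MaximalBound (smoothedSchwartz hσ one_pos) p (C₀ * (V * Cp)) := by
    refine LinearizedBound.maximalBound hpm hp.pos _ (linearizedBound_of_decay hC₀ (fun y => ?_)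
      (fun x => (hp.pos x).le) hCp)
    rw [smoothedSchwartz_apply]
    have := hsm 1 one_pos le_rfl y
    rwa [Real.one_rpow, mul_one] at this
  set P : ℝ := C₀ * (2 ^ (n - β) + 1) * (V * Cq) with hP
  have hP0 : 0 < P := by positivity
  set Q : ℝ := Real.sqrt (7 * C₁) with hQ
  have hQ0 : 0 < Q := by positivity
  -- The interpolated power of `s`: the loss `s^(β-n)` at `q` with weight `1 - θ` and the gain
  -- `s^((2α-1)/2)` at two with weight `θ`. Its positivity is the inequality `hθN`.
  set ε : ℝ := (β - n) * (1 - θ) + (2 * α - 1) / 2 * θ with hε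
  have hpiece : ∀ s (hs : 0 < s), s ≤ 1 →
      MaximalBound (dyadicPiece hσ hs) p (2 * (P ^ (1 - θ) * Q ^ θ) * s ^ ε) := by
    intro s hs hs1
    have b₀ : LinearizedBound (dyadicPiece hσ hs) q
        ((C₀ * (2 ^ (n - β) + 1) * s ^ (β - n)) * (V * Cq)) :=
      linearizedBound_of_decay (by positivity) (norm_dyadicPiece_le hσ hsm hs hs1)
        (fun x => (hq.pos x).le) hCq
    have b₁ : LinearizedBound (dyadicPiece hσ hs) (fun _ => 2) (Q * s ^ ((2 * α - 1) / 2)) :=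
      linearizedBound_two_dyadicPiece hσ hC₁ hs (hmult s hs hs1)
    have hmin : 1 < min l (min qm 2) := lt_min hl1 (lt_min hqm1 one_lt_two)
    have key := maximalBound_of_interpolation hpm hq.continuous.measurable measurable_const hmin
      (fun x => (min_le_left _ _).trans (hl x)) hu
      (fun x => ((min_le_right _ _).trans (min_le_left _ _)).trans (hqm x))
      (fun x => (min_le_right _ _).trans (min_le_right _ _)) hθ0 hθ1 hpq
      (by positivity) (by positivity) _ b₀ b₁
    convert key using 1
    have e1 : C₀ * (2 ^ (n - β) + 1) * s ^ (β - n) * (V * Cq) = P * s ^ (β - n) := by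
      rw [hP]; ring
    rw [e1, Real.mul_rpow hP0.le (by positivity), Real.mul_rpow hQ0.le (by positivity),
      ← Real.rpow_mul hs.le, ← Real.rpow_mul hs.le, hε, Real.rpow_add hs]
    ring
  refine ⟨max (C₀ * (V * Cp)) (2 * (P ^ (1 - θ) * Q ^ θ)), ε, by positivity, by rw [hε]; nlinarith,
    ?_, ?_⟩
  · exact hlow.mono hp.pos (le_max_left _ _)
  · intro s hs hs1
    exact (hpiece s hs hs1).mono hp.pos (by gcongr; exact le_max_right _ _)

/-! ### Summation of the pieces -/

/-- Jensen's inequality for the discrete probability measure with weights `w`. -/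
lemma tsum_mul_rpow_le {w : ℕ → ℝ≥0∞} (hw : ∑' j, w j = 1) (z : ℕ → ℝ≥0∞) {s : ℝ} (hs : 1 ≤ s) :
    (∑' j, w j * z j) ^ s ≤ ∑' j, w j * z j ^ s := by
  set μ : Measure ℕ := Measure.sum fun j => w j • Measure.dirac j with hμ
  have hint : ∀ f : ℕ → ℝ≥0∞, ∫⁻ j, f j ∂μ = ∑' j, w j * f j := fun f => by
    rw [hμ, lintegral_sum_measure]
    refine tsum_congr fun j => ?_
    rw [lintegral_smul_measure, lintegral_dirac, smul_eq_mul]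
  have : IsProbabilityMeasure μ := by
    constructor
    rw [← lintegral_one, hint]
    simpa only [mul_one] using hw
  have h := eLpNorm'_le_eLpNorm'_of_exponent_le (μ := μ) (f := z) one_pos hs
    (measurable_from_nat (f := z)).aestronglyMeasurable
  simp only [eLpNorm', enorm_eq_self, ENNReal.rpow_one, div_one] at h
  rwa [one_div, ENNReal.le_rpow_inv_iff (by linarith), hint, hint] at h

/-- The countable triangle inequality for the Luxemburg norm. The normalized sum is a convex
combination of the `a j / lam j` with weights `lam j / D`, and the modular is convex. -/
lemma lintegral_tsum_div_rpow_le {p : 𝔼 → ℝ} (hp : Measurable p) (hp1 : ∀ x, 1 ≤ p x)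
    {a : ℕ → 𝔼 → ℝ≥0∞} (ha : ∀ j, Measurable (a j)) {lam : ℕ → ℝ≥0∞} (h0 : ∀ j, lam j ≠ 0)
    (ht : ∑' j, lam j ≠ ∞) (h : ∀ j, ∫⁻ x, (a j x / lam j) ^ p x ≤ 1) :
    ∫⁻ x, ((∑' j, a j x) / ∑' j, lam j) ^ p x ≤ 1 := by
  set D := ∑' j, lam j with hD
  have hD0 : D ≠ 0 := fun hc => h0 0 (ENNReal.tsum_eq_zero.1 hc 0)
  have hw : ∑' j, lam j / D = 1 := by
    simp only [div_eq_mul_inv]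
    rw [ENNReal.tsum_mul_right, ENNReal.mul_inv_cancel hD0 ht]
  have hpt : ∀ x, ((∑' j, a j x) / D) ^ p x ≤ ∑' j, lam j / D * (a j x / lam j) ^ p x := by
    intro x
    refine le_trans (le_of_eq ?_) (tsum_mul_rpow_le hw (fun j => a j x / lam j) (hp1 x))
    congr 1
    rw [div_eq_mul_inv, ← ENNReal.tsum_mul_right]
    refine tsum_congr fun j => ?_
    rw [mul_comm (lam j / D), ← mul_div_assoc, ENNReal.div_mul_cancel (h0 j)
      (ENNReal.ne_top_of_tsum_ne_top ht j), div_eq_mul_inv]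
  calc ∫⁻ x, ((∑' j, a j x) / D) ^ p x
      ≤ ∫⁻ x, ∑' j, lam j / D * (a j x / lam j) ^ p x := lintegral_mono hpt
    _ = ∑' j, lam j / D * ∫⁻ x, (a j x / lam j) ^ p x := by
        rw [lintegral_tsum fun j => ((((ha j).div_const _).pow hp).const_mul _).aemeasurable]
        exact tsum_congr fun j => lintegral_const_mul _ (((ha j).div_const _).pow hp)
    _ ≤ ∑' j, lam j / D * 1 := by gcongr with j; exact h j
    _ = 1 := by simp only [mul_one]; exact hw

lemma integrable_mollifier {s : ℝ} (hs : 0 < s) : Integrable (mollifier (n := n) s) := by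
  unfold mollifier
  exact ((bumpKernel.integrable (μ := volume)).comp_smul (inv_ne_zero hs.ne')).const_mul _

/-- Fubini and rescaling move the scale `s` from the kernel into the argument of `f`, where the
limit `s → 0` can be taken by dominated convergence. -/
lemma avgOp_smoothed_eq {σ : Measure 𝔼} [IsFiniteMeasure σ] {f : 𝔼 → ℂ} (hf : Continuous f) {b : ℝ}
    (hb : ∀ x, ‖f x‖ ≤ b) {s : ℝ} (hs : 0 < s) (t : ℝ) (x : 𝔼) :
    avgOp (smoothed σ s) t f x =
      ∫ w, (∫ v, bumpKernel v * f (x - t • w - (t * s) • v)) ∂σ := by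
  have hmc := continuous_mollifier (n := n) s
  have hmi := integrable_mollifier (n := n) hs
  have hdom : Integrable (fun q : 𝔼 × 𝔼 => mollifier s (q.1 - q.2) * (b : ℂ))
      ((volume : Measure 𝔼).prod σ) := by
    rw [integrable_prod_iff' (by fun_prop : Continuous fun q : 𝔼 × 𝔼 =>
      mollifier s (q.1 - q.2) * (b : ℂ)).aestronglyMeasurable]
    refine ⟨ae_of_all _ fun w => (hmi.comp_sub_right w).mul_const _, ?_⟩
    refine (integrable_const (∫ y : 𝔼, ‖mollifier s y * (b : ℂ)‖)).congr (ae_of_all _ fun w => ?_)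
    exact (integral_sub_right_eq_self (fun y : 𝔼 => ‖mollifier s y * (b : ℂ)‖) w).symm
  have hint : Integrable (Function.uncurry fun y w : 𝔼 => mollifier s (y - w) * f (x - t • y))
      ((volume : Measure 𝔼).prod σ) := by
    refine hdom.mono (by fun_prop : Continuous fun q : 𝔼 × 𝔼 =>
      mollifier s (q.1 - q.2) * f (x - t • q.1)).aestronglyMeasurable (ae_of_all _ fun q => ?_)
    simp only [Function.uncurry]
    rw [norm_mul, norm_mul, Complex.norm_real]
    gcongr
    exact (hb _).trans (Real.le_norm_self b)
  have h1 : avgOp (smoothed σ s) t f x =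
      ∫ y, (∫ w, mollifier s (y - w) * f (x - t • y) ∂σ) := by
    rw [avgOp]
    refine integral_congr_ae (ae_of_all _ fun y => ?_)
    simp only [smoothed]
    rw [integral_mul_const]
  rw [h1, integral_integral_swap hint]
  refine integral_congr_ae (ae_of_all _ fun w => ?_)
  have h2 := Measure.integral_comp_smul (volume : Measure 𝔼)
    (fun v : 𝔼 => bumpKernel v * f (x - t • w - (t * s) • v)) s⁻¹
  simp only [finrank_euclideanSpace, Fintype.card_fin, smul_smul, mul_assoc,
    mul_inv_cancel₀ hs.ne', mul_one] at h2
  have h3 : ∫ y, mollifier s (y - w) * f (x - t • y) =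
      ∫ y, mollifier s y * f (x - t • w - t • y) := by
    rw [← integral_sub_right_eq_self (fun y => mollifier s y * f (x - t • w - t • y)) w]
    refine integral_congr_ae (ae_of_all _ fun y => ?_)
    simp only [smul_sub, sub_sub, add_sub_cancel]
  simp only []
  rw [h3]
  simp only [mollifier, mul_assoc]
  rw [integral_const_mul, h2, inv_pow, inv_inv, abs_of_pos (by positivity), Complex.real_smul,
    ← mul_assoc, ← Complex.ofReal_mul, inv_mul_cancel₀ (by positivity), Complex.ofReal_one, one_mul]

/-- The averages against the smoothed measures converge. -/
lemma tendsto_avgOp_smoothed {σ : Measure 𝔼} [IsFiniteMeasure σ] {f : 𝔼 → ℂ} (hf : Continuous f)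
    {b : ℝ} (hb : ∀ x, ‖f x‖ ≤ b) (t : ℝ) (x : 𝔼) {s : ℕ → ℝ} (hs : ∀ j, 0 < s j)
    (hlim : Tendsto s atTop (𝓝 0)) :
    Tendsto (fun j => avgOp (smoothed σ (s j)) t f x) atTop (𝓝 (∫ y, f (x - t • y) ∂σ)) := by
  have hbk := (bumpKernel (n := n)).continuous
  have hin : ∀ w : 𝔼, Continuous fun r : ℝ => ∫ v, bumpKernel v * f (x - t • w - (t * r) • v) := by
    intro w
    refine continuous_of_dominated (bound := fun v => ‖bumpKernel v‖ * b)
      (fun r => Continuous.aestronglyMeasurable (by fun_prop)) (fun r => ae_of_all _ fun v => ?_)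
      (bumpKernel.integrable.norm.mul_const _) (ae_of_all _ fun v => by fun_prop)
    rw [norm_mul]
    gcongr
    exact hb _
  have hw : ∀ r : ℝ, Continuous fun w : 𝔼 => ∫ v, bumpKernel v * f (x - t • w - (t * r) • v) := by
    intro r
    refine continuous_of_dominated (bound := fun v => ‖bumpKernel v‖ * b)
      (fun w => Continuous.aestronglyMeasurable (by fun_prop)) (fun w => ae_of_all _ fun v => ?_)
      (bumpKernel.integrable.norm.mul_const _) (ae_of_all _ fun v => by fun_prop)
    rw [norm_mul]
    gcongr
    exact hb _
  have hout : Continuous fun r : ℝ =>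
      ∫ w, (∫ v, bumpKernel v * f (x - t • w - (t * r) • v)) ∂σ := by
    refine continuous_of_dominated (bound := fun _ => ∫ v : 𝔼, ‖bumpKernel v‖ * b)
      (fun r => (hw r).aestronglyMeasurable) (fun r => ae_of_all _ fun w => ?_)
      (integrable_const _) (ae_of_all _ fun w => hin w)
    refine norm_integral_le_of_norm_le (bumpKernel.integrable.norm.mul_const _)
      (ae_of_all _ fun v => ?_)
    rw [norm_mul]
    gcongr
    exact hb _
  have h0 : ∫ w, (∫ v, bumpKernel v * f (x - t • w - (t * 0) • v)) ∂σ = ∫ y, f (x - t • y) ∂σ := by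
    refine integral_congr_ae (ae_of_all _ fun w => ?_)
    simp only [mul_zero, zero_smul, sub_zero]
    rw [integral_mul_const, integral_bumpKernel, one_mul]
  rw [← h0]
  refine ((hout.tendsto 0).comp hlim).congr fun j => ?_
  exact (avgOp_smoothed_eq hf hb (hs j) t x).symm

lemma integrable_mul_comp_sub (K : 𝓢(𝔼, ℂ)) {f : 𝔼 → ℂ} (hf : Continuous f) {b : ℝ}
    (hb : ∀ x, ‖f x‖ ≤ b) (t : ℝ) (x : 𝔼) : Integrable fun y => K y * f (x - t • y) := by
  refine K.integrable.mul_bdd (c := b)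
    (by fun_prop : Continuous fun y => f (x - t • y)).aestronglyMeasurable
    (ae_of_all _ fun y => hb _)

/-- Telescoping: the smoothings at scales `2^(-j-1)` and `2^(-j)` differ by one dyadic piece, and
the smoothed averages converge to those over `σ`. -/
lemma enorm_integral_comp_sub_le {σ : Measure 𝔼} [IsFiniteMeasure σ] (hσ : CompactlySupported σ)
    {f : 𝔼 → ℂ} (hf : Continuous f) {b : ℝ} (hb : ∀ x, ‖f x‖ ≤ b) (t : ℝ) (x : 𝔼) :
    ‖∫ y, f (x - t • y) ∂σ‖ₑ ≤ ‖avgOp (smoothedSchwartz hσ one_pos) t f x‖ₑ +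
      ∑' j : ℕ, ‖avgOp (dyadicPiece hσ (pow_pos one_half_pos j)) t f x‖ₑ := by
  have hcoe : ∀ {s : ℝ} (hs : 0 < s), ⇑(smoothedSchwartz hσ hs) = smoothed σ s := fun hs =>
    funext fun x => smoothedSchwartz_apply hσ hs x
  have hstep : ∀ j : ℕ, avgOp (smoothed σ ((1 / 2) ^ (j + 1))) t f x =
      avgOp (smoothed σ ((1 / 2) ^ j)) t f x +
        avgOp (dyadicPiece hσ (pow_pos one_half_pos j)) t f x := by
    intro j
    have hs : (0 : ℝ) < (1 / 2) ^ j := pow_pos one_half_pos j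
    have e : ((1 : ℝ) / 2) ^ (j + 1) = (1 / 2) ^ j / 2 := by rw [pow_succ]; ring
    rw [e, ← hcoe hs, ← hcoe (half_pos hs), avgOp, avgOp, avgOp, dyadicPiece,
      ← integral_add (integrable_mul_comp_sub _ hf hb t x) (integrable_mul_comp_sub _ hf hb t x)]
    refine integral_congr_ae (ae_of_all _ fun y => ?_)
    simp only [sub_apply]
    ring
  have hsum : ∀ J : ℕ, avgOp (smoothed σ ((1 / 2) ^ J)) t f x =
      avgOp (smoothed σ 1) t f x +
        ∑ j ∈ Finset.range J, avgOp (dyadicPiece hσ (pow_pos one_half_pos j)) t f x := by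
    intro J
    induction J with
    | zero => simp
    | succ J ih => rw [hstep, ih, Finset.sum_range_succ, add_assoc]
  refine le_of_tendsto' (tendsto_avgOp_smoothed (σ := σ) hf hb t x (s := fun j => (1 / 2) ^ j)
    (fun j => pow_pos one_half_pos j)
    (tendsto_pow_atTop_nhds_zero_of_lt_one (by norm_num) (by norm_num))).enorm fun J => ?_
  rw [hsum, hcoe]
  refine (enorm_add_le _ _).trans ?_
  gcongr
  exact (enorm_sum_le _ _).trans (ENNReal.sum_le_tsum _)

lemma measurable_iSup_avgOp (K : 𝓢(𝔼, ℂ)) {f : 𝔼 → ℂ} (hf : Continuous f) {b : ℝ}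
    (hb : ∀ x, ‖f x‖ ≤ b) : Measurable fun x => ⨆ (t : ℝ) (_ : 0 < t), ‖avgOp K t f x‖ₑ := by
  have hc := continuous_avgOp K hf hb
  refine (lowerSemicontinuous_iSup fun t => lowerSemicontinuous_iSup fun _ => ?_).measurable
  exact (hc.comp (by fun_prop : Continuous fun x : 𝔼 => (t, x))).enorm.lowerSemicontinuous

lemma maximalAverage_le {σ : Measure 𝔼} [IsFiniteMeasure σ] (hσ : CompactlySupported σ)
    {f : 𝔼 → ℂ} (hf : Continuous f) {b : ℝ} (hb : ∀ x, ‖f x‖ ≤ b) (x : 𝔼) :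
    maximalAverage σ f x ≤
      (⨆ (t : ℝ) (_ : 0 < t), ‖avgOp (smoothedSchwartz hσ one_pos) t f x‖ₑ) +
      ∑' j : ℕ, ⨆ (t : ℝ) (_ : 0 < t),
        ‖avgOp (dyadicPiece hσ (pow_pos one_half_pos j)) t f x‖ₑ := by
  refine iSup₂_le fun t ht => (enorm_integral_comp_sub_le hσ hf hb t x).trans ?_
  gcongr with j
  · exact le_iSup₂ (f := fun (t : ℝ) (_ : 0 < t) =>
      ‖avgOp (smoothedSchwartz hσ one_pos) t f x‖ₑ) t ht
  · exact le_iSup₂ (f := fun (t : ℝ) (_ : 0 < t) =>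
      ‖avgOp (dyadicPiece hσ (pow_pos one_half_pos j)) t f x‖ₑ) t ht

/-- The radii `A 2^(-jε)` of the dyadic pieces form a convergent series. Index zero of `lam` is
reserved for the low-frequency piece. -/
lemma exists_modular_maximalAverage_le {σ : Measure 𝔼} [IsFiniteMeasure σ]
    (hσ : CompactlySupported σ) {p : 𝔼 → ℝ} (hp : Measurable p) (hp1 : ∀ x, 1 ≤ p x) {A ε : ℝ}
    (hA : 0 < A) (hε : 0 < ε) (hlow : MaximalBound (smoothedSchwartz hσ one_pos) p A)
    (hpiece : ∀ s (hs : 0 < s), s ≤ 1 → MaximalBound (dyadicPiece hσ hs) p (A * s ^ ε)) :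
    ∃ D : ℝ≥0, 0 < D ∧ ∀ f : 𝔼 → ℝ, Continuous f → HasCompactSupport f → (∀ x, 0 ≤ f x) →
      ∫⁻ x, ENNReal.ofReal (f x) ^ p x ≤ 1 →
        ∫⁻ x, (maximalAverage σ (fun y => (f y : ℂ)) x / D) ^ p x ≤ 1 := by
  set lam : ℕ → ℝ≥0∞ := fun j => Nat.casesOn j (ENNReal.ofReal A)
    fun j => ENNReal.ofReal (A * ((1 / 2) ^ j) ^ ε) with hlam
  have hlam0 : ∀ j, lam j ≠ 0 := by
    rintro (_ | j)
    · simpa [hlam] using hA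
    · have : 0 < A * ((1 / 2 : ℝ) ^ j) ^ ε := by positivity
      simpa [hlam] using this
  have hlamt : ∑' j, lam j ≠ ∞ := by
    have hr : ∀ j : ℕ, ((1 / 2 : ℝ) ^ j) ^ ε = ((1 / 2 : ℝ) ^ ε) ^ j := fun j => by
      rw [← Real.rpow_natCast, ← Real.rpow_natCast, ← Real.rpow_mul (by norm_num),
        ← Real.rpow_mul (by norm_num), mul_comm]
    have hs : Summable fun j : ℕ => A * ((1 / 2 : ℝ) ^ j) ^ ε := by
      simp only [hr]
      exact (summable_geometric_of_lt_one (by positivity)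
        (Real.rpow_lt_one (by norm_num) (by norm_num) hε)).mul_left _
    rw [tsum_eq_zero_add' ENNReal.summable]
    refine ENNReal.add_ne_top.2 ⟨ENNReal.ofReal_ne_top, ?_⟩
    exact hs.tsum_ofReal_ne_top
  refine ⟨(∑' j, lam j).toNNReal, ENNReal.toNNReal_pos (fun hc =>
    hlam0 0 (ENNReal.tsum_eq_zero.1 hc 0)) hlamt, fun f hf hs hf0 hfm => ?_⟩
  rw [ENNReal.coe_toNNReal hlamt]
  obtain ⟨b, hb⟩ := hf.bounded_above_of_compact_support hs
  have hb' : ∀ x, ‖((f x : ℝ) : ℂ)‖ ≤ b := fun x => by rw [Complex.norm_real]; exact hb x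
  have hfc : Continuous fun y => (f y : ℂ) := Complex.continuous_ofReal.comp hf
  set a : ℕ → 𝔼 → ℝ≥0∞ := fun j x => Nat.casesOn j
    (⨆ (t : ℝ) (_ : 0 < t), ‖avgOp (smoothedSchwartz hσ one_pos) t (fun y => (f y : ℂ)) x‖ₑ)
    fun j => ⨆ (t : ℝ) (_ : 0 < t),
      ‖avgOp (dyadicPiece hσ (pow_pos one_half_pos j)) t (fun y => (f y : ℂ)) x‖ₑ with ha
  have ham : ∀ j, Measurable (a j) := by
    rintro (_ | j)
    · exact measurable_iSup_avgOp _ hfc hb'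
    · exact measurable_iSup_avgOp _ hfc hb'
  refine le_trans (lintegral_mono fun x => ENNReal.rpow_le_rpow (ENNReal.div_le_div_right ?_ _)
    (zero_le_one.trans (hp1 x))) (lintegral_tsum_div_rpow_le hp hp1 ham hlam0 hlamt ?_)
  · rw [tsum_eq_zero_add' ENNReal.summable]
    exact maximalAverage_le hσ hfc hb' x
  · rintro (_ | j)
    · exact hlow f hf hs hf0 hfm
    · exact hpiece _ (pow_pos one_half_pos j) (pow_le_one₀ (by norm_num) (by norm_num))
        f hf hs hf0 hfm

/-! ### Extension to measurable functions -/

/-- The maximal operator on nonnegative functions. -/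
noncomputable def positiveMax (σ : Measure 𝔼) (g : 𝔼 → ℝ≥0∞) (x : 𝔼) : ℝ≥0∞ :=
  ⨆ (t : ℝ) (_ : 0 < t), ∫⁻ y, g (x - t • y) ∂σ

lemma positiveMax_mono (σ : Measure 𝔼) {g h : 𝔼 → ℝ≥0∞} (hgh : ∀ x, g x ≤ h x) (x : 𝔼) :
    positiveMax σ g x ≤ positiveMax σ h x := by
  unfold positiveMax
  gcongr with t ht y
  exact hgh _

/-- For nonnegative functions the absolute value can be dropped. From here on the signed pieces are
gone and monotonicity is available. -/
lemma positiveMax_ofReal {σ : Measure 𝔼} [IsFiniteMeasure σ] {f : 𝔼 → ℝ} (hf : Continuous f)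
    {b : ℝ} (hb : ∀ x, ‖f x‖ ≤ b) (hf0 : ∀ x, 0 ≤ f x) (x : 𝔼) :
    positiveMax σ (fun y => ENNReal.ofReal (f y)) x = maximalAverage σ (fun y => (f y : ℂ)) x := by
  unfold positiveMax maximalAverage
  congr 1 with t
  congr 1 with _
  have hc : Continuous fun y => f (x - t • y) := by fun_prop
  have hi : Integrable (fun y => f (x - t • y)) σ :=
    (integrable_const b).mono' hc.aestronglyMeasurable (ae_of_all _ fun y => hb _)
  rw [← ofReal_integral_eq_lintegral_ofReal hi (ae_of_all _ fun y => hf0 _), integral_complex_ofReal,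
    ← ofReal_norm, Complex.norm_real, Real.norm_of_nonneg (integral_nonneg fun y => hf0 _)]

/-- The Moreau–Yosida regularizations of a function. -/
noncomputable def infConvolution (G : 𝔼 → ℝ≥0∞) (k : ℕ) (x : 𝔼) : ℝ≥0∞ :=
  ⨅ y, (min (G y) k + k * edist x y)

lemma infConvolution_le (G : 𝔼 → ℝ≥0∞) (k : ℕ) (x : 𝔼) : infConvolution G k x ≤ min (G x) k :=
  (iInf_le _ x).trans (by simp)

lemma infConvolution_ne_top (G : 𝔼 → ℝ≥0∞) (k : ℕ) (x : 𝔼) : infConvolution G k x ≠ ∞ :=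
  (((infConvolution_le G k x).trans (min_le_right _ _)).trans_lt (ENNReal.natCast_lt_top k)).ne

lemma infConvolution_mono (G : 𝔼 → ℝ≥0∞) (x : 𝔼) : Monotone fun k => infConvolution G k x := by
  intro k l hkl
  dsimp only [infConvolution]
  gcongr

/-- An infimum of `k`-Lipschitz functions; truncation at height `k` keeps it finite. -/
lemma continuous_infConvolution (G : 𝔼 → ℝ≥0∞) (k : ℕ) :
    Continuous fun x => (infConvolution G k x).toReal := by
  refine (LipschitzWith.of_le_add_mul (k : ℝ≥0) fun x y => ?_).continuous
  have h : infConvolution G k x ≤ infConvolution G k y + k * edist x y := by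
    unfold infConvolution
    rw [ENNReal.iInf_add]
    refine le_iInf fun z => (iInf_le _ z).trans ?_
    rw [add_assoc, ← mul_add]
    gcongr
    rw [add_comm]
    exact edist_triangle _ _ _
  have h2 : (k : ℝ≥0∞) * edist x y ≠ ∞ := ENNReal.mul_ne_top (ENNReal.natCast_ne_top k)
    (edist_ne_top x y)
  have h3 := ENNReal.toReal_mono (ENNReal.add_ne_top.2 ⟨infConvolution_ne_top G k y, h2⟩) h
  rw [ENNReal.toReal_add (infConvolution_ne_top G k y) h2, ENNReal.toReal_mul,
    ENNReal.toReal_natCast, ← dist_edist] at h3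
  simpa using h3

/-- Near `x` the function exceeds `a` by lower semicontinuity, and outside a ball of radius `r` the
penalty `k r` exceeds `a` for large `k`. -/
lemma LowerSemicontinuous.exists_le_infConvolution {G : 𝔼 → ℝ≥0∞} (hG : LowerSemicontinuous G)
    {x : 𝔼} {a : ℝ≥0∞} (ha : a < G x) : ∃ K : ℕ, ∀ k ≥ K, a ≤ infConvolution G k x := by
  obtain ⟨r, hr, hball⟩ := Metric.eventually_nhds_iff_ball.1 (hG x a ha)
  have hat : a ≠ ∞ := ha.ne_top
  obtain ⟨K, hK⟩ := exists_nat_ge (max a.toReal (a.toReal / r))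
  refine ⟨K, fun k hk => le_iInf fun y => ?_⟩
  have hkK : (K : ℝ) ≤ k := by exact_mod_cast hk
  have h1 : a.toReal ≤ k := (le_max_left _ _).trans (hK.trans hkK)
  have h2 : a.toReal ≤ k * r := (div_le_iff₀ hr).1 ((le_max_right _ _).trans (hK.trans hkK))
  by_cases hy : y ∈ ball x r
  · refine le_trans (le_min (hball y hy).le ?_) le_self_add
    rw [← ENNReal.ofReal_toReal hat, ← ENNReal.ofReal_natCast]
    exact ENNReal.ofReal_le_ofReal h1
  · refine le_trans ?_ le_add_self
    rw [mem_ball, not_lt, dist_comm] at hy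
    rw [← ENNReal.ofReal_toReal hat, ← ENNReal.ofReal_natCast, edist_dist,
      ← ENNReal.ofReal_mul (by positivity)]
    exact ENNReal.ofReal_le_ofReal (h2.trans (by gcongr))

/-- A continuous cutoff to the ball of radius `k`. -/
noncomputable def ballCutoff (k : ℕ) (x : 𝔼) : ℝ := max 0 (min 1 (k - ‖x‖))

lemma ballCutoff_nonneg (k : ℕ) (x : 𝔼) : 0 ≤ ballCutoff k x := le_max_left _ _

lemma ballCutoff_le_one (k : ℕ) (x : 𝔼) : ballCutoff k x ≤ 1 :=
  max_le zero_le_one (min_le_left _ _)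

lemma continuous_ballCutoff (k : ℕ) : Continuous (ballCutoff (n := n) k) := by
  unfold ballCutoff; fun_prop

lemma ballCutoff_mono (x : 𝔼) : Monotone fun k => ballCutoff k x := by
  intro k l hkl
  dsimp only [ballCutoff]
  gcongr

lemma hasCompactSupport_ballCutoff (k : ℕ) : HasCompactSupport (ballCutoff (n := n) k) := by
  refine HasCompactSupport.intro (isCompact_closedBall (0 : 𝔼) k) fun x hx => ?_
  rw [mem_closedBall, dist_zero_right, not_le] at hx
  exact max_eq_left ((min_le_right _ _).trans (by linarith))

lemma ballCutoff_eq_one {k : ℕ} {x : 𝔼} (h : ‖x‖ + 1 ≤ k) : ballCutoff k x = 1 := by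
  rw [ballCutoff, min_eq_left (by linarith), max_eq_right zero_le_one]

/-- Nonnegative lower semicontinuous functions are increasing limits of continuous functions with
compact support. -/
lemma LowerSemicontinuous.exists_seq_continuous {G : 𝔼 → ℝ≥0∞} (hG : LowerSemicontinuous G) :
    ∃ f : ℕ → 𝔼 → ℝ, (∀ k, Continuous (f k)) ∧ (∀ k, HasCompactSupport (f k)) ∧
      (∀ k x, 0 ≤ f k x) ∧ (Monotone fun k x => ENNReal.ofReal (f k x)) ∧
      ∀ x, ⨆ k, ENNReal.ofReal (f k x) = G x := by
  have hle : ∀ k x, ENNReal.ofReal ((infConvolution G k x).toReal * ballCutoff k x) ≤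
      infConvolution G k x := fun k x => by
    refine (ENNReal.ofReal_le_ofReal (mul_le_of_le_one_right ENNReal.toReal_nonneg
      (ballCutoff_le_one k x))).trans ENNReal.ofReal_toReal_le
  refine ⟨fun k x => (infConvolution G k x).toReal * ballCutoff k x,
    fun k => (continuous_infConvolution G k).mul (continuous_ballCutoff k),
    fun k => (hasCompactSupport_ballCutoff k).mul_left,
    fun k x => mul_nonneg ENNReal.toReal_nonneg (ballCutoff_nonneg k x), ?_, fun x => ?_⟩
  · intro k l hkl x
    refine ENNReal.ofReal_le_ofReal (mul_le_mul ?_ (ballCutoff_mono x hkl) (ballCutoff_nonneg k x)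
      ENNReal.toReal_nonneg)
    exact ENNReal.toReal_mono (infConvolution_ne_top G l x) (infConvolution_mono G x hkl)
  · refine le_antisymm (iSup_le fun k => (hle k x).trans
      ((infConvolution_le G k x).trans (min_le_left _ _))) (le_of_forall_lt_imp_le_of_dense
      fun a ha => ?_)
    obtain ⟨K, hK⟩ := LowerSemicontinuous.exists_le_infConvolution hG ha
    obtain ⟨m, hm⟩ := exists_nat_ge (‖x‖ + 1)
    refine le_trans (hK (max K m) (le_max_left _ _)) (le_iSup_of_le (max K m) ?_)
    dsimp only
    rw [ballCutoff_eq_one, mul_one, ENNReal.ofReal_toReal (infConvolution_ne_top G _ x)]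
    exact hm.trans (by exact_mod_cast le_max_right _ _)

lemma measurable_maximalAverage_of_continuous {σ : Measure 𝔼} [IsFiniteMeasure σ] {f : 𝔼 → ℂ}
    (hf : Continuous f) {b : ℝ} (hb : ∀ x, ‖f x‖ ≤ b) : Measurable (maximalAverage σ f) := by
  unfold maximalAverage
  refine (lowerSemicontinuous_iSup fun t => lowerSemicontinuous_iSup fun _ => ?_).measurable
  refine (Continuous.enorm ?_).lowerSemicontinuous
  exact continuous_of_dominated (bound := fun _ => b)
    (fun x => Continuous.aestronglyMeasurable (by fun_prop)) (fun x => ae_of_all _ fun y => hb _)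
    (integrable_const _) (ae_of_all _ fun y => by fun_prop)

/-- Monotone convergence under the integral, and interchange of suprema. -/
lemma positiveMax_iSup {σ : Measure 𝔼} {g : ℕ → 𝔼 → ℝ≥0∞} (hg : ∀ k, Measurable (g k))
    (hmono : Monotone g) (x : 𝔼) :
    positiveMax σ (fun y => ⨆ k, g k y) x = ⨆ k, positiveMax σ (g k) x := by
  unfold positiveMax
  have h : ∀ t : ℝ, ∫⁻ y, ⨆ k, g k (x - t • y) ∂σ = ⨆ k, ∫⁻ y, g k (x - t • y) ∂σ := fun t =>
    lintegral_iSup (fun k => (hg k).comp (by fun_prop)) fun k l hkl y => hmono hkl _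
  simp only [h]
  rw [iSup_comm]
  refine iSup_congr fun t => ?_
  rw [iSup_comm]

/-- The maximal operator maps the unit ball of `L^{p(·)}` into the ball of radius `D`. -/
def PositiveMaxBound (σ : Measure 𝔼) (p : 𝔼 → ℝ) (D : ℝ≥0) : Prop :=
  ∀ g : 𝔼 → ℝ≥0∞, Measurable g → ∫⁻ x, g x ^ p x ≤ 1 →
    ∃ H : 𝔼 → ℝ≥0∞, Measurable H ∧ (∀ x, positiveMax σ g x ≤ H x) ∧ ∫⁻ x, (H x / D) ^ p x ≤ 1

/-- Both sides are continuous along increasing sequences, so the bound for continuous compactly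
supported functions suffices; the limit is measurable as a countable supremum. -/
lemma lintegral_positiveMax_le_of_lowerSemicontinuous {σ : Measure 𝔼} [IsFiniteMeasure σ]
    {p : 𝔼 → ℝ} (hp : Measurable p) (hp0 : ∀ x, 0 < p x) {D : ℝ≥0}
    (h : ∀ f : 𝔼 → ℝ, Continuous f → HasCompactSupport f → (∀ x, 0 ≤ f x) →
      ∫⁻ x, ENNReal.ofReal (f x) ^ p x ≤ 1 →
        ∫⁻ x, (maximalAverage σ (fun y => (f y : ℂ)) x / D) ^ p x ≤ 1)
    {G : 𝔼 → ℝ≥0∞} (hG : LowerSemicontinuous G) (hGm : ∫⁻ x, G x ^ p x ≤ 1) :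
    Measurable (positiveMax σ G) ∧ ∫⁻ x, (positiveMax σ G x / D) ^ p x ≤ 1 := by
  obtain ⟨f, hfc, hfs, hf0, hmono, hsup⟩ := LowerSemicontinuous.exists_seq_continuous hG
  have hGsup : G = fun x => ⨆ k, ENNReal.ofReal (f k x) := funext fun x => (hsup x).symm
  choose b hb using fun k => (hfc k).bounded_above_of_compact_support (hfs k)
  have hmax : positiveMax σ G = fun x => ⨆ k, maximalAverage σ (fun y => (f k y : ℂ)) x := by
    ext x
    rw [hGsup, positiveMax_iSup (fun k => (hfc k).measurable.ennreal_ofReal) hmono]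
    exact iSup_congr fun k => positiveMax_ofReal (hfc k) (hb k) (hf0 k) x
  have hmeas : ∀ k, Measurable (maximalAverage σ fun y => (f k y : ℂ)) := fun k =>
    measurable_maximalAverage_of_continuous (Complex.continuous_ofReal.comp (hfc k)) (b := b k)
      fun x => by rw [Complex.norm_real]; exact hb k x
  have hmonoM : ∀ x, Monotone fun k => maximalAverage σ (fun y => (f k y : ℂ)) x := by
    intro x k l hkl
    simp only [← positiveMax_ofReal (hfc _) (hb _) (hf0 _) x]
    exact positiveMax_mono σ (hmono hkl) x
  rw [hmax]
  refine ⟨Measurable.iSup hmeas, ?_⟩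
  have heq : ∀ x, ((⨆ k, maximalAverage σ (fun y => (f k y : ℂ)) x) / D) ^ p x =
      ⨆ k, (maximalAverage σ (fun y => (f k y : ℂ)) x / D) ^ p x := fun x => by
    rw [ENNReal.iSup_div]
    exact (ENNReal.orderIsoRpow (p x) (hp0 x)).map_iSup _
  rw [lintegral_congr heq, lintegral_iSup (fun k => ((hmeas k).div_const _).pow hp)
    fun k l hkl x => ENNReal.rpow_le_rpow (ENNReal.div_le_div_right (hmonoM x hkl) _) (hp0 x).le]
  refine iSup_le fun k => h (f k) (hfc k) (hfs k) (hf0 k) (le_trans (lintegral_mono fun x => ?_) hGm)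
  refine ENNReal.rpow_le_rpow ?_ (hp0 x).le
  rw [← hsup x]
  exact le_iSup (fun k => ENNReal.ofReal (f k x)) k

/-- The condition `a < H^(1/p)` means `a^p < H`. Its left side is continuous in the point because
`p` is, and its right side is lower semicontinuous. -/
lemma lowerSemicontinuous_rpow_inv {p : 𝔼 → ℝ} (hp : Continuous p) (hp0 : ∀ x, 0 < p x)
    {H : 𝔼 → ℝ≥0∞} (hH : LowerSemicontinuous H) :
    LowerSemicontinuous fun x => H x ^ (p x)⁻¹ := by
  intro x a (ha : a < H x ^ (p x)⁻¹)
  have hat : a ≠ ∞ := ha.ne_top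
  rw [ENNReal.lt_rpow_inv_iff (hp0 x)] at ha
  obtain ⟨c, hc, hc'⟩ := exists_between ha
  have hcont : Tendsto (fun y => a ^ p y) (𝓝 x) (𝓝 (a ^ p x)) := by
    rcases eq_or_ne a 0 with rfl | ha0
    · simp only [ENNReal.zero_rpow_of_pos (hp0 _)]
      exact tendsto_const_nhds
    · have h1 : ∀ y, a ^ p y = ENNReal.ofReal (a.toReal ^ p y) := fun y => by
        rw [← ENNReal.ofReal_rpow_of_pos (ENNReal.toReal_pos ha0 hat), ENNReal.ofReal_toReal hat]
      simp only [h1]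
      exact ENNReal.tendsto_ofReal (((Real.continuous_const_rpow
        (ENNReal.toReal_pos ha0 hat).ne').tendsto _).comp (hp.tendsto x))
  filter_upwards [hcont.eventually (gt_mem_nhds hc), hH x c hc'] with y hy hy'
  refine (ENNReal.lt_rpow_inv_iff (hp0 y)).2 ?_
  exact lt_trans hy hy'

/-- By Vitali–Carathéodory, `g^p` lies below a lower semicontinuous `H` of integral at most two.
Then `G = H^(1/p) / 2` has modular at most one, since `2^(-p) ≤ 1/2`, and `g ≤ 2G`, which doubles
the constant. The majorant `2 positiveMax σ G` is measurable, which is not known of `positiveMax σ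
g`. -/
lemma positiveMaxBound_of_continuous {σ : Measure 𝔼} [IsFiniteMeasure σ] {p : 𝔼 → ℝ}
    (hp : Continuous p) (hp1 : ∀ x, 1 ≤ p x) {D : ℝ≥0}
    (h : ∀ f : 𝔼 → ℝ, Continuous f → HasCompactSupport f → (∀ x, 0 ≤ f x) →
      ∫⁻ x, ENNReal.ofReal (f x) ^ p x ≤ 1 →
        ∫⁻ x, (maximalAverage σ (fun y => (f y : ℂ)) x / D) ^ p x ≤ 1) :
    PositiveMaxBound σ p (2 * D) := by
  intro g hg hgm
  have hp0 : ∀ x, 0 < p x := fun x => zero_lt_one.trans_le (hp1 x)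
  obtain ⟨H, hgH, hH, hHm⟩ := exists_le_lowerSemicontinuous_lintegral_ge (μ := volume)
    (fun x => g x ^ p x) (hg.pow hp.measurable) one_ne_zero
  have hu := lowerSemicontinuous_rpow_inv hp hp0 hH
  set G : 𝔼 → ℝ≥0∞ := fun x => 2⁻¹ * H x ^ (p x)⁻¹ with hGdef
  have hG : LowerSemicontinuous G := by
    have hc : Continuous fun a : ℝ≥0∞ => 2⁻¹ * a := ENNReal.continuous_const_mul (by simp)
    exact hc.comp_lowerSemicontinuous hu fun a b hab => mul_le_mul_right hab _
  have hGm : ∫⁻ x, G x ^ p x ≤ 1 := by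
    calc ∫⁻ x, G x ^ p x ≤ ∫⁻ x, 2⁻¹ * H x := by
          refine lintegral_mono fun x => ?_
          rw [hGdef, ENNReal.mul_rpow_of_nonneg _ _ (hp0 x).le, ENNReal.rpow_inv_rpow (hp0 x).ne']
          gcongr
          exact ENNReal.rpow_le_self_of_le_one (by simp) (hp1 x)
      _ = 2⁻¹ * ∫⁻ x, H x := lintegral_const_mul' _ _ (by simp)
      _ ≤ 2⁻¹ * 2 := by
          gcongr
          refine hHm.trans ?_
          calc _ ≤ (1 : ℝ≥0∞) + 1 := by gcongr
            _ = 2 := one_add_one_eq_two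
      _ = 1 := ENNReal.inv_mul_cancel (by simp) (by simp)
  obtain ⟨hm, hb⟩ := lintegral_positiveMax_le_of_lowerSemicontinuous hp.measurable hp0 h hG hGm
  refine ⟨fun x => 2 * positiveMax σ G x, hm.const_mul 2, fun x => ?_, ?_⟩
  · have hgG : ∀ y, g y ≤ 2 * G y := fun y => by
      rw [hGdef, ← mul_assoc, ENNReal.mul_inv_cancel (by simp) (by simp), one_mul,
        ENNReal.le_rpow_inv_iff (hp0 y)]
      exact hgH y
    refine (positiveMax_mono σ hgG x).trans (le_of_eq ?_)
    unfold positiveMax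
    simp only [ENNReal.mul_iSup]
    refine iSup_congr fun t => iSup_congr fun _ => ?_
    exact lintegral_const_mul' _ _ (by simp)
  · refine le_trans (le_of_eq (lintegral_congr fun x => ?_)) hb
    rw [ENNReal.coe_mul, ENNReal.coe_ofNat, ENNReal.mul_div_mul_left _ _ (by simp) (by simp)]

/-! ### Approximation by continuous functions -/

lemma mul_rpow_le_of_one_le {c a : ℝ≥0∞} (hc : 1 ≤ c) {p u : ℝ} (hp : 0 ≤ p) (hpu : p ≤ u) :
    (c * a) ^ p ≤ c ^ u * a ^ p := by
  rw [ENNReal.mul_rpow_of_nonneg _ _ hp]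
  gcongr

/-- Functions which can be approximated by bounded continuous functions in the sense of the modular
of `L^{p(·)}`. -/
def ModularApproximable (p : 𝔼 → ℝ) (f : 𝔼 → ℂ) : Prop :=
  ∀ η : ℝ≥0∞, η ≠ 0 → ∃ φ : 𝔼 → ℂ, Continuous φ ∧ (∃ b : ℝ, ∀ x, ‖φ x‖ ≤ b) ∧
    ∫⁻ x, ‖f x - φ x‖ₑ ^ p x ≤ η

lemma abs_rpow_sub_rpow_le {a b s : ℝ} (ha : 0 ≤ a) (hb : 0 ≤ b) (hs0 : 0 ≤ s) (hs1 : s ≤ 1) :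
    |a ^ s - b ^ s| ≤ |a - b| ^ s := by
  wlog h : b ≤ a generalizing a b
  · rw [abs_sub_comm, abs_sub_comm a]
    exact this hb ha (le_of_not_ge h)
  · rw [abs_of_nonneg (sub_nonneg.2 h),
      abs_of_nonneg (sub_nonneg.2 (Real.rpow_le_rpow hb h hs0)), sub_le_iff_le_add]
    have := Real.rpow_add_le_add_rpow (sub_nonneg.2 h) hb hs0 hs1
    rwa [sub_add_cancel] at this

/-- Since `g^p` is integrable it has a continuous `L¹` approximation `Φ`. The function `φ = max(Φ,
0)^(1/p)` works because `|a^s - b^s| ≤ |a - b|^s` for `s = 1/p ≤ 1` gives `|g - φ|^p ≤ |g^p - Φ|`.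
-/
lemma modularApproximable_ofReal {p : 𝔼 → ℝ} (hp : Continuous p) (hp1 : ∀ x, 1 ≤ p x) {g : 𝔼 → ℝ}
    (hg : Measurable g) (hg0 : ∀ x, 0 ≤ g x) (hgm : ∫⁻ x, ENNReal.ofReal (g x) ^ p x < ∞) :
    ModularApproximable p fun x => (g x : ℂ) := by
  intro η hη
  have hp0 : ∀ x, 0 < p x := fun x => zero_lt_one.trans_le (hp1 x)
  have hF : Integrable fun x => g x ^ p x := by
    refine ⟨(hg.pow hp.measurable).aestronglyMeasurable, ?_⟩
    refine lt_of_le_of_lt (le_of_eq (lintegral_congr fun x => ?_)) hgm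
    rw [← ofReal_norm, Real.norm_of_nonneg (Real.rpow_nonneg (hg0 x) _),
      ENNReal.ofReal_rpow_of_nonneg (hg0 x) (hp0 x).le]
  obtain ⟨Φ, hΦs, hΦ, hΦc, -⟩ := hF.exists_hasCompactSupport_lintegral_sub_le hη
  have hc : Continuous fun x => max (Φ x) 0 ^ (p x)⁻¹ :=
    (hΦc.max continuous_const).rpow (hp.inv₀ fun x => (hp0 x).ne')
      fun x => Or.inr (inv_pos.2 (hp0 x))
  have hs : HasCompactSupport fun x => max (Φ x) 0 ^ (p x)⁻¹ := by
    refine hΦs.mono fun x hx => ?_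
    rw [Function.mem_support] at hx ⊢
    contrapose! hx
    rw [hx, max_self, Real.zero_rpow (inv_ne_zero (hp0 x).ne')]
  obtain ⟨b, hb⟩ := hc.bounded_above_of_compact_support hs
  refine ⟨fun x => ((max (Φ x) 0 ^ (p x)⁻¹ : ℝ) : ℂ), Complex.continuous_ofReal.comp hc,
    ⟨b, fun x => by rw [Complex.norm_real]; exact hb x⟩, le_trans (lintegral_mono fun x => ?_) hΦ⟩
  have hgx : g x = (g x ^ p x) ^ (p x)⁻¹ := (Real.rpow_rpow_inv (hg0 x) (hp0 x).ne').symm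
  have key : |g x - max (Φ x) 0 ^ (p x)⁻¹| ≤ |g x ^ p x - Φ x| ^ (p x)⁻¹ := by
    have h1 : 0 ≤ g x ^ p x := Real.rpow_nonneg (hg0 x) _
    calc |g x - max (Φ x) 0 ^ (p x)⁻¹|
        = |(g x ^ p x) ^ (p x)⁻¹ - max (Φ x) 0 ^ (p x)⁻¹| := by rw [← hgx]
      _ ≤ |g x ^ p x - max (Φ x) 0| ^ (p x)⁻¹ := abs_rpow_sub_rpow_le h1 (le_max_right _ _)
          (inv_nonneg.2 (hp0 x).le) (inv_le_one_of_one_le₀ (hp1 x))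
      _ ≤ |g x ^ p x - Φ x| ^ (p x)⁻¹ := by
          refine Real.rpow_le_rpow (abs_nonneg _) ?_ (inv_nonneg.2 (hp0 x).le)
          have := abs_max_sub_max_le_abs (g x ^ p x) (Φ x) 0
          rwa [max_eq_left h1] at this
  rw [← Complex.ofReal_sub, ← ofReal_norm, ← ofReal_norm, Complex.norm_real, Real.norm_eq_abs,
    Real.norm_eq_abs, ENNReal.ofReal_rpow_of_nonneg (abs_nonneg _) (hp0 x).le]
  refine ENNReal.ofReal_le_ofReal ?_
  calc _ ≤ (|g x ^ p x - Φ x| ^ (p x)⁻¹) ^ p x :=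
        Real.rpow_le_rpow (abs_nonneg _) key (hp0 x).le
    _ = _ := Real.rpow_inv_rpow (abs_nonneg _) (hp0 x).ne'

lemma ModularApproximable.const_mul {p : 𝔼 → ℝ} {f : 𝔼 → ℂ} (hf : ModularApproximable p f) {c : ℂ}
    (hc : ‖c‖ = 1) : ModularApproximable p fun x => c * f x := by
  intro η hη
  obtain ⟨φ, hφ, ⟨b, hb⟩, hm⟩ := hf η hη
  refine ⟨fun x => c * φ x, hφ.const_mul c, ⟨b, fun x => by rw [norm_mul, hc, one_mul]; exact hb x⟩,
    le_trans (le_of_eq (lintegral_congr fun x => ?_)) hm⟩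
  rw [← mul_sub, enorm_mul, ← ofReal_norm c, hc, ENNReal.ofReal_one, one_mul]

lemma ModularApproximable.add {p : 𝔼 → ℝ} (hp : Measurable p) (hp0 : ∀ x, 0 ≤ p x) {u : ℝ}
    (hu : ∀ x, p x ≤ u) {f g : 𝔼 → ℂ} (hfm : Measurable f)
    (hf : ModularApproximable p f) (hg : ModularApproximable p g) :
    ModularApproximable p fun x => f x + g x := by
  intro η hη
  have hu0 : 0 ≤ u := (hp0 0).trans (hu 0)
  have h2u0 : (2 : ℝ≥0∞) ^ u ≠ 0 := (ENNReal.rpow_pos (by simp) (by simp)).ne'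
  have h2ut : (2 : ℝ≥0∞) ^ u ≠ ∞ := ENNReal.rpow_ne_top_of_nonneg hu0 (by simp)
  have hη' : η / 2 / 2 ^ u ≠ 0 :=
    ENNReal.div_ne_zero.2 ⟨ENNReal.div_ne_zero.2 ⟨hη, by simp⟩, h2ut⟩
  obtain ⟨φ, hφ, ⟨b, hb⟩, hφm⟩ := hf _ hη'
  obtain ⟨ψ, hψ, ⟨b', hb'⟩, hψm⟩ := hg _ hη'
  refine ⟨fun x => φ x + ψ x, hφ.add hψ,
    ⟨b + b', fun x => (norm_add_le _ _).trans (add_le_add (hb x) (hb' x))⟩, ?_⟩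
  calc ∫⁻ x, ‖f x + g x - (φ x + ψ x)‖ₑ ^ p x
      ≤ ∫⁻ x, 2 ^ u * (‖f x - φ x‖ₑ ^ p x + ‖g x - ψ x‖ₑ ^ p x) := by
        refine lintegral_mono fun x => ?_
        have h1 : ‖f x + g x - (φ x + ψ x)‖ₑ ≤ 2 * max ‖f x - φ x‖ₑ ‖g x - ψ x‖ₑ := by
          rw [add_sub_add_comm, two_mul]
          exact (enorm_add_le _ _).trans (add_le_add (le_max_left _ _) (le_max_right _ _))
        refine (ENNReal.rpow_le_rpow h1 (hp0 x)).trans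
          ((mul_rpow_le_of_one_le one_le_two (hp0 x) (hu x)).trans ?_)
        gcongr
        rcases le_total ‖f x - φ x‖ₑ ‖g x - ψ x‖ₑ with h | h
        · rw [max_eq_right h]; exact le_add_self
        · rw [max_eq_left h]; exact le_self_add
    _ = 2 ^ u * ((∫⁻ x, ‖f x - φ x‖ₑ ^ p x) + ∫⁻ x, ‖g x - ψ x‖ₑ ^ p x) := by
        have hm : Measurable fun x => ‖f x - φ x‖ₑ ^ p x := (hfm.sub hφ.measurable).enorm.pow hp
        rw [lintegral_const_mul' _ _ h2ut, lintegral_add_left hm]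
    _ ≤ 2 ^ u * (η / 2 / 2 ^ u + η / 2 / 2 ^ u) := by gcongr
    _ = η := by
        rw [← ENNReal.add_div, ENNReal.add_halves, ENNReal.mul_div_cancel h2u0 h2ut]

/-- Decomposition into the positive and negative parts of the real and imaginary parts. -/
lemma modularApproximable_of_lintegral_lt_top {p : 𝔼 → ℝ} (hp : Continuous p)
    (hp1 : ∀ x, 1 ≤ p x) {u : ℝ} (hu : ∀ x, p x ≤ u) {f : 𝔼 → ℂ} (hf : Measurable f)
    (hfm : ∫⁻ x, ‖f x‖ₑ ^ p x < ∞) : ModularApproximable p f := by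
  have hp0 : ∀ x, 0 ≤ p x := fun x => zero_le_one.trans (hp1 x)
  have hpart : ∀ g : 𝔼 → ℝ, Measurable g → (∀ x, |g x| ≤ ‖f x‖) →
      ModularApproximable p fun x => ((max (g x) 0 : ℝ) : ℂ) := fun g hg hgf =>
    modularApproximable_ofReal hp hp1 (hg.max measurable_const) (fun x => le_max_right _ _)
      (lt_of_le_of_lt (lintegral_mono fun x => ENNReal.rpow_le_rpow (by
        rw [← ofReal_norm]
        refine ENNReal.ofReal_le_ofReal (max_le ((le_abs_self _).trans (hgf x)) (norm_nonneg _)))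
        (hp0 x)) hfm)
  have hre : Measurable fun x => (f x).re := Complex.measurable_re.comp hf
  have him : Measurable fun x => (f x).im := Complex.measurable_im.comp hf
  have hnre : Measurable fun x => -(f x).re := hre.neg
  have hnim : Measurable fun x => -(f x).im := him.neg
  have h1 := hpart _ hre fun x => Complex.abs_re_le_norm (f x)
  have h2 := (hpart _ hnre fun x => by
    rw [abs_neg]; exact Complex.abs_re_le_norm (f x)).const_mul (c := -1) (by simp)
  have h3 := (hpart _ him fun x => Complex.abs_im_le_norm (f x)).const_mul (c := Complex.I)
    (by simp)
  have h4 := (hpart _ hnim fun x => by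
    rw [abs_neg]; exact Complex.abs_im_le_norm (f x)).const_mul (c := -Complex.I) (by simp)
  have hm : ∀ g : 𝔼 → ℝ, Measurable g → Measurable fun x => ((max (g x) 0 : ℝ) : ℂ) :=
    fun g hg => Complex.measurable_ofReal.comp (hg.max measurable_const)
  have h := ((h1.add hp.measurable hp0 hu (hm _ hre) h2).add hp.measurable hp0 hu
    ((hm _ hre).add ((hm _ hnre).const_mul _)) (h3.add hp.measurable hp0 hu
      ((hm _ him).const_mul _) h4))
  have e : f = fun x => ((max (f x).re 0 : ℝ) : ℂ) + -1 * ((max (-(f x).re) 0 : ℝ) : ℂ) +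
      (Complex.I * ((max (f x).im 0 : ℝ) : ℂ) + -Complex.I * ((max (-(f x).im) 0 : ℝ) : ℂ)) := by
    ext x
    have hmax : ∀ r : ℝ, ((max r 0 : ℝ) : ℂ) = r + ((max (-r) 0 : ℝ) : ℂ) := fun r => by
      rw [← Complex.ofReal_add]
      congr 1
      rcases le_total 0 r with h | h
      · rw [max_eq_left h, max_eq_right (by linarith), add_zero]
      · rw [max_eq_right h, max_eq_left (by linarith), add_neg_cancel]
    rw [hmax (f x).re, hmax (f x).im]
    conv_lhs => rw [← Complex.re_add_im (f x)]
    ring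
  rw [e]
  exact h

/-! ### The maximal operator on `L^{p(·)}` -/

lemma positiveMax_div (σ : Measure 𝔼) (g : 𝔼 → ℝ≥0∞) {lam : ℝ≥0∞} (h : lam ≠ 0) (x : 𝔼) :
    positiveMax σ (fun y => g y / lam) x = positiveMax σ g x / lam := by
  unfold positiveMax
  simp only [ENNReal.iSup_div]
  refine iSup_congr fun t => iSup_congr fun _ => ?_
  simp only [div_eq_mul_inv]
  exact lintegral_mul_const' _ _ (ENNReal.inv_ne_top.2 h)

lemma maximalAverage_le_positiveMax (σ : Measure 𝔼) (f : 𝔼 → ℂ) (x : 𝔼) :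
    maximalAverage σ f x ≤ positiveMax σ (fun y => ‖f y‖ₑ) x := by
  unfold maximalAverage positiveMax
  gcongr
  exact enorm_integral_le_lintegral_enorm _

lemma PositiveMaxBound.exists_majorant {σ : Measure 𝔼} {p : 𝔼 → ℝ} {D : ℝ≥0}
    (h : PositiveMaxBound σ p D) {g : 𝔼 → ℝ≥0∞} (hg : Measurable g) {lam : ℝ≥0∞} (h0 : lam ≠ 0)
    (ht : lam ≠ ∞) (hm : ∫⁻ x, (g x / lam) ^ p x ≤ 1) :
    ∃ H : 𝔼 → ℝ≥0∞, Measurable H ∧ (∀ x, positiveMax σ g x ≤ lam * H x) ∧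
      ∫⁻ x, (H x / D) ^ p x ≤ 1 := by
  obtain ⟨H, hH, hgH, hHm⟩ := h (fun x => g x / lam) (hg.div_const lam) hm
  refine ⟨H, hH, fun x => ?_, hHm⟩
  have := hgH x
  rwa [positiveMax_div σ g h0, ENNReal.div_le_iff h0 ht, mul_comm] at this

lemma ae_lt_top_of_lintegral_div_rpow_le {p : 𝔼 → ℝ} (hp : Measurable p) (hp0 : ∀ x, 0 < p x)
    {H : 𝔼 → ℝ≥0∞} (hH : Measurable H) {D : ℝ≥0} (hm : ∫⁻ x, (H x / D) ^ p x ≤ 1) :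
    ∀ᵐ x, H x < ∞ := by
  filter_upwards [ae_lt_top ((hH.div_const _).pow hp) (hm.trans_lt ENNReal.one_lt_top).ne]
    with x hx
  by_contra hcon
  rw [not_lt, top_le_iff] at hcon
  rw [hcon, ENNReal.top_div_coe, ENNReal.top_rpow_of_pos (hp0 x)] at hx
  exact hx.ne rfl

/-- The averages over dilates of `σ` do not see null sets, for almost every center. -/
lemma PositiveMaxBound.ae_forall_ae_notMem {σ : Measure 𝔼} {p : 𝔼 → ℝ} {D : ℝ≥0}
    (h : PositiveMaxBound σ p D) (hp : Measurable p) (hp0 : ∀ x, 0 < p x) {N : Set 𝔼}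
    (hN : volume N = 0) : ∀ᵐ x, ∀ t : ℝ, 0 < t → ∀ᵐ y ∂σ, x - t • y ∉ N := by
  set M := toMeasurable volume N with hM
  have hMm : MeasurableSet M := measurableSet_toMeasurable _ _
  have hM0 : volume M = 0 := by rw [hM, measure_toMeasurable, hN]
  -- This function has modular zero, yet any average charging `M` would be infinite; the almost
  -- everywhere finite majorant excludes this for all times at once.
  set g : 𝔼 → ℝ≥0∞ := M.indicator fun _ => ∞ with hg
  have hgm : Measurable g := measurable_const.indicator hMm
  have hmod : ∫⁻ x, g x ^ p x ≤ 1 := by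
    rw [lintegral_eq_zero_of_ae_eq_zero ?_]
    · exact zero_le_one
    · filter_upwards [measure_eq_zero_iff_ae_notMem.1 hM0] with x hx
      rw [hg, indicator_of_notMem hx, ENNReal.zero_rpow_of_pos (hp0 x)]
      rfl
  obtain ⟨H, hH, hgH, hHm⟩ := h g hgm hmod
  filter_upwards [ae_lt_top_of_lintegral_div_rpow_le hp hp0 hH hHm] with x hx t ht
  have h1 : ∫⁻ y, g (x - t • y) ∂σ ≠ ∞ := (((le_iSup₂ (f := fun (t : ℝ) (_ : 0 < t) =>
    ∫⁻ y, g (x - t • y) ∂σ) t ht).trans (hgH x)).trans_lt hx).ne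
  filter_upwards [ae_lt_top (hgm.comp (by fun_prop)) h1] with y hy hyN
  have h2 : x - t • y ∈ M := subset_toMeasurable _ _ hyN
  rw [hg, Function.comp_apply, indicator_of_mem h2] at hy
  exact hy.ne rfl

/-- For `p ≥ 1`, enlarging the scale by a factor `c ≥ 1` divides the modular by at least `c`. -/
lemma exists_modular_le_one {p : 𝔼 → ℝ} (hp1 : ∀ x, 1 ≤ p x) {f : 𝔼 → ℂ} {lam : ℝ≥0∞}
    (h0 : 0 < lam) (ht : lam ≠ ∞) (hm : modular p lam f < ∞) :
    ∃ lam' : ℝ≥0∞, 0 < lam' ∧ lam' ≠ ∞ ∧ modular p lam' f ≤ 1 := by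
  set c : ℝ≥0∞ := max (modular p lam f) 1 with hc
  have hc1 : 1 ≤ c := le_max_right _ _
  have hct : c ≠ ∞ := (max_lt hm ENNReal.one_lt_top).ne
  have hc0 : c ≠ 0 := (zero_lt_one.trans_le hc1).ne'
  refine ⟨c * lam, ENNReal.mul_pos hc0 h0.ne', ENNReal.mul_ne_top hct ht, ?_⟩
  calc modular p (c * lam) f ≤ ∫⁻ x, c⁻¹ * (‖f x‖ₑ / lam) ^ p x := by
        refine lintegral_mono fun x => ?_
        have e : ‖f x‖ₑ / (c * lam) = c⁻¹ * (‖f x‖ₑ / lam) := by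
          rw [div_eq_mul_inv, div_eq_mul_inv, ENNReal.mul_inv (Or.inl hc0) (Or.inl hct)]
          ring
        rw [e, ENNReal.mul_rpow_of_nonneg _ _ (zero_le_one.trans (hp1 x))]
        gcongr
        exact ENNReal.rpow_le_self_of_le_one (ENNReal.inv_le_one.2 hc1) (hp1 x)
    _ = c⁻¹ * modular p lam f := lintegral_const_mul' _ _ (ENNReal.inv_ne_top.2 hc0)
    _ ≤ c⁻¹ * c := by gcongr; exact le_max_left _ _
    _ = 1 := ENNReal.inv_mul_cancel hc0 hct

/-- For a bounded exponent, finiteness of the modular at one scale implies finiteness at scale one.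
-/
lemma lintegral_enorm_rpow_lt_top {p : 𝔼 → ℝ} (hp0 : ∀ x, 0 ≤ p x) {u : ℝ} (hu : ∀ x, p x ≤ u)
    {f : 𝔼 → ℂ} {lam : ℝ≥0∞} (h0 : 0 < lam) (ht : lam ≠ ∞) (hm : modular p lam f < ∞) :
    ∫⁻ x, ‖f x‖ₑ ^ p x < ∞ := by
  have hu0 : 0 ≤ u := (hp0 0).trans (hu 0)
  have hct : max lam 1 ^ u ≠ ∞ :=
    ENNReal.rpow_ne_top_of_nonneg hu0 (max_lt ht.lt_top ENNReal.one_lt_top).ne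
  calc ∫⁻ x, ‖f x‖ₑ ^ p x ≤ ∫⁻ x, max lam 1 ^ u * (‖f x‖ₑ / lam) ^ p x := by
        refine lintegral_mono fun x => le_trans (ENNReal.rpow_le_rpow ?_ (hp0 x))
          (mul_rpow_le_of_one_le (le_max_right _ _) (hp0 x) (hu x))
        calc ‖f x‖ₑ = lam * (‖f x‖ₑ / lam) := (ENNReal.mul_div_cancel h0.ne' ht).symm
          _ ≤ _ := by gcongr; exact le_max_left _ _
    _ = max lam 1 ^ u * modular p lam f := lintegral_const_mul' _ _ hct
    _ < ∞ := ENNReal.mul_lt_top hct.lt_top hm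

lemma PositiveMaxBound.ae_integrable {σ : Measure 𝔼} {p : 𝔼 → ℝ} {D : ℝ≥0}
    (h : PositiveMaxBound σ p D) (hp : Measurable p) (hp1 : ∀ x, 1 ≤ p x) {f : 𝔼 → ℂ}
    (hf : Measurable f) {lam : ℝ≥0∞} (h0 : 0 < lam) (ht : lam ≠ ∞) (hm : modular p lam f < ∞) :
    ∀ᵐ x, maximalAverage σ f x < ∞ ∧ ∀ t : ℝ, 0 < t → Integrable (fun y => f (x - t • y)) σ := by
  obtain ⟨lam', h0', ht', hm'⟩ := exists_modular_le_one hp1 h0 ht hm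
  obtain ⟨H, hH, hfH, hHm⟩ := h.exists_majorant hf.enorm h0'.ne' ht' hm'
  filter_upwards [ae_lt_top_of_lintegral_div_rpow_le hp (fun x => zero_lt_one.trans_le (hp1 x)) hH
    hHm] with x hx
  have hlt : positiveMax σ (fun y => ‖f y‖ₑ) x < ∞ :=
    (hfH x).trans_lt (ENNReal.mul_lt_top ht'.lt_top hx)
  refine ⟨(maximalAverage_le_positiveMax σ f x).trans_lt hlt, fun t ht0 => ?_⟩
  refine ⟨(hf.comp (by fun_prop)).aestronglyMeasurable, ?_⟩
  exact (le_iSup₂ (f := fun (t : ℝ) (_ : 0 < t) => ∫⁻ y, ‖f (x - t • y)‖ₑ ∂σ) t ht0).trans_lt hlt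

/-- Sublinearity. Integrability at every time is needed because otherwise the integral does not
split. -/
lemma maximalAverage_le_add {σ : Measure 𝔼} {f g : 𝔼 → ℂ} {x : 𝔼}
    (hf : ∀ t : ℝ, 0 < t → Integrable (fun y => f (x - t • y)) σ)
    (hg : ∀ t : ℝ, 0 < t → Integrable (fun y => g (x - t • y)) σ) :
    maximalAverage σ f x ≤ maximalAverage σ g x + positiveMax σ (fun y => ‖f y - g y‖ₑ) x := by
  refine iSup₂_le fun t ht => ?_
  have e : ∫ y, f (x - t • y) ∂σ =
      ∫ y, g (x - t • y) ∂σ + ∫ y, (f (x - t • y) - g (x - t • y)) ∂σ := by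
    rw [integral_sub (hf t ht) (hg t ht), add_sub_cancel]
  rw [e]
  refine (enorm_add_le _ _).trans (add_le_add ?_ ((enorm_integral_le_lintegral_enorm _).trans ?_))
  · exact le_iSup₂ (f := fun (t : ℝ) (_ : 0 < t) => ‖∫ y, g (x - t • y) ∂σ‖ₑ) t ht
  · exact le_iSup₂ (f := fun (t : ℝ) (_ : 0 < t) =>
      ∫⁻ y, ‖f (x - t • y) - g (x - t • y)‖ₑ ∂σ) t ht

/-- If the weighted sum of `(H k / D) ^ p` is finite, then `H k` grows at most like `2 ^ k`. -/
lemma tendsto_mul_of_tsum_lt_top {H : ℕ → ℝ≥0∞} {D : ℝ≥0} (hD : D ≠ 0) {p : ℝ} (hp : 1 ≤ p)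
    (hS : ∑' k : ℕ, (2⁻¹ : ℝ≥0∞) ^ k * (H k / D) ^ p < ∞) :
    Tendsto (fun k => (4⁻¹ : ℝ≥0∞) ^ k * H k) atTop (𝓝 0) := by
  set S := ∑' k : ℕ, (2⁻¹ : ℝ≥0∞) ^ k * (H k / D) ^ p with hSdef
  have hDe : (D : ℝ≥0∞) ≠ 0 := by exact_mod_cast hD
  -- A single term of the series gives `(H k / D)^p ≤ 2^k S`; as `p ≥ 1`, either `H k / D ≤ 1` or it
  -- is at most its own power.
  have hk : ∀ k, (4⁻¹ : ℝ≥0∞) ^ k * H k ≤ (2⁻¹ : ℝ≥0∞) ^ k * (D * (1 + S)) := by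
    intro k
    have h2k : (2⁻¹ : ℝ≥0∞) ^ k * 2 ^ k = 1 := by
      rw [← mul_pow, ENNReal.inv_mul_cancel (by simp) (by simp), one_pow]
    have h4 : (4⁻¹ : ℝ≥0∞) ^ k = 2⁻¹ ^ k * 2⁻¹ ^ k := by
      rw [← mul_pow, ← ENNReal.mul_inv (by simp) (by simp)]
      norm_num
    have h1 : (H k / D) ^ p ≤ 2 ^ k * S := by
      calc (H k / D) ^ p = 2 ^ k * ((2⁻¹ : ℝ≥0∞) ^ k * (H k / D) ^ p) := by
            rw [← mul_assoc, mul_comm (2 ^ k), h2k, one_mul]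
        _ ≤ 2 ^ k * S := by
            gcongr
            exact ENNReal.le_tsum (f := fun k => (2⁻¹ : ℝ≥0∞) ^ k * (H k / D) ^ p) k
    have h2 : H k / D ≤ 2 ^ k * (1 + S) := by
      rcases le_total (H k / D) 1 with h | h
      · refine h.trans ?_
        calc (1 : ℝ≥0∞) = 1 * 1 := (one_mul 1).symm
          _ ≤ 2 ^ k * (1 + S) := mul_le_mul' (one_le_pow₀ one_le_two) le_self_add
      · calc H k / D = (H k / D) ^ (1 : ℝ) := (ENNReal.rpow_one _).symm
          _ ≤ (H k / D) ^ p := ENNReal.rpow_le_rpow_of_exponent_le h hp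
          _ ≤ 2 ^ k * S := h1
          _ ≤ _ := by gcongr; exact le_add_self
    calc (4⁻¹ : ℝ≥0∞) ^ k * H k = 2⁻¹ ^ k * (2⁻¹ ^ k * (D * (H k / D))) := by
          rw [ENNReal.mul_div_cancel hDe ENNReal.coe_ne_top, h4, mul_assoc]
      _ ≤ 2⁻¹ ^ k * (2⁻¹ ^ k * (D * (2 ^ k * (1 + S)))) := by gcongr
      _ = 2⁻¹ ^ k * ((2⁻¹ ^ k * 2 ^ k) * (D * (1 + S))) := by ring
      _ = _ := by rw [h2k, one_mul]
  have h0 : Tendsto (fun k => (2⁻¹ : ℝ≥0∞) ^ k * (D * (1 + S))) atTop (𝓝 0) := by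
    have h := ENNReal.Tendsto.mul_const (b := (D : ℝ≥0∞) * (1 + S))
      (ENNReal.tendsto_pow_atTop_nhds_zero_of_lt_one
        (ENNReal.inv_lt_one.2 ENNReal.one_lt_two)) (Or.inr (ENNReal.mul_ne_top ENNReal.coe_ne_top
          (ENNReal.add_ne_top.2 ⟨ENNReal.one_ne_top, hS.ne⟩)))
    rwa [zero_mul] at h
  exact tendsto_of_tendsto_of_tendsto_of_le_of_le tendsto_const_nhds h0 (fun _ => zero_le) hk

/-- The supremum over uncountably many times is an almost everywhere limit of maximal functions of
continuous `φ k`. The errors have norms at most `4^(-k) D`, but only modular bounds on their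
majorants `H k`. Weighting by `2^(-k)` makes the modulars summable, so almost everywhere `H k` grows
at most like `2^k`, and the factor `4^(-k)` wins. -/
lemma PositiveMaxBound.aemeasurable_maximalAverage {σ : Measure 𝔼} [IsFiniteMeasure σ]
    {p : 𝔼 → ℝ} {D : ℝ≥0} (hD : D ≠ 0) (h : PositiveMaxBound σ p D) (hp : Continuous p)
    (hp1 : ∀ x, 1 ≤ p x) {u : ℝ} (hu : ∀ x, p x ≤ u) {f : 𝔼 → ℂ} (hf : Measurable f)
    {lam : ℝ≥0∞} (h0 : 0 < lam) (ht : lam ≠ ∞) (hm : modular p lam f < ∞) :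
    AEMeasurable (maximalAverage σ f) volume := by
  have hp0 : ∀ x, 0 ≤ p x := fun x => zero_le_one.trans (hp1 x)
  have hu0 : 0 ≤ u := (hp0 0).trans (hu 0)
  have happ := modularApproximable_of_lintegral_lt_top hp hp1 hu hf
    (lintegral_enorm_rpow_lt_top hp0 hu h0 ht hm)
  have hex : ∀ k : ℕ, ∃ φ : 𝔼 → ℂ, Continuous φ ∧ (∃ b : ℝ, ∀ x, ‖φ x‖ ≤ b) ∧
      ∃ H : 𝔼 → ℝ≥0∞, Measurable H ∧
        (∀ x, positiveMax σ (fun y => ‖f y - φ y‖ₑ) x ≤ (4⁻¹ : ℝ≥0∞) ^ k * H x) ∧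
        ∫⁻ x, (H x / D) ^ p x ≤ 1 := by
    intro k
    have hl0 : (4⁻¹ : ℝ≥0∞) ^ k ≠ 0 := pow_ne_zero _ (by simp)
    have hlt : (4⁻¹ : ℝ≥0∞) ^ k ≠ ∞ := ENNReal.pow_ne_top (by simp)
    have h4k : (1 : ℝ≥0∞) ≤ 4 ^ k := one_le_pow₀ (by norm_num)
    have h4t : ((4 : ℝ≥0∞) ^ k) ^ u ≠ ∞ :=
      ENNReal.rpow_ne_top_of_nonneg hu0 (ENNReal.pow_ne_top (by simp))
    have h40 : ((4 : ℝ≥0∞) ^ k) ^ u ≠ 0 :=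
      (ENNReal.rpow_pos (zero_lt_one.trans_le h4k) (ENNReal.pow_ne_top (by simp))).ne'
    obtain ⟨φ, hφ, hb, hφm⟩ := happ (((4 : ℝ≥0∞) ^ k) ^ u)⁻¹ (ENNReal.inv_ne_zero.2 h4t)
    have hmod : ∫⁻ x, (‖f x - φ x‖ₑ / 4⁻¹ ^ k) ^ p x ≤ 1 := by
      calc ∫⁻ x, (‖f x - φ x‖ₑ / 4⁻¹ ^ k) ^ p x
          ≤ ∫⁻ x, (4 ^ k) ^ u * ‖f x - φ x‖ₑ ^ p x := by
            refine lintegral_mono fun x => ?_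
            rw [div_eq_mul_inv, ENNReal.inv_pow, inv_inv, mul_comm]
            exact mul_rpow_le_of_one_le h4k (hp0 x) (hu x)
        _ = (4 ^ k) ^ u * ∫⁻ x, ‖f x - φ x‖ₑ ^ p x := lintegral_const_mul' _ _ h4t
        _ ≤ (4 ^ k) ^ u * (((4 : ℝ≥0∞) ^ k) ^ u)⁻¹ := by gcongr
        _ = 1 := ENNReal.mul_inv_cancel h40 h4t
    obtain ⟨H, hH, hfH, hHm⟩ := h.exists_majorant (hf.sub hφ.measurable).enorm hl0 hlt hmod
    exact ⟨φ, hφ, hb, H, hH, hfH, hHm⟩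
  choose φ hφ hb H hH hfH hHm using hex
  choose b hb using hb
  have hSfin : ∀ᵐ x, ∑' k : ℕ, (2⁻¹ : ℝ≥0∞) ^ k * (H k x / D) ^ p x < ∞ := by
    have hmeas : ∀ k : ℕ, Measurable fun x => (2⁻¹ : ℝ≥0∞) ^ k * (H k x / D) ^ p x := fun k =>
      (((hH k).div_const _).pow hp.measurable).const_mul _
    refine ae_lt_top (Measurable.tsum hmeas) (ne_of_lt ?_)
    rw [lintegral_tsum fun k => (hmeas k).aemeasurable]
    calc ∑' k : ℕ, ∫⁻ x, (2⁻¹ : ℝ≥0∞) ^ k * (H k x / D) ^ p x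
        ≤ ∑' k : ℕ, (2⁻¹ : ℝ≥0∞) ^ k := by
          refine ENNReal.tsum_le_tsum fun k => ?_
          rw [lintegral_const_mul' _ _ (ENNReal.pow_ne_top (by simp))]
          exact mul_le_of_le_one_right' (hHm k)
      _ = 2 := by rw [ENNReal.tsum_geometric, ENNReal.one_sub_inv_two, inv_inv]
      _ < ∞ := by simp
  refine aemeasurable_of_tendsto_metrizable_ae' (f := fun k => maximalAverage σ (φ k))
    (fun k => (measurable_maximalAverage_of_continuous (hφ k) (hb k)).aemeasurable) ?_
  filter_upwards [hSfin, h.ae_integrable hp.measurable hp1 hf h0 ht hm] with x hx hint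
  have hφint : ∀ k (t : ℝ), 0 < t → Integrable (fun y => φ k (x - t • y)) σ := fun k t _ =>
    (integrable_const (b k)).mono' ((hφ k).comp (by fun_prop)).aestronglyMeasurable
      (ae_of_all _ fun y => hb k _)
  have hlim := tendsto_mul_of_tsum_lt_top hD (hp1 x) hx
  refine tendsto_of_sub_le_of_le_add hint.1.ne hlim (fun k => ?_) fun k => ?_
  · rw [tsub_le_iff_right]
    refine (maximalAverage_le_add hint.2 (hφint k)).trans ?_
    gcongr
    exact hfH k x
  · refine (maximalAverage_le_add (hφint k) hint.2).trans ?_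
    gcongr
    refine le_trans (le_of_eq ?_) (hfH k x)
    congr 1
    ext y
    exact enorm_sub_rev _ _

lemma PositiveMaxBound.modular_maximalAverage_le {σ : Measure 𝔼} {p : 𝔼 → ℝ} {D : ℝ≥0}
    (h : PositiveMaxBound σ p D) (hp0 : ∀ x, 0 ≤ p x) {f : 𝔼 → ℂ} (hf : Measurable f)
    {lam : ℝ≥0∞} (h0 : 0 < lam) (ht : lam ≠ ∞) (hm : modular p lam f ≤ 1) :
    modular p (D * lam) (maximalAverage σ f) ≤ 1 := by
  obtain ⟨H, hH, hfH, hHm⟩ := h.exists_majorant hf.enorm h0.ne' ht hm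
  refine le_trans (lintegral_mono fun x => ENNReal.rpow_le_rpow ?_ (hp0 x)) hHm
  rw [enorm_eq_self]
  calc maximalAverage σ f x / (D * lam) ≤ (lam * H x) / (lam * D) := by
        rw [mul_comm (D : ℝ≥0∞)]
        exact ENNReal.div_le_div_right ((maximalAverage_le_positiveMax σ f x).trans (hfH x)) _
    _ = H x / D := ENNReal.mul_div_mul_left _ _ h0.ne' ht

lemma modular_congr_ae {ε : Type*} [ENorm ε] {p : 𝔼 → ℝ} {f g : 𝔼 → ε}
    (h : f =ᵐ[volume] g) (lam : ℝ≥0∞) : modular p lam f = modular p lam g :=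
  lintegral_congr_ae (h.mono fun x hx => by simp only [hx])

/-- Everything is proved for a Borel representative `g`. For almost every `x` no dilate of `σ`
centred at `x` charges the set `{f ≠ g}`, so `f` and `g` have the same averages there at all times.
-/
theorem PositiveMaxBound.maximalAverage_bound {σ : Measure 𝔼} [IsFiniteMeasure σ]
    {p : 𝔼 → ℝ} {D : ℝ≥0} (hD : D ≠ 0) (h : PositiveMaxBound σ p D) (hp : Continuous p)
    (hp1 : ∀ x, 1 ≤ p x) {u : ℝ} (hu : ∀ x, p x ≤ u) {f : 𝔼 → ℂ} (hf : MemVarLp p f) :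
    (∀ᵐ x : 𝔼 ∂volume, ∀ t : ℝ, 0 < t → Integrable (fun y => f (x - t • y)) σ) ∧
      MemVarLp p (maximalAverage σ f) ∧
      varLpNorm p (maximalAverage σ f) ≤ D * varLpNorm p f := by
  have hp0 : ∀ x, 0 ≤ p x := fun x => zero_le_one.trans (hp1 x)
  obtain ⟨hfm, lam, hlam0, hlamt, hmod⟩ := hf
  obtain ⟨g, hg, hfg⟩ := hfm
  have hgm : Measurable g := hg.measurable
  have hcongr : ∀ᵐ x, ∀ t : ℝ, 0 < t → (fun y => g (x - t • y)) =ᵐ[σ] fun y => f (x - t • y) := by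
    filter_upwards [h.ae_forall_ae_notMem hp.measurable (fun x => zero_lt_one.trans_le (hp1 x))
      (ae_iff.1 hfg)] with x hx t ht
    filter_upwards [hx t ht] with y hy
    exact (not_not.1 hy).symm
  have hmax : maximalAverage σ f =ᵐ[volume] maximalAverage σ g := by
    filter_upwards [hcongr] with x hx
    refine iSup_congr fun t => iSup_congr fun ht => ?_
    rw [integral_congr_ae (hx t ht)]
  have hmodg : modular p lam g < ∞ := by rwa [← modular_congr_ae hfg]
  have hDe : (D : ℝ≥0∞) ≠ 0 := by exact_mod_cast hD
  have hkey : ∀ lam' : ℝ≥0∞, 0 < lam' → lam' ≠ ∞ → modular p lam' f ≤ 1 →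
      0 < D * lam' ∧ D * lam' ≠ ∞ ∧ modular p (D * lam') (maximalAverage σ f) ≤ 1 := by
    intro lam' h0' ht' hm'
    refine ⟨ENNReal.mul_pos hDe h0'.ne', ENNReal.mul_ne_top ENNReal.coe_ne_top ht', ?_⟩
    rw [modular_congr_ae hmax]
    rw [modular_congr_ae hfg] at hm'
    exact h.modular_maximalAverage_le hp0 hgm h0' ht' hm'
  refine ⟨?_, ⟨?_, ?_⟩, ?_⟩
  · filter_upwards [hcongr, h.ae_integrable hp.measurable hp1 hgm hlam0 hlamt hmodg]
      with x hx hx' t ht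
    exact (hx'.2 t ht).congr (hx t ht)
  · exact ((h.aemeasurable_maximalAverage hD hp hp1 hu hgm hlam0 hlamt hmodg).congr
      hmax.symm).aestronglyMeasurable
  · obtain ⟨lam', h0', ht', hm'⟩ := exists_modular_le_one hp1 hlam0 hlamt hmod
    obtain ⟨h1, h2, h3⟩ := hkey lam' h0' ht' hm'
    exact ⟨D * lam', h1, h2, h3.trans_lt ENNReal.one_lt_top⟩
  · rw [mul_comm, ← ENNReal.div_le_iff hDe ENNReal.coe_ne_top]
    refine le_sInf fun lam' ⟨h0', ht', hm'⟩ => ?_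
    rw [ENNReal.div_le_iff hDe ENNReal.coe_ne_top, mul_comm]
    exact sInf_le (hkey lam' h0' ht' hm')

/-- This spares checking that Schwartz functions belong to the space: where the norm is infinite the
inequality is trivial. -/
lemma varLpNorm_eq_top_or_memVarLp (p : 𝔼 → ℝ) {f : 𝔼 → ℂ} (hf : AEStronglyMeasurable f volume) :
    varLpNorm p f = ∞ ∨ MemVarLp p f := by
  by_cases h : ∃ lam : ℝ≥0∞, 0 < lam ∧ lam ≠ ∞ ∧ modular p lam f ≤ 1
  · obtain ⟨lam, h0, ht, hm⟩ := h
    exact Or.inr ⟨hf, lam, h0, ht, hm.trans_lt ENNReal.one_lt_top⟩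
  · left
    rw [varLpNorm, sInf_eq_top]
    exact fun lam hlam => absurd ⟨lam, hlam⟩ h

/-! ### From the essential bounds of the exponent to the theorem. -/

lemma GloballyLogHolder.exists_le {p : 𝔼 → ℝ} (hp : GloballyLogHolder p) : ∃ b, ∀ x, p x ≤ b := by
  obtain ⟨pInf, c₂, -, hc₂, h⟩ := hp.decay
  refine ⟨pInf + c₂, fun x => ?_⟩
  have h1 : 1 ≤ Real.log (Real.exp 1 + ‖x‖) := by
    rw [Real.le_log_iff_exp_le (by positivity)]
    linarith [norm_nonneg x]
  have h2 : c₂ * (1 / Real.log (Real.exp 1 + ‖x‖)) ≤ c₂ :=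
    mul_le_of_le_one_right hc₂.le ((div_le_one (by linarith)).2 h1)
  linarith [(abs_le.1 (h x)).2]

/-- A set of full measure is dense, and the set where the inequality holds is closed. -/
lemma forall_le_of_ae_le {f g : 𝔼 → ℝ} (hf : Continuous f) (hg : Continuous g)
    (h : ∀ᵐ x, f x ≤ g x) (x : 𝔼) : f x ≤ g x := by
  have hx : x ∈ closure {x | f x ≤ g x} := Measure.dense_of_ae h x
  rwa [(isClosed_le hf hg).closure_eq] at hx

lemma GloballyLogHolder.essInf_le {p : 𝔼 → ℝ} (hp : GloballyLogHolder p) (x : 𝔼) :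
    essInf p volume ≤ p x :=
  forall_le_of_ae_le continuous_const hp.continuous
    (ae_essInf_le ⟨0, eventually_map.2 (Eventually.of_forall fun x => (hp.pos x).le)⟩) x

lemma GloballyLogHolder.le_essSup {p : 𝔼 → ℝ} (hp : GloballyLogHolder p) (x : 𝔼) :
    p x ≤ essSup p volume := by
  obtain ⟨b, hb⟩ := hp.exists_le
  exact forall_le_of_ae_le hp.continuous continuous_const
    (ae_le_essSup ⟨b, eventually_map.2 (Eventually.of_forall hb)⟩) x

/-- With `N = n - β` and `γ = 2α - 1` the hypotheses become `2N + γ < p₋ (N + γ)` and `N p₊ < 2N +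
γ`, the form in which the interpolation weight is chosen. -/
theorem exists_positiveMaxBound (hn : 1 ≤ n) {σ : Measure 𝔼} [IsFiniteMeasure σ]
    (hσ : CompactlySupported σ) {α β : ℝ} (hα : 1 / 2 < α) (hβ0 : 0 ≤ β) (hβn : β ≤ n)
    (hdim : LocallyUniformlyDimensional σ β)
    (hdecay : ∃ C : ℝ, ∀ ξ : 𝔼,
      Real.sqrt (∫ t in (1 : ℝ)..2, ‖measureFourier σ (t • ξ)‖ ^ 2) ≤ C * (1 + ‖ξ‖) ^ (-α))
    (hgrad : ∃ C : ℝ, ∀ ξ : 𝔼,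
      Real.sqrt (∫ t in (1 : ℝ)..2, gradNormSq (measureFourier σ) (t • ξ)) ≤
        C * (1 + ‖ξ‖) ^ (-α))
    {p : 𝔼 → ℝ} (hp : GloballyLogHolder p)
    (hp_lower : (2 * n + 2 * α - 2 * β - 1) / (n + 2 * α - β - 1) < essInf p volume)
    (hp_upper : β < n → essSup p volume < (2 * n + 2 * α - 2 * β - 1) / (n - β)) :
    ∃ D : ℝ≥0, D ≠ 0 ∧ PositiveMaxBound σ p D ∧ (∀ x, 1 ≤ p x) ∧ ∃ u, ∀ x, p x ≤ u := by
  have hd : 0 < n + 2 * α - β - 1 := by linarith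
  have h1 : 2 * (n - β) + (2 * α - 1) < essInf p volume * ((n - β) + (2 * α - 1)) := by
    rw [div_lt_iff₀ hd] at hp_lower
    linarith
  have hl1 : 1 < essInf p volume := by nlinarith
  obtain ⟨u, hu, h2⟩ : ∃ u, (∀ x, p x ≤ u) ∧ (n - β) * u < 2 * (n - β) + (2 * α - 1) := by
    rcases hβn.lt_or_eq with h | h
    · refine ⟨essSup p volume, hp.le_essSup, ?_⟩
      have := hp_upper h
      rw [lt_div_iff₀ (by linarith)] at this
      linarith
    -- For `β = n` the factor `n - β` vanishes, so any upper bound for `p` will do, and the decay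
    -- condition provides one.
    · obtain ⟨b, hb⟩ := hp.exists_le
      refine ⟨b, hb, ?_⟩
      rw [h]
      linarith
  have hp1 : ∀ x, 1 ≤ p x := fun x => hl1.le.trans (hp.essInf_le x)
  obtain ⟨A, ε, hA, hε, hlow, hpiece⟩ := exists_maximalBound_dyadicPiece hn hσ hα hβ0 hβn hdim hdecay
    hgrad hp (by linarith) hp.essInf_le hu h1 h2
  obtain ⟨D, hD, hbound⟩ := exists_modular_maximalAverage_le hσ hp.continuous.measurable hp1 hA hε
    hlow hpiece
  exact ⟨2 * D, (by positivity), positiveMaxBound_of_continuous hp.continuous hp1 hbound, hp1, u, hu⟩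

end MaximalMultiplier


theorem theorem2p2 (n : ℕ) (hn : 1 ≤ n)
    (σ : MeasureTheory.Measure (EuclideanSpace ℝ (Fin n)))
    (hσ : MaximalMultiplier.CompactlySupported σ)
    (m : EuclideanSpace ℝ (Fin n) → ℂ)
    (hm : m = MaximalMultiplier.measureFourier σ)
    (α β : ℝ) (hα : 1 / 2 < α) (hβ0 : 0 ≤ β) (hβn : β ≤ n)
    (hdim : MaximalMultiplier.LocallyUniformlyDimensional σ β)
    (hdecay : ∃ C : ℝ, ∀ ξ : EuclideanSpace ℝ (Fin n),
      Real.sqrt (∫ t in (1 : ℝ)..2, ‖m (t • ξ)‖ ^ 2) ≤ C * (1 + ‖ξ‖) ^ (-α))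
    (hgrad : ∃ C : ℝ, ∀ ξ : EuclideanSpace ℝ (Fin n),
      Real.sqrt (∫ t in (1 : ℝ)..2, MaximalMultiplier.gradNormSq m (t • ξ)) ≤
        C * (1 + ‖ξ‖) ^ (-α))
    (p : EuclideanSpace ℝ (Fin n) → ℝ)
    (hp : MaximalMultiplier.GloballyLogHolder p)
    (hp_lower : (2 * n + 2 * α - 2 * β - 1) / (n + 2 * α - β - 1) < essInf p volume)
    -- for `β = n` the upper bound is `+∞`, and the condition is void
    (hp_upper : β < n → essSup p volume < (2 * n + 2 * α - 2 * β - 1) / (n - β)) :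
    ∃ C : ℝ≥0,
      (∀ f : 𝓢(EuclideanSpace ℝ (Fin n), ℂ),
        MaximalMultiplier.maximalMultiplier m f =
            MaximalMultiplier.maximalAverage σ (fun x => f x) ∧
        MaximalMultiplier.varLpNorm p (MaximalMultiplier.maximalMultiplier m f) ≤
          C * MaximalMultiplier.varLpNorm p (fun x => f x)) ∧
      (∀ f : EuclideanSpace ℝ (Fin n) → ℂ, MaximalMultiplier.MemVarLp p f →
        (∀ᵐ x : EuclideanSpace ℝ (Fin n) ∂volume, ∀ t : ℝ, 0 < t →
          Integrable (fun y => f (x - t • y)) σ) ∧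
        MaximalMultiplier.MemVarLp p (MaximalMultiplier.maximalAverage σ f) ∧
        MaximalMultiplier.varLpNorm p (MaximalMultiplier.maximalAverage σ f) ≤
          C * MaximalMultiplier.varLpNorm p f) := by
  subst hm
  have := MaximalMultiplier.LocallyUniformlyDimensional.isFiniteMeasure hσ hdim
  obtain ⟨D, hD, hbound, hp1, u, hu⟩ := MaximalMultiplier.exists_positiveMaxBound hn hσ hα hβ0 hβn
    hdim hdecay hgrad hp hp_lower hp_upper
  have hmain := fun (f : EuclideanSpace ℝ (Fin n) → ℂ) (hf : MaximalMultiplier.MemVarLp p f) =>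
    hbound.maximalAverage_bound hD hp.continuous hp1 hu hf
  refine ⟨D, fun f => ⟨MaximalMultiplier.maximalMultiplier_measureFourier f, ?_⟩, hmain⟩
  rw [MaximalMultiplier.maximalMultiplier_measureFourier f]
  rcases MaximalMultiplier.varLpNorm_eq_top_or_memVarLp p
    (f := fun x => f x) f.continuous.aestronglyMeasurable with h | h
  -- The constant must be nonzero here, as `0 * ∞ = 0`.
  · rw [h, ENNReal.mul_top (by exact_mod_cast hD)]
    exact le_top
  · exact (hmain _ h).2.2
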